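/- Let $g\ge 1$, let $\mathbb D=\{x\in\mathbb C:|x|\le 1\}$, and let $\mathbf z\subset\mathbb D$ be a set of $2g+2$ points in the interior of $\mathbb D$. Let $\mathrm{Diff}(\mathbb D,\mathbf z)$ be the group of $C^\infty$ diffeomorphisms of $\mathbb D$ that fix $\partial\mathbb D$ pointwise and preserve the set $\mathbf z$, and let $B_{2g+2}$ be the braid group, i.e. the quotient of $\mathrm{Diff}(\mathbb D,\mathbf z)$ by the normal subgroup of those elements that are smoothly isotopic to the identity within $\mathrm{Diff}(\mathbb D,\mathbf z)$. Let $$\Sigma=\Sigma_g^2=\{(x,w)\in\mathbb C^2 : |x|\le 1,\ w^2=\textstyle\prod_{a\in\mathbf z}(x-a)\},\qquad p:\Sigma\to\mathbb D,\quad p(x,w)=x,$$ be the double cover of $\mathbb D$ branched over $\mathbf z$, a smooth compact surface of genus $g$ with two boundary components. Let $\mathrm{Diff}(\Sigma,\partial\Sigma)\subset\mathrm{Homeo}(\Sigma,\partial\Sigma)$ be its groups of $C^\infty$ diffeomorphisms and of homeomorphisms that fix $\partial\Sigma$ pointwise, and let $\mathrm{Mod}_g^2$ be the quotient of $\mathrm{Homeo}(\Sigma,\partial\Sigma)$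 by the normal subgroup of those elements that are isotopic to the identity within $\mathrm{Homeo}(\Sigma,\partial\Sigma)$. The two groups of diffeomorphisms carry the $C^\infty$ topology. Every $f\in\mathrm{Diff}(\mathbb D,\mathbf z)$ has exactly one lift $\Psi(f)\in\mathrm{Homeo}(\Sigma,\partial\Sigma)$, that is, with $p\circ\Psi(f)=f\circ p$; the map $\Psi$ is a homomorphism, and it induces a homomorphism $\psi:B_{2g+2}\to\mathrm{Mod}_g^2$, $\psi([f])=[\Psi(f)]$, called the geometric homomorphism. **Theorem.** There is a continuous homomorphism $\rho:\mathrm{Diff}(\mathbb D,\mathbf z)\to\mathrm{Diff}(\Sigma,\partial\Sigma)$ that induces the geometric homomorphism on mapping class groups: $[\rho(f)]=\psi([f])$ in $\mathrm{Mod}_g^2$ for every $f\in\mathrm{Diff}(\mathbb D,\mathbf z)$. Moreover, $\rho$ can be chosen so that $\rho(f)$ is the identity near $\partial\Sigma$ whenever $f$ is the identity near $\partial\mathbb D$. -/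

import Mathlib

open Set Topology
open scoped ContDiff unitInterval

namespace BranchedLift

section General

variable {E F G : Type*} [NormedAddCommGroup E] [NormedSpace ℝ E]
  [NormedAddCommGroup F] [NormedSpace ℝ F] [NormedAddCommGroup G] [NormedSpace ℝ G]

/-- A map from a subset `X` of a normed space is smooth if near every point of `X` it extends to a
`C^∞` map on a neighbourhood in the ambient space. For an embedded submanifold (possibly with
boundary or corners) this is the usual notion of a smooth map. -/
def IsSmooth {X : Set E} (f : X → F) : Prop :=
  ∀ x : X, ∃ U ∈ 𝓝 (x : E), ∃ f' : E → F, ContDiffOn ℝ ∞ f' U ∧ ∀ y : X, (y : E) ∈ U → f' y = f y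

theorem IsSmooth.of_contDiff {X : Set E} {f : E → F} (hf : ContDiff ℝ ∞ f) :
    IsSmooth (fun x : X => f x) :=
  fun _ => ⟨univ, Filter.univ_mem, f, hf.contDiffOn, fun _ _ => rfl⟩

theorem IsSmooth.comp {X : Set E} {Y : Set F} {g : Y → G} {f : X → Y} (hg : IsSmooth g)
    (hf : IsSmooth (fun x => (f x : F))) : IsSmooth (fun x => g (f x)) := by
  intro x
  obtain ⟨U, hU, f', hf', hfU⟩ := hf x
  obtain ⟨V, hV, g', hg', hgV⟩ := hg (f x)
  have hx : f' x = f x := hfU x (mem_of_mem_nhds hU)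
  have hc : ContinuousAt f' x := (hf'.continuousOn).continuousAt hU
  have hW : f' ⁻¹' V ∈ 𝓝 (x : E) := hc.preimage_mem_nhds (by rw [hx]; exact hV)
  refine ⟨U ∩ f' ⁻¹' V, Filter.inter_mem hU hW, g' ∘ f',
    hg'.comp (hf'.mono inter_subset_left) (fun y hy => hy.2), ?_⟩
  intro y hy
  have h1 : f' y = f y := hfU y hy.1
  have h2 : (f y : F) ∈ V := h1 ▸ hy.2
  rw [Function.comp_apply, h1]
  exact hgV (f y) h2

theorem IsSmooth.prodMk {X : Set E} {f : X → F} {g : X → G} (hf : IsSmooth f) (hg : IsSmooth g) :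
    IsSmooth (fun x => (f x, g x)) := by
  intro x
  obtain ⟨U, hU, f', hf', hfU⟩ := hf x
  obtain ⟨V, hV, g', hg', hgV⟩ := hg x
  refine ⟨U ∩ V, Filter.inter_mem hU hV, fun y => (f' y, g' y),
    (hf'.mono inter_subset_left).prodMk (hg'.mono inter_subset_right), ?_⟩
  intro y hy
  exact Prod.ext (hfU y hy.1) (hgV y hy.2)

/-- The group of diffeomorphisms of a submanifold `X` of a normed space, inside its group of
homeomorphisms. -/
def diffGroup (X : Set E) : Subgroup (X ≃ₜ X) where
  carrier := {f | IsSmooth (fun x => (f x : E)) ∧ IsSmooth (fun x => ((f⁻¹ : X ≃ₜ X) x : E))}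
  one_mem' := ⟨IsSmooth.of_contDiff contDiff_id, IsSmooth.of_contDiff contDiff_id⟩
  mul_mem' := by
    rintro f g ⟨hf, hf'⟩ ⟨hg, hg'⟩
    refine ⟨hf.comp (f := g) hg, ?_⟩
    rw [mul_inv_rev]
    exact hg'.comp (f := (f⁻¹ : X ≃ₜ X)) hf'
  inv_mem' := by
    rintro f ⟨hf, hf'⟩
    exact ⟨hf', by rw [inv_inv]; exact hf⟩

/-- The diffeomorphisms of `X` that belong to a given group `K` of homeomorphisms. -/
def diffIn {X : Set E} (K : Subgroup (X ≃ₜ X)) : Subgroup (X ≃ₜ X) := diffGroup X ⊓ K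

/-- The inclusion of a group of diffeomorphisms into the corresponding group of homeomorphisms. -/
def diffInclusion {X : Set E} (K : Subgroup (X ≃ₜ X)) : diffIn K →* K :=
  Subgroup.inclusion inf_le_right

/-- Smooth maps from the square `[0,1]²` to `X`. -/
def SmoothSquare (X : Set E) : Type _ :=
  {c : ℝ × ℝ → X // ContDiffOn ℝ ∞ (fun t => (c t : E)) (Icc (0 : ℝ × ℝ) 1)}

/-- The `C^∞` topology on a group of diffeomorphisms of a compact surface `X` (possibly with
boundary): the coarsest topology such that, for every smooth map `c` from the square to `X` (in
particular for every parametrization of a piece of `X`) and every `k`, the `k`-th derivative of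
`f ∘ c` depends continuously on `f`, in the sense of uniform convergence on the square. -/
noncomputable instance cInftyTopology {X : Set E} (K : Subgroup (X ≃ₜ X)) : TopologicalSpace (diffIn K) :=
  ⨅ (c : SmoothSquare X) (k : ℕ),
    TopologicalSpace.induced
      (fun f : diffIn K => UniformOnFun.ofFun {Icc (0 : ℝ × ℝ) 1}
        (iteratedFDerivWithin ℝ k (fun t => ((f : X ≃ₜ X) (c.1 t) : E)) (Icc (0 : ℝ × ℝ) 1)))
      inferInstance

/-- The map `[0,1] × X → E` given by a family, indexed by `[0,1]`, of homeomorphisms of `X ⊆ E`. -/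
def familyMap {X : Set E} (H : I → X ≃ₜ X) (p : (Icc (0 : ℝ) 1 ×ˢ X : Set (ℝ × E))) : E :=
  H ⟨p.1.1, p.2.1⟩ ⟨p.1.2, p.2.2⟩

theorem familyMap_comp_smooth {X : Set E} {H K : I → X ≃ₜ X} {s : I → I}
    (hs : IsSmooth (fun p : (Icc (0 : ℝ) 1 ×ˢ X : Set (ℝ × E)) => (s ⟨p.1.1, p.2.1⟩ : ℝ)))
    (hH : IsSmooth (familyMap H)) (hK : IsSmooth (familyMap K)) :
    IsSmooth (familyMap (fun t => H (s t) * K t)) :=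
  hH.comp (Y := (Icc (0 : ℝ) 1 ×ˢ X : Set (ℝ × E)))
    (f := fun p => ⟨((s ⟨p.1.1, p.2.1⟩ : ℝ), familyMap K p), ⟨(s ⟨p.1.1, p.2.1⟩).2, (K ⟨p.1.1, p.2.1⟩ ⟨p.1.2, p.2.2⟩).2⟩⟩) (hs.prodMk hK)

theorem familyMap_const_smooth {X : Set E} {f : X ≃ₜ X} (hf : IsSmooth (fun x => (f x : E))) :
    IsSmooth (familyMap (fun _ => f)) :=
  hf.comp (f := fun p : (Icc (0 : ℝ) 1 ×ˢ X : Set (ℝ × E)) => ⟨p.1.2, p.2.2⟩)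
    (IsSmooth.of_contDiff contDiff_snd)

theorem smooth_time {X : Set E} :
    IsSmooth (fun p : (Icc (0 : ℝ) 1 ×ˢ X : Set (ℝ × E)) => ((⟨p.1.1, p.2.1⟩ : I) : ℝ)) :=
  IsSmooth.of_contDiff contDiff_fst

theorem smooth_symm_time {X : Set E} :
    IsSmooth (fun p : (Icc (0 : ℝ) 1 ×ˢ X : Set (ℝ × E)) =>
      ((unitInterval.symm ⟨p.1.1, p.2.1⟩ : I) : ℝ)) :=
  IsSmooth.of_contDiff (f := fun p : ℝ × E => 1 - p.1) (contDiff_const.sub contDiff_fst)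

/-- The diffeomorphisms in `K` that are smoothly isotopic to the identity through diffeomorphisms
in `K`. -/
def smoothIsotopyOne {X : Set E} (K : Subgroup (X ≃ₜ X)) : Subgroup (diffIn K) where
  carrier := {f | ∃ H : I → diffIn K,
    IsSmooth (familyMap fun t => (H t : X ≃ₜ X)) ∧ H 0 = 1 ∧ H 1 = f}
  one_mem' := ⟨fun _ => 1, familyMap_const_smooth (1 : diffIn K).2.1.1, rfl, rfl⟩
  mul_mem' := by
    rintro f g ⟨H, hH, H0, H1⟩ ⟨L, hL, L0, L1⟩
    exact ⟨fun t => H t * L t, familyMap_comp_smooth (s := id) smooth_time hH hL,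
      by simp [H0, L0], by simp [H1, L1]⟩
  inv_mem' := by
    rintro f ⟨H, hH, H0, H1⟩
    refine ⟨fun t => f⁻¹ * H (unitInterval.symm t), ?_, by simp [H1], by simp [H0]⟩
    have h1 : IsSmooth (familyMap fun t => (H (unitInterval.symm t) : X ≃ₜ X)) := by
      have := familyMap_comp_smooth (s := unitInterval.symm) (K := fun _ => (1 : X ≃ₜ X))
        smooth_symm_time hH (familyMap_const_smooth (1 : diffIn K).2.1.1)
      simpa using this
    exact familyMap_comp_smooth (s := id) smooth_time (familyMap_const_smooth f.2.1.2) h1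

instance {X : Set E} (K : Subgroup (X ≃ₜ X)) : (smoothIsotopyOne K).Normal where
  conj_mem := by
    rintro f ⟨H, hH, H0, H1⟩ g
    refine ⟨fun t => g * H t * g⁻¹, ?_, by simp [H0], by simp [H1]⟩
    exact familyMap_comp_smooth (s := id) (H := fun t => ((g * H t : diffIn K) : X ≃ₜ X))
      (K := fun _ => ((g⁻¹ : diffIn K) : X ≃ₜ X)) smooth_time
      (familyMap_comp_smooth (s := id) smooth_time (familyMap_const_smooth g.2.1.1) hH)
      (familyMap_const_smooth g.2.1.2)

/-- Diffeomorphisms in `K` modulo smooth isotopy through diffeomorphisms in `K`. -/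
abbrev SmoothMod {X : Set E} (K : Subgroup (X ≃ₜ X)) : Type _ := diffIn K ⧸ smoothIsotopyOne K

end General

section Topological

variable {X : Type*} [TopologicalSpace X]

/-- The homeomorphisms in `K` that are isotopic to the identity through homeomorphisms in `K`. -/
def isotopyOne (K : Subgroup (X ≃ₜ X)) : Subgroup K where
  carrier := {f | ∃ H : I → K,
    Continuous (fun p : I × X => (H p.1 : X ≃ₜ X) p.2) ∧ H 0 = 1 ∧ H 1 = f}
  one_mem' := ⟨fun _ => 1, continuous_snd, rfl, rfl⟩
  mul_mem' := by
    rintro f g ⟨H, hH, H0, H1⟩ ⟨L, hL, L0, L1⟩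
    exact ⟨fun t => H t * L t, hH.comp (continuous_fst.prodMk hL),
      by simp [H0, L0], by simp [H1, L1]⟩
  inv_mem' := by
    rintro f ⟨H, hH, H0, H1⟩
    exact ⟨fun t => f⁻¹ * H (unitInterval.symm t),
      ((f : X ≃ₜ X)⁻¹).continuous.comp
        (hH.comp ((unitInterval.continuous_symm.comp continuous_fst).prodMk continuous_snd)),
      by simp [H1], by simp [H0]⟩

instance (K : Subgroup (X ≃ₜ X)) : (isotopyOne K).Normal where
  conj_mem := by
    rintro f ⟨H, hH, H0, H1⟩ g
    exact ⟨fun t => g * H t * g⁻¹,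
      (g : X ≃ₜ X).continuous.comp
        (hH.comp (continuous_fst.prodMk (((g : X ≃ₜ X)⁻¹).continuous.comp continuous_snd))),
      by simp [H0], by simp [H1]⟩

/-- Homeomorphisms in `K` modulo isotopy through homeomorphisms in `K`. -/
abbrev TopMod (K : Subgroup (X ≃ₜ X)) : Type _ := K ⧸ isotopyOne K

end Topological

/-- The closed unit disc `𝔻` in `ℂ`. -/
def disc : Set ℂ := {x | ‖x‖ ≤ 1}

/-- The homeomorphisms of the disc that fix the boundary circle pointwise and preserve the set `z`
of marked points. -/
def homeoDisc (z : Finset ℂ) : Subgroup (disc ≃ₜ disc) where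
  carrier := {f | (∀ x : disc, ‖(x : ℂ)‖ = 1 → f x = x) ∧
    ∀ x : disc, (f x : ℂ) ∈ z ↔ (x : ℂ) ∈ z}
  one_mem' := ⟨fun _ _ => rfl, fun _ => Iff.rfl⟩
  mul_mem' := by
    rintro f g ⟨hf, hf'⟩ ⟨hg, hg'⟩
    refine ⟨fun x hx => ?_, fun x => (hf' (g x)).trans (hg' x)⟩
    change f (g x) = x
    rw [hg x hx, hf x hx]
  inv_mem' := by
    rintro f ⟨hf, hf'⟩
    refine ⟨fun x hx => ?_, fun x => ?_⟩
    · exact f.symm_apply_eq.2 (hf x hx).symm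
    · have := hf' (f.symm x)
      rw [f.apply_symm_apply] at this
      exact this.symm

/-- The double cover of the disc branched over `z`, as the part over the disc of the affine
hyperelliptic curve `w² = ∏_{a ∈ z} (x - a)` in `ℂ²`. When `z` consists of `2g+2` points of the open
disc, this is a compact smooth surface of genus `g` whose boundary (the part over the unit circle)
has two components. -/
def surface (z : Finset ℂ) : Set (ℂ × ℂ) := {p | ‖p.1‖ ≤ 1 ∧ p.2 ^ 2 = ∏ a ∈ z, (p.1 - a)}

/-- The branched covering map `(x, w) ↦ x`. -/
def proj (z : Finset ℂ) (q : surface z) : disc := ⟨q.1.1, q.2.1⟩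

/-- The homeomorphisms of the branched double cover that fix its boundary pointwise. -/
def homeoSurface (z : Finset ℂ) : Subgroup (surface z ≃ₜ surface z) where
  carrier := {h | ∀ q : surface z, ‖(proj z q : ℂ)‖ = 1 → h q = q}
  one_mem' := fun _ _ => rfl
  mul_mem' := by
    intro f g hf hg x hx
    change f (g x) = x
    rw [hg x hx, hf x hx]
  inv_mem' := by
    intro f hf x hx
    exact f.symm_apply_eq.2 (hf x hx).symm

/-- `Diff(𝔻, z)`, with the `C^∞` topology. -/
abbrev DiffDisc (z : Finset ℂ) : Type := diffIn (homeoDisc z)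

/-- The braid group, as the mapping class group of the disc with marked points `z`:
`Diff(𝔻, z)` modulo isotopy. -/
abbrev BraidGroup (z : Finset ℂ) : Type := SmoothMod (homeoDisc z)

/-- `Homeo(Σ, ∂Σ)` for the branched double cover `Σ`. -/
abbrev HomeoSurface (z : Finset ℂ) : Type := homeoSurface z

/-- `Diff(Σ, ∂Σ)` for the branched double cover `Σ`, with the `C^∞` topology. -/
abbrev DiffSurface (z : Finset ℂ) : Type := diffIn (homeoSurface z)

/-- The mapping class group of `Σ` relative to its boundary: `Homeo(Σ, ∂Σ)` modulo isotopy. -/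
abbrev ModSurface (z : Finset ℂ) : Type := TopMod (homeoSurface z)

/-- `h` is a lift of `f` to the branched double cover. -/
def IsLift (z : Finset ℂ) (f : DiffDisc z) (h : HomeoSurface z) : Prop :=
  ∀ q : surface z, proj z ((h : surface z ≃ₜ surface z) q) = (f : disc ≃ₜ disc) (proj z q)

end BranchedLift

/-! The lift of a diffeomorphism `f` of the marked disc is a homeomorphism of `Σ`, but in general it
is not smooth over `z`. At a marked point the derivative of `f` is an arbitrary invertible real
linear map, and the lift of such a map through `w ↦ w²` need not be differentiable at `0`. The
remedy is to replace `f`, by a construction compatible with composition, by a homeomorphism that is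
isotopic to it through maps preserving `z` and is conformal near `z`, and to lift that one.

The replacement is a blow-up. In polar coordinates at `a ∈ z` a point is `a + r u` with `r > 0` and
`|u| = 1`. Allowing every real `r` glues a second, inside-out copy of the punctured plane along the
circle of directions `r = 0`. By Hadamard's formula `h (a + r u) - h a = r M u`, where `M` is the
mean of the derivative of `h` on the segment from `a`. So `h` acts on pairs by `(r, u) ↦ (r |M u|, M
u / |M u|)`, smoothly across `r = 0` and functorially (`direction_mul`, `blowMap_mul`). The function
`profile`, which identifies the radius `s > 0` with `r ∈ ℝ`, realizes this inside a disc of radius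
about `ε` around `a`. The centre of the disc corresponds to infinity in the second copy, where `h`
is the identity. Read in the inverted coordinate, the identity near infinity, recentred from `a` to
`h a`, is a Möbius map (`blowMap_of_near`). Hence the difference quotient of the new map at `a`
extends smoothly and without zeros, so does its square root, and the lift is smooth
(`exists_smooth_quotRoot`, `exists_smooth_curveLift_blow`). As `ε → 0` the new map tends uniformly
to `h`, which is the isotopy (`continuous_blowIsotopy`).

The second copy of the plane requires `h` to be smooth on all of `ℂ`, while `f` extended by the
identity is not smooth along the unit circle. Therefore `f` is first conjugated by a radial
homeomorphism given near the circle by `u ↦ e(e(u))`, where `u = 1 - |y|²` and `e(u) = exp(-1/u)`. A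
diffeomorphism multiplies `u` by a positive smooth factor `B`; after conjugation `u` becomes `u / (1
+ u log (1 - e(u) log B))`, which is tangent to `u` to infinite order (`collarInv_mul`). A single
exponential would give `u / (1 - u log B)`, which is not. The conjugating map is isotopic to the
identity, so mapping classes do not change.

Lifts are explicit: `(x, w) ↦ (h x, w ∏ √((h x - h a)/(x - a)))`, each root being normalized far
away (`quotRoot`). Uniqueness of continuous roots gives multiplicativity and identifies every lift
with this one. Continuity of `ρ` comes from carrying out the whole construction for families with
jointly continuous spatial derivatives, with the diffeomorphism group itself as parameter space. -/

namespace BranchedLift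

/-! ### Calculus of families with jointly continuous spatial derivatives -/

section ParametrizedCalculus

variable {Λ : Type} [TopologicalSpace Λ]
  {E F G H : Type} [NormedAddCommGroup E] [NormedSpace ℝ E]
  [NormedAddCommGroup F] [NormedSpace ℝ F] [NormedAddCommGroup G] [NormedSpace ℝ G]
  [NormedAddCommGroup H] [NormedSpace ℝ H]

/-- A family `f` of functions on `E`, parametrized by a topological space `Λ`, is `C^k` on
`S ⊆ Λ × E` if its derivatives of order at most `k` in the direction of `E` exist along the slices
of `S` and are jointly continuous on `S`. -/
def ParamContDiffOn (Λ : Type) [TopologicalSpace Λ] (E : Type) [NormedAddCommGroup E]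
    [NormedSpace ℝ E] : ℕ → ∀ (F : Type) [NormedAddCommGroup F] [NormedSpace ℝ F],
      (Λ → E → F) → Set (Λ × E) → Prop
  | 0, _, _, _, f, S => ContinuousOn (fun p : Λ × E => f p.1 p.2) S
  | k + 1, F, _, _, f, S => ContinuousOn (fun p : Λ × E => f p.1 p.2) S ∧
      ∃ f' : Λ → E → E →L[ℝ] F,
        (∀ p ∈ S, HasFDerivWithinAt (f p.1) (f' p.1 p.2) {x | (p.1, x) ∈ S} p.2) ∧
        ParamContDiffOn Λ E k (E →L[ℝ] F) f' S

/-- A family of functions whose derivatives of all orders are jointly continuous. -/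
def SmoothFamilyOn (f : Λ → E → F) (S : Set (Λ × E)) : Prop :=
  ∀ k, ParamContDiffOn Λ E k F f S

theorem ParamContDiffOn.continuousOn {k : ℕ} {f : Λ → E → F} {S : Set (Λ × E)}
    (h : ParamContDiffOn Λ E k F f S) : ContinuousOn (fun p : Λ × E => f p.1 p.2) S := by
  cases k with
  | zero => exact h
  | succ k => exact h.1

theorem ParamContDiffOn.of_succ {k : ℕ} {f : Λ → E → F} {S : Set (Λ × E)}
    (h : ParamContDiffOn Λ E (k + 1) F f S) : ParamContDiffOn Λ E k F f S := by
  induction k generalizing F with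
  | zero => exact h.1
  | succ k ih =>
    obtain ⟨hc, f', hd, h'⟩ := h
    exact ⟨hc, f', hd, ih h'⟩

theorem ParamContDiffOn.mono {k : ℕ} {f : Λ → E → F} {S T : Set (Λ × E)}
    (h : ParamContDiffOn Λ E k F f S) (hT : T ⊆ S) : ParamContDiffOn Λ E k F f T := by
  induction k generalizing F with
  | zero => exact ContinuousOn.mono h hT
  | succ k ih =>
    obtain ⟨hc, f', hd, h'⟩ := h
    exact ⟨hc.mono hT, f', fun p hp => (hd p (hT hp)).mono fun x hx => hT hx, ih h'⟩

theorem ParamContDiffOn.congr {k : ℕ} {f g : Λ → E → F} {S : Set (Λ × E)}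
    (h : ParamContDiffOn Λ E k F f S) (hg : ∀ p ∈ S, g p.1 p.2 = f p.1 p.2) :
    ParamContDiffOn Λ E k F g S := by
  cases k with
  | zero => exact ContinuousOn.congr h hg
  | succ k =>
    obtain ⟨hc, f', hd, h'⟩ := h
    exact ⟨hc.congr hg, f', fun p hp => (hd p hp).congr (fun x hx => hg (p.1, x) hx) (hg p hp), h'⟩

theorem ParamContDiffOn.const {k : ℕ} {c : Λ → F} {S : Set (Λ × E)}
    (hc : ContinuousOn (fun p : Λ × E => c p.1) S) :
    ParamContDiffOn Λ E k F (fun l _ => c l) S := by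
  induction k generalizing F with
  | zero => exact hc
  | succ k ih =>
    exact ⟨hc, fun _ _ => 0, fun p _ => hasFDerivWithinAt_const _ _ _,
      ih (c := fun _ => 0) continuousOn_const⟩

theorem ParamContDiffOn.id {k : ℕ} {S : Set (Λ × E)} :
    ParamContDiffOn Λ E k E (fun _ x => x) S := by
  cases k with
  | zero => exact continuous_snd.continuousOn
  | succ k =>
    exact ⟨continuous_snd.continuousOn, fun _ _ => ContinuousLinearMap.id ℝ E,
      fun p _ => hasFDerivWithinAt_id _ _,
      ParamContDiffOn.const (c := fun _ => ContinuousLinearMap.id ℝ E) continuousOn_const⟩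

theorem ParamContDiffOn.clm {k : ℕ} {f : Λ → E → F} {S : Set (Λ × E)}
    (h : ParamContDiffOn Λ E k F f S) (L : F →L[ℝ] G) :
    ParamContDiffOn Λ E k G (fun l x => L (f l x)) S := by
  induction k generalizing F G with
  | zero => exact L.continuous.comp_continuousOn h
  | succ k ih =>
    obtain ⟨hc, f', hd, h'⟩ := h
    exact ⟨L.continuous.comp_continuousOn hc, fun l x => L.comp (f' l x),
      fun p hp => L.hasFDerivAt.comp_hasFDerivWithinAt _ (hd p hp),
      ih h' (ContinuousLinearMap.compL ℝ E F G L)⟩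

theorem ParamContDiffOn.add {k : ℕ} {f g : Λ → E → F} {S : Set (Λ × E)}
    (hf : ParamContDiffOn Λ E k F f S) (hg : ParamContDiffOn Λ E k F g S) :
    ParamContDiffOn Λ E k F (fun l x => f l x + g l x) S := by
  induction k generalizing F with
  | zero => exact ContinuousOn.add hf hg
  | succ k ih =>
    obtain ⟨hc, f', hd, h'⟩ := hf
    obtain ⟨hc2, g', hd2, h2'⟩ := hg
    exact ⟨hc.add hc2, fun l x => f' l x + g' l x, fun p hp => (hd p hp).add (hd2 p hp), ih h' h2'⟩

theorem ParamContDiffOn.prodMk {k : ℕ} {f : Λ → E → F} {g : Λ → E → G} {S : Set (Λ × E)}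
    (hf : ParamContDiffOn Λ E k F f S) (hg : ParamContDiffOn Λ E k G g S) :
    ParamContDiffOn Λ E k (F × G) (fun l x => (f l x, g l x)) S :=
  ((hf.clm (ContinuousLinearMap.inl ℝ F G)).add (hg.clm (ContinuousLinearMap.inr ℝ F G))).congr
    fun p _ => by simp

/-- Leibniz rule. The derivative is a sum of two expressions of the same kind with other bilinear
maps, so the induction runs over all `B` and all target spaces at once. -/
theorem ParamContDiffOn.bilinear {k : ℕ} {f : Λ → E → F} {g : Λ → E → G} {S : Set (Λ × E)}
    (B : F →L[ℝ] G →L[ℝ] H)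
    (hf : ParamContDiffOn Λ E k F f S) (hg : ParamContDiffOn Λ E k G g S) :
    ParamContDiffOn Λ E k H (fun l x => B (f l x) (g l x)) S := by
  have hcont : ∀ {f : Λ → E → F} {g : Λ → E → G},
      ContinuousOn (fun p : Λ × E => f p.1 p.2) S → ContinuousOn (fun p : Λ × E => g p.1 p.2) S →
      ContinuousOn (fun p : Λ × E => B (f p.1 p.2) (g p.1 p.2)) S := fun hf hg =>
    (B.continuous.comp_continuousOn hf).clm_apply hg
  induction k generalizing F G H with
  | zero => exact hcont hf hg
  | succ k ih =>
    have hf0 := hf.of_succ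
    have hg0 := hg.of_succ
    obtain ⟨hc, f', hd, h'⟩ := hf
    obtain ⟨hc2, g', hd2, h2'⟩ := hg
    refine ⟨hcont hc hc2, fun l x => B.precompR E (f l x) (g' l x) + B.precompL E (f' l x) (g l x),
      fun p hp => B.hasFDerivWithinAt_of_bilinear (hd p hp) (hd2 p hp),
      (ih (B.precompR E) hf0 h2' ?_).add (ih (B.precompL E) h' hg0 ?_)⟩
    · intro f g hf hg
      exact ((B.precompR E).continuous.comp_continuousOn hf).clm_apply hg
    · intro f g hf hg
      exact ((B.precompL E).continuous.comp_continuousOn hf).clm_apply hg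

/-- Composition of parametrized families. -/
theorem ParamContDiffOn.comp {k : ℕ} {g : Λ → F → G} {f : Λ → E → F} {S : Set (Λ × E)}
    {T : Set (Λ × F)} (hg : ParamContDiffOn Λ F k G g T) (hf : ParamContDiffOn Λ E k F f S)
    (hST : ∀ p ∈ S, (p.1, f p.1 p.2) ∈ T) :
    ParamContDiffOn Λ E k G (fun l x => g l (f l x)) S := by
  have hcont : ContinuousOn (fun p : Λ × E => g p.1 (f p.1 p.2)) S :=
    hg.continuousOn.comp (continuous_fst.continuousOn.prodMk hf.continuousOn) hST
  induction k generalizing G with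
  | zero => exact hcont
  | succ k ih =>
    have hf0 := hf.of_succ
    obtain ⟨-, f', hd, h'⟩ := hf
    obtain ⟨hc2, g', hd2, h2'⟩ := hg
    refine ⟨hcont, fun l x => (g' l (f l x)).comp (f' l x), fun p hp => ?_, ?_⟩
    · exact (hd2 (p.1, f p.1 p.2) (hST p hp)).comp p.2 (hd p hp) fun x hx => hST (p.1, x) hx
    · exact (ih h2' hf0 (h2'.continuousOn.comp
        (continuous_fst.continuousOn.prodMk hf0.continuousOn) hST)).bilinear
        (ContinuousLinearMap.compL ℝ E F G) h'

theorem ParamContDiffOn.of_contDiffOn {k : ℕ} {g : E → F} {s : Set E}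
    (hg : ContDiffOn ℝ ∞ g s) (hs : UniqueDiffOn ℝ s) {S : Set (Λ × E)} (hS : ∀ p ∈ S, p.2 ∈ s) :
    ParamContDiffOn Λ E k F (fun _ x => g x) S := by
  induction k generalizing F with
  | zero => exact hg.continuousOn.comp continuous_snd.continuousOn hS
  | succ k ih =>
    refine ⟨hg.continuousOn.comp continuous_snd.continuousOn hS,
      fun _ x => fderivWithin ℝ g s x, fun p hp => ?_, ih ?_⟩
    · exact ((hg.differentiableOn (by simp)) p.2 (hS p hp)).hasFDerivWithinAt.mono
        fun x hx => hS (p.1, x) hx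
    · exact hg.fderivWithin hs (by simp)

/-- Gluing: being `C^k` is a local property. -/
theorem ParamContDiffOn.of_local {k : ℕ} {f : Λ → E → F} {S : Set (Λ × E)}
    (hS : ∀ l, UniqueDiffOn ℝ {x | (l, x) ∈ S})
    (h : ∀ p ∈ S, ∃ W : Set (Λ × E), IsOpen W ∧ p ∈ W ∧ ParamContDiffOn Λ E k F f (S ∩ W)) :
    ParamContDiffOn Λ E k F f S := by
  have hcont : ContinuousOn (fun p : Λ × E => f p.1 p.2) S := by
    intro p hp
    obtain ⟨W, hW, hpW, hf⟩ := h p hp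
    exact (hf.continuousOn p ⟨hp, hpW⟩).mono_of_mem_nhdsWithin
      (inter_mem_nhdsWithin S (hW.mem_nhds hpW))
  induction k generalizing F with
  | zero => exact hcont
  | succ k ih =>
    -- The local derivatives come from unrelated choices. Unique differentiability forces each of
    -- them to equal `fderivWithin` on the slice, which is defined globally.
    have key : ∀ p ∈ S, ∃ W : Set (Λ × E), IsOpen W ∧ p ∈ W ∧
        (∀ q ∈ S ∩ W, HasFDerivWithinAt (f q.1)
          (fderivWithin ℝ (f q.1) {x | (q.1, x) ∈ S} q.2) {x | (q.1, x) ∈ S} q.2) ∧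
        ParamContDiffOn Λ E k (E →L[ℝ] F)
          (fun l x => fderivWithin ℝ (f l) {y | (l, y) ∈ S} x) (S ∩ W) := by
      intro p hp
      obtain ⟨W, hW, hpW, -, f', hd, h'⟩ := h p hp
      have hd' : ∀ q ∈ S ∩ W, HasFDerivWithinAt (f q.1) (f' q.1 q.2) {x | (q.1, x) ∈ S} q.2 := by
        intro q hq
        refine (hd q hq).mono_of_mem_nhdsWithin ?_
        have : {x | (q.1, x) ∈ W} ∈ 𝓝 q.2 :=
          (hW.preimage (Continuous.prodMk_right q.1)).mem_nhds hq.2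
        exact inter_mem_nhdsWithin _ this
      refine ⟨W, hW, hpW, fun q hq => (hd' q hq).differentiableWithinAt.hasFDerivWithinAt,
        h'.congr fun q hq => (hd' q hq).fderivWithin (hS q.1 q.2 hq.1)⟩
    refine ⟨hcont, fun l x => fderivWithin ℝ (f l) {y | (l, y) ∈ S} x, fun p hp => ?_, ih ?_ ?_⟩
    · obtain ⟨W, -, hpW, hd, -⟩ := key p hp
      exact hd p ⟨hp, hpW⟩
    · intro p hp
      obtain ⟨W, hW, hpW, -, h'⟩ := key p hp
      exact ⟨W, hW, hpW, h'⟩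
    · intro p hp
      obtain ⟨W, hW, hpW, -, h'⟩ := key p hp
      exact (h'.continuousOn p ⟨hp, hpW⟩).mono_of_mem_nhdsWithin
        (inter_mem_nhdsWithin S (hW.mem_nhds hpW))

theorem ParamContDiffOn.contDiffOn {k : ℕ} {f : Λ → E → F} {S : Set (Λ × E)} {s : Set E} {l : Λ}
    (h : ParamContDiffOn Λ E k F f S) (hs : ∀ x ∈ s, (l, x) ∈ S) : ContDiffOn ℝ k (f l) s := by
  induction k generalizing F with
  | zero =>
    exact contDiffOn_zero.2 (h.continuousOn.comp (Continuous.prodMk_right l).continuousOn hs)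
  | succ k ih =>
    obtain ⟨-, f', hd, h'⟩ := h
    push_cast
    rw [contDiffOn_succ_iff_hasFDerivWithinAt (by simp)]
    intro x hx
    rw [insert_eq_of_mem hx]
    exact ⟨s, self_mem_nhdsWithin, by simp, f' l, fun y hy => (hd (l, y) (hs y hy)).mono hs, ih h'⟩

theorem SmoothFamilyOn.contDiffOn {f : Λ → E → F} {S : Set (Λ × E)} {s : Set E} {l : Λ}
    (h : SmoothFamilyOn f S) (hs : ∀ x ∈ s, (l, x) ∈ S) : ContDiffOn ℝ ∞ (f l) s :=
  contDiffOn_infty.2 fun k => (h k).contDiffOn hs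

/-- Together with the converse below this translates between the inductive definition and the
iterated derivatives that define the `C^∞` topology. -/
theorem ParamContDiffOn.continuousOn_iteratedFDerivWithin {k : ℕ} {f : Λ → E → F} {Q : Set E}
    (hQ : UniqueDiffOn ℝ Q) (h : ParamContDiffOn Λ E k F f (univ ×ˢ Q)) :
    ContinuousOn (fun p : Λ × E => iteratedFDerivWithin ℝ k (f p.1) Q p.2) (univ ×ˢ Q) := by
  induction k generalizing F with
  | zero =>
    simp only [iteratedFDerivWithin_zero_eq_comp, Function.comp_def]
    exact (LinearIsometryEquiv.continuous _).comp_continuousOn h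
  | succ k ih =>
    obtain ⟨-, f', hd, h'⟩ := h
    have h2 := (LinearIsometryEquiv.continuous (continuousMultilinearCurryRightEquiv' ℝ k E F).symm).comp_continuousOn
      (ih h')
    refine h2.congr fun p hp => ?_
    rw [iteratedFDerivWithin_succ_eq_comp_right hQ hp.2]
    simp only [Function.comp_apply]
    congr 1
    refine iteratedFDerivWithin_congr (fun y hy => ?_) hp.2 k
    have := hd (p.1, y) ⟨mem_univ _, hy⟩
    simp only [mem_prod, mem_univ, true_and, ofPred_mem_eq] at this
    exact this.fderivWithin (hQ y hy)

theorem ParamContDiffOn.of_iteratedFDerivWithin {k : ℕ} {f : Λ → E → F} {Q : Set E}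
    (hQ : UniqueDiffOn ℝ Q) (hf : ∀ l, ContDiffOn ℝ ∞ (f l) Q)
    (h : ∀ j ≤ k, ContinuousOn (fun p : Λ × E => iteratedFDerivWithin ℝ j (f p.1) Q p.2)
      (univ ×ˢ Q)) :
    ParamContDiffOn Λ E k F f (univ ×ˢ Q) := by
  have hcont : ContinuousOn (fun p : Λ × E => f p.1 p.2) (univ ×ˢ Q) := by
    refine ((LinearIsometryEquiv.continuous
      (continuousMultilinearCurryFin0 ℝ E F)).comp_continuousOn (h 0 k.zero_le)).congr fun p _ => ?_
    simp [iteratedFDerivWithin_zero_eq_comp]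
  induction k generalizing F with
  | zero => exact hcont
  | succ k ih =>
    have hj : ∀ j ≤ k, ContinuousOn (fun p : Λ × E =>
        iteratedFDerivWithin ℝ j (fun y => fderivWithin ℝ (f p.1) Q y) Q p.2) (univ ×ˢ Q) := by
      intro j hj
      refine ((LinearIsometryEquiv.continuous
        (continuousMultilinearCurryRightEquiv' ℝ j E F)).comp_continuousOn
          (h (j + 1) (by omega))).congr fun p hp => ?_
      simp only [Function.comp_apply, iteratedFDerivWithin_succ_eq_comp_right hQ hp.2]
      simp
    refine ⟨hcont, fun l y => fderivWithin ℝ (f l) Q y, fun p hp => ?_, ih ?_ hj ?_⟩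
    · have : {x | (p.1, x) ∈ (univ : Set Λ) ×ˢ Q} = Q := by ext; simp
      rw [this]
      exact ((hf p.1).differentiableOn (by simp) p.2 hp.2).hasFDerivWithinAt
    · exact fun l => (hf l).fderivWithin hQ (by simp)
    · refine ((LinearIsometryEquiv.continuous
        (continuousMultilinearCurryFin0 ℝ E (E →L[ℝ] F))).comp_continuousOn
          (hj 0 k.zero_le)).congr fun p _ => ?_
      simp [iteratedFDerivWithin_zero_eq_comp]

namespace SmoothFamilyOn

variable {f g : Λ → E → F} {S T : Set (Λ × E)}

theorem continuousOn (h : SmoothFamilyOn f S) : ContinuousOn (fun p : Λ × E => f p.1 p.2) S := h 0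

theorem mono (h : SmoothFamilyOn f S) (hT : T ⊆ S) : SmoothFamilyOn f T := fun k => (h k).mono hT

theorem congr (h : SmoothFamilyOn f S) (hg : ∀ p ∈ S, g p.1 p.2 = f p.1 p.2) :
    SmoothFamilyOn g S := fun k => (h k).congr hg

theorem const {c : Λ → F} (hc : ContinuousOn (fun p : Λ × E => c p.1) S) :
    SmoothFamilyOn (fun l _ => c l) S := fun _ => .const hc

theorem const' (c : F) : SmoothFamilyOn (fun _ _ => c) S := const continuousOn_const

protected theorem id : SmoothFamilyOn (fun (_ : Λ) (x : E) => x) S := fun _ => .id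

theorem clm (h : SmoothFamilyOn f S) (L : F →L[ℝ] G) : SmoothFamilyOn (fun l x => L (f l x)) S :=
  fun k => (h k).clm L

theorem add (hf : SmoothFamilyOn f S) (hg : SmoothFamilyOn g S) :
    SmoothFamilyOn (fun l x => f l x + g l x) S := fun k => (hf k).add (hg k)

theorem sub (hf : SmoothFamilyOn f S) (hg : SmoothFamilyOn g S) :
    SmoothFamilyOn (fun l x => f l x - g l x) S :=
  (hf.add (hg.clm (-ContinuousLinearMap.id ℝ F))).congr fun p _ => by simp [sub_eq_add_neg]

theorem prodMk {g : Λ → E → G} (hf : SmoothFamilyOn f S) (hg : SmoothFamilyOn g S) :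
    SmoothFamilyOn (fun l x => (f l x, g l x)) S := fun k => (hf k).prodMk (hg k)

theorem bilinear {g : Λ → E → G} (B : F →L[ℝ] G →L[ℝ] H) (hf : SmoothFamilyOn f S)
    (hg : SmoothFamilyOn g S) : SmoothFamilyOn (fun l x => B (f l x) (g l x)) S :=
  fun k => (hf k).bilinear B (hg k)

theorem smul {c : Λ → E → ℝ} (hc : SmoothFamilyOn c S) (hf : SmoothFamilyOn f S) :
    SmoothFamilyOn (fun l x => c l x • f l x) S :=
  hc.bilinear (ContinuousLinearMap.lsmul ℝ ℝ) hf

theorem mul {A : Type} [NormedRing A] [NormedAlgebra ℝ A] {f g : Λ → E → A}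
    (hf : SmoothFamilyOn f S) (hg : SmoothFamilyOn g S) :
    SmoothFamilyOn (fun l x => f l x * g l x) S :=
  hf.bilinear (ContinuousLinearMap.mul ℝ A) hg

theorem finset_prod {ι : Type} (s : Finset ι) {f : ι → Λ → E → ℂ}
    (hf : ∀ i ∈ s, SmoothFamilyOn (f i) S) :
    SmoothFamilyOn (fun l x => ∏ i ∈ s, f i l x) S := by
  classical
  induction s using Finset.induction_on with
  | empty => simpa using const' 1
  | insert i s hi ih =>
    simp only [Finset.prod_insert hi]
    exact (hf i (Finset.mem_insert_self i s)).mul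
      (ih fun j hj => hf j (Finset.mem_insert_of_mem hj))

theorem finset_sum {ι : Type} (s : Finset ι) {f : ι → Λ → E → F}
    (hf : ∀ i ∈ s, SmoothFamilyOn (f i) S) :
    SmoothFamilyOn (fun l x => ∑ i ∈ s, f i l x) S := by
  classical
  induction s using Finset.induction_on with
  | empty => simpa using const' 0
  | insert i s hi ih =>
    simp only [Finset.sum_insert hi]
    exact (hf i (Finset.mem_insert_self i s)).add
      (ih fun j hj => hf j (Finset.mem_insert_of_mem hj))

theorem comp {g : Λ → F → G} {T : Set (Λ × F)} (hg : SmoothFamilyOn g T)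
    (hf : SmoothFamilyOn f S) (hST : ∀ p ∈ S, (p.1, f p.1 p.2) ∈ T) :
    SmoothFamilyOn (fun l x => g l (f l x)) S := fun k => (hg k).comp (hf k) hST

theorem of_contDiffOn {g : E → F} {s : Set E} (hg : ContDiffOn ℝ ∞ g s) (hs : UniqueDiffOn ℝ s)
    (hS : ∀ p ∈ S, p.2 ∈ s) : SmoothFamilyOn (fun _ x => g x) S :=
  fun _ => .of_contDiffOn hg hs hS

theorem of_contDiff {g : E → F} (hg : ContDiff ℝ ∞ g) : SmoothFamilyOn (fun _ x => g x) S :=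
  of_contDiffOn hg.contDiffOn uniqueDiffOn_univ fun _ _ => mem_univ _

/-- Composition with a fixed smooth map. -/
theorem contDiffOn_comp {g : F → G} {s : Set F} (hg : ContDiffOn ℝ ∞ g s) (hs : IsOpen s)
    (hf : SmoothFamilyOn f S) (hS : ∀ p ∈ S, f p.1 p.2 ∈ s) :
    SmoothFamilyOn (fun l x => g (f l x)) S :=
  (of_contDiffOn (Λ := Λ) (S := univ ×ˢ s) hg hs.uniqueDiffOn fun _ hp => hp.2).comp hf
    fun p hp => ⟨mem_univ _, hS p hp⟩

theorem contDiff_comp {g : F → G} (hg : ContDiff ℝ ∞ g) (hf : SmoothFamilyOn f S) :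
    SmoothFamilyOn (fun l x => g (f l x)) S :=
  contDiffOn_comp hg.contDiffOn isOpen_univ hf fun _ _ => mem_univ _

theorem of_local (hS : ∀ l, UniqueDiffOn ℝ {x | (l, x) ∈ S})
    (h : ∀ p ∈ S, ∃ W : Set (Λ × E), IsOpen W ∧ p ∈ W ∧ SmoothFamilyOn f (S ∩ W)) :
    SmoothFamilyOn f S := fun k => .of_local hS fun p hp => by
  obtain ⟨W, hW, hpW, hf⟩ := h p hp
  exact ⟨W, hW, hpW, hf k⟩

theorem of_local_isOpen (hS : IsOpen S)
    (h : ∀ p ∈ S, ∃ W : Set (Λ × E), IsOpen W ∧ p ∈ W ∧ SmoothFamilyOn f (S ∩ W)) :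
    SmoothFamilyOn f S :=
  of_local (fun l => (hS.preimage (Continuous.prodMk_right l)).uniqueDiffOn) h

/-- Change of the parameter space. -/
theorem reparam {Λ' : Type} [TopologicalSpace Λ'] {φ : Λ' → Λ} (hφ : Continuous φ)
    {S' : Set (Λ' × E)} (hf : SmoothFamilyOn f S) (hS : ∀ p ∈ S', (φ p.1, p.2) ∈ S) :
    SmoothFamilyOn (fun l x => f (φ l) x) S' := by
  intro k
  have hcont : ContinuousOn (fun p : Λ' × E => f (φ p.1) p.2) S' :=
    hf.continuousOn.comp ((hφ.comp continuous_fst).prodMk continuous_snd).continuousOn hS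
  have hk := hf k
  clear hf
  induction k generalizing F with
  | zero => exact hcont
  | succ k ih =>
    obtain ⟨-, f', hd, h'⟩ := hk
    exact ⟨hcont, fun l x => f' (φ l) x,
      fun p hp => (hd (φ p.1, p.2) (hS p hp)).mono fun x hx => hS (p.1, x) hx,
      ih (h'.continuousOn.comp ((hφ.comp continuous_fst).prodMk continuous_snd).continuousOn hS) h'⟩

end SmoothFamilyOn

end ParametrizedCalculus

/-! ### The principal square root and smooth families -/

section SquareRoot

/-- The principal branch of the complex square root. -/
noncomputable def csqrt (x : ℂ) : ℂ := x ^ (2⁻¹ : ℂ)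

theorem csqrt_sq (x : ℂ) : csqrt x ^ 2 = x := by
  simp [csqrt]

theorem csqrt_ne_zero {x : ℂ} (hx : x ≠ 0) : csqrt x ≠ 0 := fun h => hx (by
  rw [← csqrt_sq x, h]; simp)

theorem csqrt_re_pos {x : ℂ} (hx : x ∈ Complex.slitPlane) : 0 < (csqrt x).re := by
  have hx0 := Complex.slitPlane_ne_zero hx
  rw [csqrt, Complex.cpow_def_of_ne_zero hx0, Complex.exp_re]
  have h1 := Complex.neg_pi_lt_arg x
  have h2 : x.arg < Real.pi :=
    lt_of_le_of_ne (Complex.arg_le_pi x) (Complex.mem_slitPlane_iff_arg.1 hx).1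
  have him : (Complex.log x * 2⁻¹).im = x.arg / 2 := by
    have : (Complex.log x * 2⁻¹) = ((2⁻¹ : ℝ) : ℂ) * Complex.log x := by push_cast; ring
    rw [this, Complex.im_ofReal_mul, Complex.log_im]; ring
  rw [him]
  exact mul_pos (Real.exp_pos _) (Real.cos_pos_of_mem_Ioo ⟨by linarith, by linarith⟩)

/-- Two roots differ by a sign, and a positive real part selects the principal one. This is how a
continuous root is recognized locally as a smooth function. -/
theorem eq_csqrt {x y : ℂ} (h : y ^ 2 = x) (hy : 0 < y.re) : y = csqrt x := by
  have hx : x ∈ Complex.slitPlane := by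
    rw [Complex.mem_slitPlane_iff, ← h, sq, Complex.mul_re, Complex.mul_im]
    by_cases him : y.im = 0
    · left; rw [him]; nlinarith
    · right
      have : y.re * y.im ≠ 0 := mul_ne_zero hy.ne' him
      intro h0; apply this; linarith
  rcases sq_eq_sq_iff_eq_or_eq_neg.1 (h.trans (csqrt_sq x).symm) with h1 | h1
  · exact h1
  · have := csqrt_re_pos hx
    rw [h1, Complex.neg_re] at hy
    linarith

theorem contDiffOn_csqrt : ContDiffOn ℝ ∞ csqrt Complex.slitPlane := by
  intro x hx
  have : ContDiffAt ℂ ∞ csqrt x := by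
    have h : ContDiffAt ℂ ∞ (fun y : ℂ => Complex.exp (Complex.log y * 2⁻¹)) x :=
      ((Complex.contDiffAt_log hx).mul contDiffAt_const).cexp
    refine h.congr_of_eventuallyEq ?_
    filter_upwards [Complex.isOpen_slitPlane.mem_nhds hx] with y hy
    rw [csqrt, Complex.cpow_def_of_ne_zero (Complex.slitPlane_ne_zero hy)]
  exact (this.restrict_scalars ℝ).contDiffWithinAt

theorem continuousOn_csqrt : ContinuousOn csqrt Complex.slitPlane := contDiffOn_csqrt.continuousOn

theorem contDiffOn_complex_inv : ContDiffOn ℝ ∞ (fun x : ℂ => x⁻¹) {0}ᶜ := fun _ hx =>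
  ((contDiffAt_inv ℂ (n := ∞) hx).restrict_scalars ℝ).contDiffWithinAt

theorem contDiffOn_complex_norm : ContDiffOn ℝ ∞ (fun x : ℂ => ‖x‖) {0}ᶜ := fun _ hx =>
  (contDiffAt_norm ℝ hx).contDiffWithinAt

variable {Λ : Type} [TopologicalSpace Λ]
  {E F : Type} [NormedAddCommGroup E] [NormedSpace ℝ E] [NormedAddCommGroup F] [NormedSpace ℝ F]
  {S : Set (Λ × E)}

namespace SmoothFamilyOn

theorem inv {f : Λ → E → ℂ} (hf : SmoothFamilyOn f S) (h0 : ∀ p ∈ S, f p.1 p.2 ≠ 0) :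
    SmoothFamilyOn (fun l x => (f l x)⁻¹) S :=
  contDiffOn_comp contDiffOn_complex_inv isOpen_compl_singleton hf h0

theorem div {f g : Λ → E → ℂ} (hf : SmoothFamilyOn f S) (hg : SmoothFamilyOn g S)
    (h0 : ∀ p ∈ S, g p.1 p.2 ≠ 0) : SmoothFamilyOn (fun l x => f l x / g l x) S := by
  simpa only [div_eq_mul_inv] using hf.mul (hg.inv h0)

theorem norm {f : Λ → E → ℂ} (hf : SmoothFamilyOn f S) (h0 : ∀ p ∈ S, f p.1 p.2 ≠ 0) :
    SmoothFamilyOn (fun l x => ‖f l x‖) S :=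
  contDiffOn_comp contDiffOn_complex_norm isOpen_compl_singleton hf h0

theorem norm_sq {f : Λ → E → ℂ} (hf : SmoothFamilyOn f S) :
    SmoothFamilyOn (fun l x => ‖f l x‖ ^ 2) S :=
  contDiff_comp (g := fun x : ℂ => ‖x‖ ^ 2) (contDiff_norm_sq ℝ) hf

theorem rinv {f : Λ → E → ℝ} (hf : SmoothFamilyOn f S) (h0 : ∀ p ∈ S, f p.1 p.2 ≠ 0) :
    SmoothFamilyOn (fun l x => (f l x)⁻¹) S :=
  contDiffOn_comp (g := fun x : ℝ => x⁻¹) (s := {0}ᶜ)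
    (fun _ hx => (contDiffAt_inv ℝ hx).contDiffWithinAt) isOpen_compl_singleton hf h0

theorem rdiv {f g : Λ → E → ℝ} (hf : SmoothFamilyOn f S) (hg : SmoothFamilyOn g S)
    (h0 : ∀ p ∈ S, g p.1 p.2 ≠ 0) : SmoothFamilyOn (fun l x => f l x / g l x) S := by
  simpa only [div_eq_mul_inv] using hf.mul (hg.rinv h0)

theorem rsqrt {f : Λ → E → ℝ} (hf : SmoothFamilyOn f S) (h0 : ∀ p ∈ S, 0 < f p.1 p.2) :
    SmoothFamilyOn (fun l x => Real.sqrt (f l x)) S :=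
  contDiffOn_comp (g := Real.sqrt) (s := {0}ᶜ)
    (fun _ hx => (Real.contDiffAt_sqrt hx).contDiffWithinAt) isOpen_compl_singleton hf
    fun p hp => (h0 p hp).ne'

theorem rlog {f : Λ → E → ℝ} (hf : SmoothFamilyOn f S) (h0 : ∀ p ∈ S, f p.1 p.2 ≠ 0) :
    SmoothFamilyOn (fun l x => Real.log (f l x)) S :=
  contDiffOn_comp (g := Real.log) Real.contDiffOn_log isOpen_compl_singleton hf h0

theorem conj {f : Λ → E → ℂ} (hf : SmoothFamilyOn f S) :
    SmoothFamilyOn (fun l x => (starRingEnd ℂ) (f l x)) S :=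
  hf.clm (Complex.conjCLE : ℂ →L[ℝ] ℂ)

theorem csqrt {f : Λ → E → ℂ} (hf : SmoothFamilyOn f S)
    (h0 : ∀ p ∈ S, f p.1 p.2 ∈ Complex.slitPlane) :
    SmoothFamilyOn (fun l x => csqrt (f l x)) S :=
  contDiffOn_comp contDiffOn_csqrt Complex.isOpen_slitPlane hf h0

/-- A continuous square root of a non-vanishing smooth family is a smooth family. -/
theorem of_sq {T f : Λ → E → ℂ} (hS : IsOpen S) (hf : SmoothFamilyOn f S)
    (hT : ContinuousOn (fun p : Λ × E => T p.1 p.2) S)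
    (hsq : ∀ p ∈ S, T p.1 p.2 ^ 2 = f p.1 p.2) (h0 : ∀ p ∈ S, f p.1 p.2 ≠ 0) :
    SmoothFamilyOn T S := by
  have hT0 : ∀ p ∈ S, T p.1 p.2 ≠ 0 := fun p hp h => h0 p hp (by rw [← hsq p hp, h]; simp)
  refine of_local_isOpen hS fun p hp => ?_
  -- Dividing by the value at `p` moves the root close to `1`, where its real part is positive and
  -- it is the principal root of `f / c²`.
  set c := T p.1 p.2 with hc
  have hcont : ContinuousOn (fun q : Λ × E => (T q.1 q.2 / c).re) S :=
    Complex.continuous_re.comp_continuousOn (hT.div_const c)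
  obtain ⟨W, hW, hWS⟩ := continuousOn_iff'.1 hcont (Ioi 0) isOpen_Ioi
  have hpos : ∀ q ∈ S ∩ W, 0 < (T q.1 q.2 / c).re := fun q hq => by
    have : q ∈ W ∩ S := ⟨hq.2, hq.1⟩
    rw [← hWS] at this
    exact this.1
  have hc0 : c ≠ 0 := hT0 p hp
  refine ⟨W, hW, ?_, ?_⟩
  · have : p ∈ W ∩ S := by
      rw [← hWS]
      refine ⟨?_, hp⟩
      change 0 < (T p.1 p.2 / c).re
      rw [← hc, div_self hc0]
      norm_num
    exact this.1
  · have hd : ∀ q ∈ S ∩ W, f q.1 q.2 / c ^ 2 ∈ Complex.slitPlane := fun q hq => by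
      rw [← hsq q hq.1, ← div_pow]
      have hre := hpos q hq
      rw [Complex.mem_slitPlane_iff, sq, Complex.mul_re, Complex.mul_im]
      by_cases him : (T q.1 q.2 / c).im = 0
      · left; rw [him]; nlinarith
      · right
        have := mul_ne_zero hre.ne' him
        intro h0; apply this; linarith
    have h1 : SmoothFamilyOn (fun l x => c * BranchedLift.csqrt (f l x / c ^ 2)) (S ∩ W) :=
      (const' c).mul (((hf.mono inter_subset_left).div (const' (c ^ 2))
        fun _ _ => pow_ne_zero 2 hc0).csqrt hd)
    refine h1.congr fun q hq => ?_
    rw [← eq_csqrt (y := T q.1 q.2 / c) (by rw [div_pow, hsq q hq.1]) (hpos q hq)]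
    field_simp

end SmoothFamilyOn

end SquareRoot

/-! ### Integrals over the unit interval depending on parameters -/

section Integral

open MeasureTheory

variable {Λ : Type} [TopologicalSpace Λ]
  {E F : Type} [NormedAddCommGroup E] [NormedSpace ℝ E] [NormedAddCommGroup F] [NormedSpace ℝ F]

/-- A jointly continuous family of functions on a compact space depends continuously on the
parameter in the uniform norm. -/
theorem norm_integral_sub_le {f g : I → F} (hf : Continuous f) (hg : Continuous g) {C : ℝ}
    (h : ∀ t, ‖f t - g t‖ ≤ C) : ‖(∫ t, f t) - ∫ t, g t‖ ≤ C := by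
  have hfi : Integrable f := hf.integrable_of_hasCompactSupport (HasCompactSupport.of_compactSpace f)
  have hgi : Integrable g := hg.integrable_of_hasCompactSupport (HasCompactSupport.of_compactSpace g)
  rw [← integral_sub hfi hgi]
  simpa using norm_integral_le_of_norm_le_const (μ := (volume : Measure I))
    (Filter.Eventually.of_forall h)

/-- Currying: since `I` is compact, joint continuity is continuity of a map into `C(I, F)` with the
uniform norm. -/
theorem eventually_norm_sub_le_of_continuous {X : Type*} [TopologicalSpace X] {g : X → I → F}
    (hg : Continuous (fun p : X × I => g p.1 p.2)) (x₀ : X) {ε : ℝ} (hε : 0 < ε) :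
    ∀ᶠ x in 𝓝 x₀, ∀ t, ‖g x t - g x₀ t‖ ≤ ε := by
  let c : C(X, C(I, F)) := ContinuousMap.curry ⟨fun p : X × I => g p.1 p.2, hg⟩
  filter_upwards [(Metric.continuousAt_iff'.1 c.continuous.continuousAt) ε hε] with x hx t
  have := (ContinuousMap.dist_lt_iff hε).1 hx t
  rw [dist_eq_norm] at this
  exact this.le

theorem continuous_integral_unitInterval {X : Type*} [TopologicalSpace X] {g : X → I → F}
    (hg : Continuous (fun p : X × I => g p.1 p.2)) : Continuous (fun x => ∫ t, g x t) := by
  rw [continuous_iff_continuousAt]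
  intro x₀
  rw [Metric.continuousAt_iff']
  intro ε hε
  filter_upwards [eventually_norm_sub_le_of_continuous hg x₀ (half_pos hε)] with x hx
  rw [dist_eq_norm]
  have hgx : ∀ y, Continuous (g y) := fun y => hg.comp (Continuous.prodMk_right y)
  exact (norm_integral_sub_le (hgx x) (hgx x₀) hx).trans_lt (half_lt_self hε)

/-- The integration variable is treated as a further parameter. Differentiation under the integral
sign needs no domination: compactness of `I` makes the derivatives uniformly close near `x₀`, and
the mean value inequality on the convex set `Q` bounds the remainder. -/
theorem ParamContDiffOn.integral [CompleteSpace F] {k : ℕ} {f : Λ × I → E → F} {Q : Set E}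
    (hQ : Convex ℝ Q) (hf : ParamContDiffOn (Λ × I) E k F f (univ ×ˢ Q)) :
    ParamContDiffOn Λ E k F (fun l x => ∫ t : I, f (l, t) x) (univ ×ˢ Q) := by
  have hsub : ∀ {F : Type} [NormedAddCommGroup F] [NormedSpace ℝ F] {f : Λ × I → E → F},
      ContinuousOn (fun p : (Λ × I) × E => f p.1 p.2) (univ ×ˢ Q) →
      Continuous (fun p : (univ ×ˢ Q : Set (Λ × E)) × I => f (p.1.1.1, p.2) p.1.1.2) := by
    intro F _ _ f hc
    exact hc.comp_continuous
      (f := fun p : (univ ×ˢ Q : Set (Λ × E)) × I => ((p.1.1.1, p.2), p.1.1.2))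
      (by fun_prop) (fun p => ⟨mem_univ _, p.1.2.2⟩)
  have hcont : ContinuousOn (fun p : Λ × E => ∫ t : I, f (p.1, t) p.2) (univ ×ˢ Q) := by
    rw [continuousOn_iff_continuous_domRestrict]
    exact continuous_integral_unitInterval
      (g := fun (p : (univ ×ˢ Q : Set (Λ × E))) t => f (p.1.1, t) p.1.2) (hsub hf.continuousOn)
  induction k generalizing F with
  | zero => exact hcont
  | succ k ih =>
    have hf0 := hf.continuousOn
    obtain ⟨-, f', hd, h'⟩ := hf
    refine ⟨hcont, fun l x => ∫ t : I, f' (l, t) x, ?_, ih h' ?_⟩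
    · rintro ⟨l, x₀⟩ ⟨-, hx₀⟩
      have hslice : {x | (l, x) ∈ (univ : Set Λ) ×ˢ Q} = Q := by ext; simp
      simp only [hslice]
      have hfl : ∀ x ∈ Q, Continuous fun t : I => f (l, t) x := fun x hx =>
        hf0.comp_continuous (f := fun t : I => ((l, t), x)) (by fun_prop) fun _ => ⟨mem_univ _, hx⟩
      have hfl' : ∀ x ∈ Q, Continuous fun t : I => f' (l, t) x := fun x hx =>
        h'.continuousOn.comp_continuous (f := fun t : I => ((l, t), x)) (by fun_prop)
          fun _ => ⟨mem_univ _, hx⟩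
      rw [hasFDerivWithinAt_iff_isLittleO, Asymptotics.isLittleO_iff]
      intro ε hε
      have hev : ∀ᶠ x in 𝓝[Q] x₀, ∀ t : I, ‖f' (l, t) x - f' (l, t) x₀‖ ≤ ε := by
        have h1 : Continuous (fun p : Q × I => f' (l, p.2) p.1) :=
          h'.continuousOn.comp_continuous (f := fun p : Q × I => ((l, p.2), (p.1 : E)))
            (by fun_prop) fun p => ⟨mem_univ _, p.1.2⟩
        have h2 := eventually_norm_sub_le_of_continuous
          (g := fun (x : Q) (t : I) => f' (l, t) x) h1 ⟨x₀, hx₀⟩ hε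
        exact (eventually_nhds_subtype_iff Q ⟨x₀, hx₀⟩
          (fun x => ∀ t : I, ‖f' (l, t) x - f' (l, t) x₀‖ ≤ ε)).1 h2
      obtain ⟨r, hr, hball⟩ := Metric.mem_nhdsWithin_iff.1 hev
      filter_upwards [inter_mem_nhdsWithin Q (Metric.ball_mem_nhds x₀ hr)] with x hx
      have hconv : Convex ℝ (Q ∩ Metric.ball x₀ r) := hQ.inter (convex_ball _ _)
      have hx0r : x₀ ∈ Q ∩ Metric.ball x₀ r := ⟨hx₀, Metric.mem_ball_self hr⟩
      have hmv : ∀ t : I, ‖f (l, t) x - f (l, t) x₀ - f' (l, t) x₀ (x - x₀)‖ ≤ ε * ‖x - x₀‖ := by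
        intro t
        refine hconv.norm_image_sub_le_of_norm_hasFDerivWithin_le' (f' := fun y => f' (l, t) y)
          (fun y hy => ?_) (fun y hy => hball ⟨hy.2, hy.1⟩ t) hx0r hx
        have := hd ((l, t), y) ⟨mem_univ _, hy.1⟩
        have hs : {x | ((l, t), x) ∈ (univ : Set (Λ × I)) ×ˢ Q} = Q := by ext; simp
        simp only [hs] at this
        exact this.mono inter_subset_left
      have hint : Integrable (fun t : I => f' (l, t) x₀) :=
        (hfl' x₀ hx₀).integrable_of_hasCompactSupport (HasCompactSupport.of_compactSpace _)
      rw [ContinuousLinearMap.integral_apply hint]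
      have hi0 : Integrable (fun t : I => f (l, t) x₀) :=
        (hfl x₀ hx₀).integrable_of_hasCompactSupport (HasCompactSupport.of_compactSpace _)
      have hi1 : Integrable (fun t : I => f (l, t) x) :=
        (hfl x hx.1).integrable_of_hasCompactSupport (HasCompactSupport.of_compactSpace _)
      rw [← integral_sub hi1 hi0]
      refine norm_integral_sub_le ((hfl x hx.1).sub (hfl x₀ hx₀))
        ((hfl' x₀ hx₀).clm_apply continuous_const) hmv
    · rw [continuousOn_iff_continuous_domRestrict]
      exact continuous_integral_unitInterval
        (g := fun (p : (univ ×ˢ Q : Set (Λ × E))) t => f' (p.1.1, t) p.1.2) (hsub h'.continuousOn)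

theorem integral_unitInterval_eq (g : ℝ → F) : ∫ t : I, g t = ∫ t in (0 : ℝ)..1, g t := by
  rw [intervalIntegral.integral_of_le zero_le_one, ← integral_Icc_eq_integral_Ioc]
  exact integral_subtype_comap measurableSet_Icc g

/-- The mean value formula along a segment. -/
theorem integral_segment_deriv [CompleteSpace F] {f : E → F} {f' : E → E →L[ℝ] F} {Q : Set E}
    (hQ : Convex ℝ Q) (hf : ∀ x ∈ Q, HasFDerivWithinAt f (f' x) Q x) (hf' : ContinuousOn f' Q)
    {a b : E} (ha : a ∈ Q) (hb : b ∈ Q) :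
    (∫ t : I, f' (a + (t : ℝ) • (b - a))) (b - a) = f b - f a := by
  have hmem : ∀ t ∈ Icc (0 : ℝ) 1, a + t • (b - a) ∈ Q := fun t ht =>
    hQ.add_smul_sub_mem ha hb ht
  have hc : ContinuousOn (fun t : ℝ => f' (a + t • (b - a))) (Icc 0 1) :=
    hf'.comp (by fun_prop) hmem
  have hci : Continuous (fun t : I => f' (a + (t : ℝ) • (b - a))) :=
    hc.comp_continuous continuous_subtype_val fun t => t.2
  rw [ContinuousLinearMap.integral_apply
    (hci.integrable_of_hasCompactSupport (HasCompactSupport.of_compactSpace _)),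
    integral_unitInterval_eq (fun t : ℝ => f' (a + t • (b - a)) (b - a))]
  have hder : ∀ t ∈ Icc (0 : ℝ) 1, HasDerivWithinAt (fun t : ℝ => f (a + t • (b - a)))
      (f' (a + t • (b - a)) (b - a)) (Icc 0 1) t := by
    intro t ht
    have h1 : HasDerivWithinAt (fun t : ℝ => a + t • (b - a)) (b - a) (Icc 0 1) t := by
      simpa using (((hasDerivAt_id t).smul_const (b - a)).const_add a).hasDerivWithinAt
    exact (hf _ (hmem t ht)).comp_hasDerivWithinAt t h1 hmem
  rw [intervalIntegral.integral_eq_sub_of_hasDeriv_right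
    (f := fun t : ℝ => f (a + t • (b - a)))]
  · simp
  · rw [uIcc_of_le zero_le_one]
    exact fun t ht => (hder t ht).continuousWithinAt
  · intro t ht
    rw [min_eq_left zero_le_one, max_eq_right zero_le_one] at ht
    exact (hder t (Ioo_subset_Icc_self ht)).hasDerivAt (Icc_mem_nhds ht.1 ht.2) |>.hasDerivWithinAt
  · refine ContinuousOn.intervalIntegrable ?_
    rw [uIcc_of_le zero_le_one]
    exact hc.clm_apply continuousOn_const

end Integral

/-! ### Continuous square roots along paths -/

section RootAlong

/-- The value at time `1` of the continuous square root of `γ` with value `r` at time `0`. -/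
noncomputable def rootAlong (γ : I → ℂ) (r : ℂ) : ℂ :=
  open Classical in
  if h : ∃ ρ : I → ℂ, Continuous ρ ∧ (∀ t, ρ t ^ 2 = γ t) ∧ ρ 0 = r then h.choose 1 else 0

/-- Two continuous roots of a nowhere vanishing path that agree at one time agree always, so the
choice in `rootAlong` does not matter. -/
theorem rootAlong_eq {γ ρ : I → ℂ} (hρ : Continuous ρ) (hsq : ∀ t, ρ t ^ 2 = γ t)
    (h0 : ∀ t, γ t ≠ 0) : rootAlong γ (ρ 0) = ρ 1 := by
  have h : ∃ ρ' : I → ℂ, Continuous ρ' ∧ (∀ t, ρ' t ^ 2 = γ t) ∧ ρ' 0 = ρ 0 :=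
    ⟨ρ, hρ, hsq, rfl⟩
  rw [rootAlong, dif_pos h]
  obtain ⟨hc, hs, hz⟩ := h.choose_spec
  have hne : ∀ {t : I}, t ∈ univ → ρ t ≠ 0 := fun {t} _ h => h0 t (by rw [← hsq t, h]; simp)
  exact isPreconnected_univ.eq_of_sq_eq hc.continuousOn hρ.continuousOn
    (fun t _ => by simp only [Pi.pow_apply]; rw [hs, hsq]) hne (mem_univ 0) hz (mem_univ 1)

/-- Square roots along paths depend continuously on the path. -/
theorem exists_root_family {A : Type*} [TopologicalSpace A] {H : A → I → ℂ} {r : A → ℂ}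
    (hH : Continuous fun p : A × I => H p.1 p.2) (h0 : ∀ a t, H a t ≠ 0) (hr : Continuous r)
    (hr0 : ∀ a, r a ^ 2 = H a 0) :
    ∃ R : A → I → ℂ, Continuous (fun p : A × I => R p.1 p.2) ∧ (∀ a t, R a t ^ 2 = H a t) ∧
      ∀ a, R a 0 = r a := by
  -- Squaring is a covering of the punctured plane. The family `H` is a homotopy of maps from `A`,
  -- and lifting it gives the roots jointly continuously in the parameter.
  have cov := isCoveringMap_npow (𝕜 := ℂ) 2 (by norm_num)
  have hr1 : ∀ a, r a ≠ 0 := fun a h => h0 a 0 (by rw [← hr0 a, h]; simp)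
  let H' : C(I × A, {x : ℂ // x ≠ 0}) := ⟨fun p => ⟨H p.2 p.1, h0 _ _⟩,
    Continuous.subtype_mk (hH.comp (continuous_snd.prodMk continuous_fst)) _⟩
  let f : C(A, {x : ℂ // x ≠ 0}) := ⟨fun a => ⟨r a, hr1 a⟩, hr.subtype_mk _⟩
  have hf : ∀ a, H' (0, a) = ⟨(f a : ℂ) ^ 2, pow_ne_zero 2 (f a).2⟩ := fun a =>
    Subtype.ext (hr0 a).symm
  let L := cov.liftHomotopy H' f hf
  refine ⟨fun a t => L (t, a), ?_, fun a t => ?_, fun a => ?_⟩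
  · exact continuous_subtype_val.comp (L.continuous.comp (continuous_snd.prodMk continuous_fst))
  · exact congrArg Subtype.val (congrFun (cov.liftHomotopy_lifts H' f hf) (t, a))
  · exact congrArg Subtype.val (cov.liftHomotopy_zero H' f hf a)

theorem continuous_rootAlong {A : Type*} [TopologicalSpace A] {H : A → I → ℂ} {r : A → ℂ}
    (hH : Continuous fun p : A × I => H p.1 p.2) (h0 : ∀ a t, H a t ≠ 0) (hr : Continuous r)
    (hr0 : ∀ a, r a ^ 2 = H a 0) : Continuous fun a => rootAlong (H a) (r a) := by
  obtain ⟨R, hR, hsq, hz⟩ := exists_root_family hH h0 hr hr0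
  have : (fun a => rootAlong (H a) (r a)) = fun a => R a 1 := by
    ext a
    rw [← hz a]
    exact rootAlong_eq (hR.comp (Continuous.prodMk_right a)) (hsq a) (h0 a)
  rw [this]
  exact hR.comp (Continuous.prodMk_left 1)

theorem rootAlong_sq {γ : I → ℂ} {r : ℂ} (hγ : Continuous γ) (h0 : ∀ t, γ t ≠ 0)
    (hr : r ^ 2 = γ 0) : rootAlong γ r ^ 2 = γ 1 := by
  obtain ⟨R, hR, hsq, hz⟩ := exists_root_family (A := Unit) (H := fun _ => γ) (r := fun _ => r)
    (hγ.comp continuous_snd) (fun _ => h0) continuous_const (fun _ => hr)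
  have h1 := rootAlong_eq (hR.comp (Continuous.prodMk_right ())) (hsq ()) h0
  simp only [Function.comp_def, hz] at h1
  rw [h1, hsq]

end RootAlong

/-! ### Homeomorphisms of the plane that are the identity outside the disc -/

/-- The group of homeomorphisms of the plane that fix every point outside the open unit disc and
preserve the set `z`. -/
def planeHomeo (z : Finset ℂ) : Subgroup (ℂ ≃ₜ ℂ) where
  carrier := {h | (∀ x : ℂ, 1 ≤ ‖x‖ → h x = x) ∧ ∀ x : ℂ, h x ∈ z ↔ x ∈ z}
  one_mem' := ⟨fun _ _ => rfl, fun _ => Iff.rfl⟩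
  mul_mem' := by
    rintro f g ⟨hf, hf'⟩ ⟨hg, hg'⟩
    refine ⟨fun x hx => ?_, fun x => (hf' (g x)).trans (hg' x)⟩
    change f (g x) = x
    rw [hg x hx, hf x hx]
  inv_mem' := by
    rintro f ⟨hf, hf'⟩
    refine ⟨fun x hx => f.symm_apply_eq.2 (hf x hx).symm, fun x => ?_⟩
    have := hf' (f.symm x)
    rw [f.apply_symm_apply] at this
    exact this.symm

variable {z : Finset ℂ} {h g : ℂ ≃ₜ ℂ} {a x : ℂ}

theorem norm_lt_of_mem (hh : h ∈ planeHomeo z) (ha : ‖a‖ < 1) : ‖h a‖ < 1 := by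
  by_contra hcon
  have h1 : h (h a) = h a := hh.1 _ (not_lt.1 hcon)
  rw [h.injective h1] at hcon
  exact hcon ha

theorem norm_le_of_mem (hh : h ∈ planeHomeo z) (hx : ‖x‖ ≤ 1) : ‖h x‖ ≤ 1 := by
  rcases hx.lt_or_eq with h1 | h1
  · exact (norm_lt_of_mem hh h1).le
  · rw [hh.1 x h1.ge, h1]

theorem prod_comp_of_mem (hh : h ∈ planeHomeo z) (φ : ℂ → ℂ) :
    ∏ a ∈ z, φ (h a) = ∏ a ∈ z, φ a := by
  refine Finset.prod_nbij h (fun a ha => (hh.2 a).2 ha) h.injective.injOn (fun b hb => ?_)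
    fun _ _ => rfl
  refine ⟨h.symm b, ?_, h.apply_symm_apply b⟩
  have := hh.2 (h.symm b)
  rw [h.apply_symm_apply] at this
  exact this.1 hb

/-! ### The square root of the difference quotient, normalized at infinity -/

section QuotientRoot

/-- The path from a point far away to `x` along the ray emanating from `a`. -/
noncomputable def radialPath (a x : ℂ) (t : I) : ℂ :=
  a + (1 + (1 - (t : ℝ)) * (3 / ‖x - a‖)) • (x - a)

theorem radialPath_one : radialPath a x 1 = x := by simp [radialPath]

theorem radialPath_ne (hx : x ≠ a) (t : I) : radialPath a x t ≠ a := by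
  have h1 : 0 ≤ (1 - (t : ℝ)) * (3 / ‖x - a‖) :=
    mul_nonneg (sub_nonneg.2 t.2.2) (by positivity)
  rw [radialPath, Ne, add_eq_left, smul_eq_zero, not_or]
  exact ⟨by linarith, sub_ne_zero.2 hx⟩

/-- The constant `3` puts the starting point at distance `‖x - a‖ + 3` from `a`, hence at norm at
least `2`. There `h` is the identity and `outerRoot` supplies the initial value. -/
theorem norm_radialPath_zero (ha : ‖a‖ < 1) (hx : x ≠ a) : 2 ≤ ‖radialPath a x 0‖ := by
  have h0 : 0 < ‖x - a‖ := norm_pos_iff.2 (sub_ne_zero.2 hx)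
  have h1 : ‖(1 + 3 / ‖x - a‖) • (x - a)‖ = ‖x - a‖ + 3 := by
    rw [norm_smul, Real.norm_of_nonneg (by positivity)]
    field_simp
  have h2 : radialPath a x 0 = (1 + 3 / ‖x - a‖) • (x - a) + a := by
    simp [radialPath, add_comm]
  have h3 := norm_sub_norm_le ((1 + 3 / ‖x - a‖) • (x - a)) (-a)
  rw [sub_neg_eq_add, ← h2, h1, norm_neg] at h3
  linarith

/-- The norm does not get smaller than `‖x‖` along the radial path to `x`. -/
theorem norm_le_norm_radialPath (ha : ‖a‖ < ‖x‖) (t : I) : ‖x‖ ≤ ‖radialPath a x t‖ := by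
  by_contra hcon
  rw [not_le] at hcon
  set c : ℝ := 1 + (1 - (t : ℝ)) * (3 / ‖x - a‖) with hc
  have hc1 : 1 ≤ c := by
    have : 0 ≤ (1 - (t : ℝ)) * (3 / ‖x - a‖) :=
      mul_nonneg (sub_nonneg.2 t.2.2) (by positivity)
    linarith
  have hc0 : 0 < c := by linarith
  -- The point `x` lies on the segment from `a` to the point of the path. If both ends were in the
  -- open ball of radius `‖x‖`, convexity would put `x` in it.
  have hconv := convex_ball (0 : ℂ) ‖x‖
  have hmem := hconv.add_smul_sub_mem (x := a) (y := radialPath a x t) (t := c⁻¹)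
    (by simpa using ha) (by simpa using hcon) ⟨by positivity, inv_le_one_of_one_le₀ hc1⟩
  have : a + c⁻¹ • (radialPath a x t - a) = x := by
    rw [radialPath, ← hc, add_sub_cancel_left, smul_smul, inv_mul_cancel₀ hc0.ne', one_smul,
      add_sub_cancel]
  rw [this] at hmem
  simp at hmem

/-- The difference quotient of `h` at `a`. -/
noncomputable def dquot (h : ℂ ≃ₜ ℂ) (a x : ℂ) : ℂ := (h x - h a) / (x - a)

theorem dquot_ne_zero (hx : x ≠ a) : dquot h a x ≠ 0 :=
  div_ne_zero (sub_ne_zero.2 fun h1 => hx (h.injective h1)) (sub_ne_zero.2 hx)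

/-- The square root of `(x - b) / (x - a)` near infinity. -/
noncomputable def outerRoot (a b x : ℂ) : ℂ := csqrt (1 - b / x) / csqrt (1 - a / x)

theorem one_sub_div_mem_slitPlane {a x : ℂ} (h : ‖a‖ < ‖x‖) : 1 - a / x ∈ Complex.slitPlane := by
  rw [sub_eq_add_neg]
  refine Complex.mem_slitPlane_of_norm_lt_one ?_
  rw [norm_neg, norm_div]
  exact (div_lt_one ((norm_nonneg a).trans_lt h)).2 h

theorem csqrt_one_sub_div_ne_zero {a x : ℂ} (h : ‖a‖ < ‖x‖) : csqrt (1 - a / x) ≠ 0 :=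
  csqrt_ne_zero (Complex.slitPlane_ne_zero (one_sub_div_mem_slitPlane h))

theorem outerRoot_sq {a b x : ℂ} (ha : ‖a‖ < ‖x‖) :
    outerRoot a b x ^ 2 = (x - b) / (x - a) := by
  have hx : x ≠ 0 := by
    rintro rfl
    simp only [norm_zero] at ha
    exact absurd ha (norm_nonneg a).not_gt
  have hxa : x - a ≠ 0 := sub_ne_zero.2 (by rintro rfl; exact lt_irrefl _ ha)
  rw [outerRoot, div_pow, csqrt_sq, csqrt_sq]
  field_simp

theorem continuousOn_outerRoot :
    ContinuousOn (fun p : (ℂ × ℂ) × ℂ => outerRoot p.1.1 p.1.2 p.2)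
      {p | ‖p.1.1‖ < ‖p.2‖ ∧ ‖p.1.2‖ < ‖p.2‖} := by
  have h0 : ∀ p ∈ {p : (ℂ × ℂ) × ℂ | ‖p.1.1‖ < ‖p.2‖ ∧ ‖p.1.2‖ < ‖p.2‖}, p.2 ≠ 0 :=
    fun p hp => norm_pos_iff.1 ((norm_nonneg _).trans_lt hp.1)
  refine ContinuousOn.div ?_ ?_ fun p hp => csqrt_one_sub_div_ne_zero hp.1
  · exact continuousOn_csqrt.comp (continuousOn_const.sub
      ((by fun_prop : Continuous fun p : (ℂ × ℂ) × ℂ => p.1.2).continuousOn.div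
        continuous_snd.continuousOn h0)) fun p hp => one_sub_div_mem_slitPlane hp.2
  · exact continuousOn_csqrt.comp (continuousOn_const.sub
      ((by fun_prop : Continuous fun p : (ℂ × ℂ) × ℂ => p.1.1).continuousOn.div
        continuous_snd.continuousOn h0)) fun p hp => one_sub_div_mem_slitPlane hp.1

/-- The continuous square root of the difference quotient of `h` at `a` that tends to `1` at
infinity. -/
noncomputable def quotRoot (h : ℂ ≃ₜ ℂ) (a x : ℂ) : ℂ :=
  rootAlong (fun t => dquot h a (radialPath a x t)) (outerRoot a (h a) (radialPath a x 0))

theorem outerRoot_sq_eq_dquot (hx : h x = x) (ha : ‖a‖ < ‖x‖) :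
    outerRoot a (h a) x ^ 2 = dquot h a x := by
  rw [outerRoot_sq ha, dquot, hx]

theorem continuous_radialPath : Continuous (radialPath a x) := by
  unfold radialPath
  fun_prop

theorem continuousOn_dquot : ContinuousOn (dquot h a) {a}ᶜ :=
  ((h.continuous.sub continuous_const).continuousOn).div
    ((continuous_id.sub continuous_const).continuousOn) fun _ hx => sub_ne_zero.2 hx

theorem outerRoot_radialPath_zero_sq (hh : h ∈ planeHomeo z) (ha : ‖a‖ < 1) (hx : x ≠ a) :
    outerRoot a (h a) (radialPath a x 0) ^ 2 = dquot h a (radialPath a x 0) := by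
  have := norm_radialPath_zero ha hx
  exact outerRoot_sq_eq_dquot (hh.1 _ (by linarith)) (by linarith)

theorem quotRoot_sq (hh : h ∈ planeHomeo z) (ha : ‖a‖ < 1) (hx : x ≠ a) :
    quotRoot h a x ^ 2 = dquot h a x := by
  have := rootAlong_sq (γ := fun t => dquot h a (radialPath a x t))
    (continuousOn_dquot.comp_continuous continuous_radialPath (radialPath_ne hx))
    (fun t => dquot_ne_zero (radialPath_ne hx t)) (outerRoot_radialPath_zero_sq hh ha hx)
  rwa [radialPath_one] at this

/-- No monodromy has to be computed: the radial paths and their initial roots vary continuously with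
the endpoint in `ℂ \ {a}` and with the parameter, hence so do the final roots. -/
theorem continuousOn_quotRoot_family {Λ : Type*} [TopologicalSpace Λ] {h : Λ → ℂ ≃ₜ ℂ}
    (hh : ∀ l, h l ∈ planeHomeo z) (hc : Continuous fun p : Λ × ℂ => h p.1 p.2) (ha : ‖a‖ < 1) :
    ContinuousOn (fun p : Λ × ℂ => quotRoot (h p.1) a p.2) {p | p.2 ≠ a} := by
  rw [continuousOn_iff_continuous_domRestrict]
  have hpath : Continuous fun q : {p : Λ × ℂ | p.2 ≠ a} × I => radialPath a q.1.1.2 q.2 := by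
    unfold radialPath
    have : ∀ q : {p : Λ × ℂ | p.2 ≠ a} × I, ‖q.1.1.2 - a‖ ≠ 0 := fun q =>
      norm_ne_zero_iff.2 (sub_ne_zero.2 q.1.2)
    fun_prop (disch := assumption)
  have hval : Continuous fun q : {p : Λ × ℂ | p.2 ≠ a} × I => h q.1.1.1 a :=
    hc.comp (by fun_prop : Continuous fun q : {p : Λ × ℂ | p.2 ≠ a} × I => (q.1.1.1, a))
  refine continuous_rootAlong
    (H := fun (q : {p : Λ × ℂ | p.2 ≠ a}) t => dquot (h q.1.1) a (radialPath a q.1.2 t))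
    (r := fun q => outerRoot a (h q.1.1 a) (radialPath a q.1.2 0)) ?_
    (fun q t => dquot_ne_zero (radialPath_ne q.2 t)) ?_
    fun q => outerRoot_radialPath_zero_sq (hh _) ha q.2
  · unfold dquot
    refine Continuous.div ?_ (hpath.sub continuous_const)
      fun q => sub_ne_zero.2 (radialPath_ne q.1.2 q.2)
    exact (hc.comp ((by fun_prop : Continuous fun q : {p : Λ × ℂ | p.2 ≠ a} × I =>
      q.1.1.1).prodMk hpath)).sub hval
  · refine continuousOn_outerRoot.comp_continuous
      (f := fun q : {p : Λ × ℂ | p.2 ≠ a} => ((a, h q.1.1 a), radialPath a q.1.2 0)) ?_ fun q => ?_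
    · have h0 : Continuous fun q : {p : Λ × ℂ | p.2 ≠ a} => (q, (0 : I)) := by fun_prop
      exact (continuous_const.prodMk (hval.comp h0)).prodMk (hpath.comp h0)
    · have h1 := norm_radialPath_zero ha q.2
      have h2 := norm_lt_of_mem (hh q.1.1) ha
      exact ⟨by change ‖a‖ < _; linarith, by change ‖h q.1.1 a‖ < _; linarith⟩

theorem continuousOn_quotRoot (hh : h ∈ planeHomeo z) (ha : ‖a‖ < 1) :
    ContinuousOn (quotRoot h a) {a}ᶜ :=
  (continuousOn_quotRoot_family (Λ := Unit) (fun _ => hh) (h.continuous.comp continuous_snd)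
    ha).comp (f := fun x => ((), x)) (by fun_prop) fun _ hx => hx

/-- Uniqueness of the square root of the difference quotient. -/
theorem quotRoot_eq {T : ℂ → ℂ} (ha : ‖a‖ < 1)
    (hT : ContinuousOn T {a}ᶜ) (hsq : ∀ x ≠ a, T x ^ 2 = dquot h a x)
    (hout : ∀ x, 2 ≤ ‖x‖ → T x = outerRoot a (h a) x) (hx : x ≠ a) : quotRoot h a x = T x := by
  have := rootAlong_eq (γ := fun t => dquot h a (radialPath a x t))
    (ρ := fun t => T (radialPath a x t))
    (hT.comp_continuous continuous_radialPath (radialPath_ne hx))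
    (fun t => hsq _ (radialPath_ne hx t)) (fun t => dquot_ne_zero (radialPath_ne hx t))
  rwa [hout _ (norm_radialPath_zero ha hx), radialPath_one] at this

/-- The whole radial path to `x` stays in the region fixed by `h`, where `outerRoot` is itself a
continuous root of the difference quotient. -/
theorem quotRoot_eq_outerRoot (ha : ‖a‖ < ‖x‖) (hha : ‖h a‖ < ‖x‖)
    (hfix : ∀ y, ‖x‖ ≤ ‖y‖ → h y = y) : quotRoot h a x = outerRoot a (h a) x := by
  have hx : x ≠ a := by rintro rfl; exact lt_irrefl _ ha
  have hp := norm_le_norm_radialPath ha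
  have := rootAlong_eq (γ := fun t => dquot h a (radialPath a x t))
    (ρ := fun t => outerRoot a (h a) (radialPath a x t)) ?_
    (fun t => outerRoot_sq_eq_dquot (hfix _ (hp t)) (ha.trans_le (hp t)))
    (fun t => dquot_ne_zero (radialPath_ne hx t))
  · rwa [radialPath_one] at this
  · exact continuousOn_outerRoot.comp_continuous (f := fun t => ((a, h a), radialPath a x t))
      (continuous_const.prodMk continuous_radialPath)
      fun t => ⟨ha.trans_le (hp t), hha.trans_le (hp t)⟩

theorem quotRoot_one (ha : ‖a‖ < 1) (hx : x ≠ a) : quotRoot 1 a x = 1 := by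
  refine quotRoot_eq (T := fun _ => 1) ha continuousOn_const (fun x hx => ?_) (fun x hx' => ?_) hx
  · rw [dquot, one_pow]
    exact (div_self (sub_ne_zero.2 hx)).symm
  · exact (div_self (csqrt_one_sub_div_ne_zero (a := a) (by linarith))).symm

theorem outerRoot_mul_outerRoot {a b c x : ℂ} (hb : ‖b‖ < ‖x‖) :
    outerRoot b c x * outerRoot a b x = outerRoot a c x := by
  rw [outerRoot, outerRoot, outerRoot, div_mul_div_cancel₀ (csqrt_one_sub_div_ne_zero hb)]

/-- The right side squares to the product of two difference quotients, which telescopes, and it has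
the right normalization far away. Uniqueness does the rest. This cocycle identity makes lifting a
homomorphism. -/
theorem quotRoot_mul (hg : g ∈ planeHomeo z) (hh : h ∈ planeHomeo z) (ha : ‖a‖ < 1) (hx : x ≠ a) :
    quotRoot (g * h) a x = quotRoot g (h a) (h x) * quotRoot h a x := by
  have hha := norm_lt_of_mem hh ha
  refine quotRoot_eq (T := fun x => quotRoot g (h a) (h x) * quotRoot h a x) ha ?_ ?_ ?_ hx
  · exact ((continuousOn_quotRoot hg hha).comp h.continuous.continuousOn
      fun x (hx : x ≠ a) h1 => hx (h.injective h1)).mul (continuousOn_quotRoot hh ha)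
  · intro x hx
    have hx' : h x ≠ h a := fun h1 => hx (h.injective h1)
    rw [mul_pow, quotRoot_sq hg hha hx', quotRoot_sq hh ha hx, dquot, dquot,
      div_mul_div_cancel₀ (sub_ne_zero.2 hx')]
    rfl
  · intro x hx
    have h2 := norm_lt_of_mem hg hha
    rw [hh.1 x (by linarith), quotRoot_eq_outerRoot (by linarith) (by linarith)
      fun y hy => hg.1 y (by linarith), quotRoot_eq_outerRoot (by linarith) (by linarith)
      fun y hy => hh.1 y (by linarith), outerRoot_mul_outerRoot (by linarith)]
    rfl

/-- Since `h` permutes `z`, numerator and denominator are the same product. It is the reason why the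
canonical lift fixes both boundary components instead of exchanging them. -/
theorem prod_outerRoot_eq_one (hh : h ∈ planeHomeo z) (hx : ∀ a ∈ z, ‖a‖ < ‖x‖) :
    ∏ a ∈ z, outerRoot a (h a) x = 1 := by
  simp only [outerRoot, Finset.prod_div_distrib]
  rw [prod_comp_of_mem hh (fun a => csqrt (1 - a / x))]
  exact div_self (Finset.prod_ne_zero_iff.2 fun a ha => csqrt_one_sub_div_ne_zero (hx a ha))

end QuotientRoot

/-! ### The canonical lift to the hyperelliptic curve -/

section Lift

/-- The affine hyperelliptic curve `w² = ∏_{a ∈ z} (x - a)`. -/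
def curve (z : Finset ℂ) : Set (ℂ × ℂ) := {p | p.2 ^ 2 = ∏ a ∈ z, (p.1 - a)}

theorem snd_eq_zero_iff {q : ℂ × ℂ} (hq : q ∈ curve z) : q.2 = 0 ↔ q.1 ∈ z := by
  have hq' : q.2 ^ 2 = ∏ a ∈ z, (q.1 - a) := hq
  rw [← sq_eq_zero_iff, hq', Finset.prod_eq_zero_iff]
  constructor
  · rintro ⟨a, ha, h0⟩
    rwa [sub_eq_zero.1 h0]
  · exact fun h => ⟨q.1, h, sub_self _⟩

/-- The lift to the hyperelliptic curve of a homeomorphism of the plane. -/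
noncomputable def curveLift (z : Finset ℂ) (h : ℂ ≃ₜ ℂ) (q : ℂ × ℂ) : ℂ × ℂ :=
  (h q.1, q.2 * ∏ a ∈ z, quotRoot h a q.1)

/-- Squaring turns the roots into `(h x - h a)/(x - a)`. The denominators cancel against `w²`, and
the numerators are reindexed by the permutation of `z`. -/
theorem curveLift_mem (hz : ∀ a ∈ z, ‖a‖ < 1) (hh : h ∈ planeHomeo z) {q : ℂ × ℂ}
    (hq : q ∈ curve z) : curveLift z h q ∈ curve z := by
  change (q.2 * ∏ a ∈ z, quotRoot h a q.1) ^ 2 = ∏ a ∈ z, (h q.1 - a)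
  by_cases hx : q.1 ∈ z
  · rw [(snd_eq_zero_iff hq).2 hx, Finset.prod_eq_zero ((hh.2 _).2 hx) (sub_self _)]
    simp
  · have hne : ∀ a ∈ z, q.1 ≠ a := fun a ha h0 => hx (h0 ▸ ha)
    rw [mul_pow, ← Finset.prod_pow, (hq : q.2 ^ 2 = _), ← Finset.prod_mul_distrib,
      ← prod_comp_of_mem hh (fun a => h q.1 - a)]
    refine Finset.prod_congr rfl fun a ha => ?_
    rw [quotRoot_sq hh (hz a ha) (hne a ha), dquot, mul_div_cancel₀ _ (sub_ne_zero.2 (hne a ha))]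

theorem curveLift_mul (hz : ∀ a ∈ z, ‖a‖ < 1) (hg : g ∈ planeHomeo z) (hh : h ∈ planeHomeo z)
    {q : ℂ × ℂ} (hq : q ∈ curve z) :
    curveLift z (g * h) q = curveLift z g (curveLift z h q) := by
  refine Prod.ext rfl ?_
  change q.2 * ∏ a ∈ z, quotRoot (g * h) a q.1 =
    (q.2 * ∏ a ∈ z, quotRoot h a q.1) * ∏ a ∈ z, quotRoot g a (h q.1)
  by_cases hx : q.1 ∈ z
  · rw [(snd_eq_zero_iff hq).2 hx]; simp
  · have hne : ∀ a ∈ z, q.1 ≠ a := fun a ha h0 => hx (h0 ▸ ha)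
    rw [mul_assoc, ← prod_comp_of_mem hh (fun a => quotRoot g a (h q.1)),
      ← Finset.prod_mul_distrib]
    congr 1
    refine Finset.prod_congr rfl fun a ha => ?_
    rw [quotRoot_mul hg hh (hz a ha) (hne a ha), mul_comm]

theorem curveLift_eq_self (hh : h ∈ planeHomeo z) {q : ℂ × ℂ}
    (hx : ∀ a ∈ z, ‖a‖ < ‖q.1‖) (hfix : ∀ y, ‖q.1‖ ≤ ‖y‖ → h y = y) : curveLift z h q = q := by
  refine Prod.ext (hfix _ le_rfl) ?_
  change q.2 * _ = q.2
  rw [Finset.prod_congr rfl fun a ha => quotRoot_eq_outerRoot (hx a ha)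
    (hx _ ((hh.2 a).2 ha)) hfix, prod_outerRoot_eq_one hh hx, mul_one]

theorem curveLift_one (hz : ∀ a ∈ z, ‖a‖ < 1) {q : ℂ × ℂ} (hq : q ∈ curve z) :
    curveLift z 1 q = q := by
  refine Prod.ext rfl ?_
  change q.2 * ∏ a ∈ z, quotRoot 1 a q.1 = q.2
  by_cases hx : q.1 ∈ z
  · rw [(snd_eq_zero_iff hq).2 hx]; simp
  · have hne : ∀ a ∈ z, q.1 ≠ a := fun a ha h0 => hx (h0 ▸ ha)
    rw [Finset.prod_congr rfl fun a ha => quotRoot_one (hz a ha) (hne a ha)]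
    simp

/-- A map into the curve whose first coordinate is continuous and whose second coordinate is
continuous away from the branch points is continuous. -/
theorem continuousOn_of_continuousOn_fst {X : Type*} [TopologicalSpace X] {f : X → ℂ × ℂ}
    {A : Set X} (hf : MapsTo f A (curve z)) (h1 : ContinuousOn (fun p => (f p).1) A)
    (h2 : ∀ p ∈ A, (f p).1 ∉ z → ContinuousWithinAt (fun p => (f p).2) A p) :
    ContinuousOn f A := by
  refine fun p hp => (h1 p hp).prodMk ?_
  by_cases hx : (f p).1 ∈ z
  -- At a branch point `w = 0`, and `‖w‖² = ∏ ‖x - a‖` forces `w` to tend to `0` with the product.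
  · have h3 : ContinuousWithinAt (fun p => ‖(f p).2‖ ^ 2) A p := by
      have h4 : ContinuousWithinAt (fun p => ‖∏ a ∈ z, ((f p).1 - a)‖) A p :=
        ContinuousWithinAt.norm (tendsto_finsetProd z fun a _ => (h1 p hp).sub_const a)
      refine h4.congr (fun y hy => ?_) ?_
      · rw [← norm_pow, (hf hy : (f y).2 ^ 2 = _)]
      · rw [← norm_pow, (hf hp : (f p).2 ^ 2 = _)]
    have h0 : (f p).2 = 0 := (snd_eq_zero_iff (hf hp)).2 hx
    have h5 : ContinuousWithinAt (fun p => ‖(f p).2‖) A p := by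
      simpa [Real.sqrt_sq] using h3.sqrt
    unfold ContinuousWithinAt at h5 ⊢
    simp only [h0, norm_zero] at h5 ⊢
    exact tendsto_zero_iff_norm_tendsto_zero.2 h5
  · exact h2 p hp hx

theorem continuousOn_curveLift_family (hz : ∀ a ∈ z, ‖a‖ < 1) {Λ : Type*} [TopologicalSpace Λ]
    {h : Λ → ℂ ≃ₜ ℂ} (hh : ∀ l, h l ∈ planeHomeo z)
    (hc : Continuous fun p : Λ × ℂ => h p.1 p.2) :
    ContinuousOn (fun p : Λ × ℂ × ℂ => curveLift z (h p.1) p.2) (univ ×ˢ curve z) := by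
  refine continuousOn_of_continuousOn_fst (fun p hp => curveLift_mem hz (hh p.1) hp.2) ?_ ?_
  · exact (hc.comp (by fun_prop : Continuous fun p : Λ × ℂ × ℂ => (p.1, p.2.1))).continuousOn
  · intro p hp hx
    have hx' : p.2.1 ∉ z := fun h1 => hx (((hh p.1).2 _).2 h1)
    refine ContinuousAt.continuousWithinAt ?_
    refine (continuous_snd.comp continuous_snd).continuousAt.mul
      (tendsto_finsetProd z fun a ha => ?_)
    have h1 := (continuousOn_quotRoot_family hh hc (hz a ha)).continuousAt (x := (p.1, p.2.1))
      ((isOpen_ne.preimage continuous_snd).mem_nhds fun h0 : p.2.1 = a => hx' (h0 ▸ ha))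
    exact h1.comp (f := fun p : Λ × ℂ × ℂ => (p.1, p.2.1)) (by fun_prop)

end Lift

variable {z : Finset ℂ}

/-! ### Homomorphisms to homeomorphism groups -/

section Actions

/-- The homomorphism to the group of homeomorphisms given by a continuous action. -/
def homOfAction {G X : Type*} [Group G] [TopologicalSpace X] (A : G → X → X)
    (hcont : ∀ g, Continuous (A g)) (h1 : ∀ x, A 1 x = x)
    (hmul : ∀ g h x, A (g * h) x = A g (A h x)) : G →* (X ≃ₜ X) where
  toFun g :=
    { toFun := A g
      invFun := A g⁻¹
      left_inv := fun x => by rw [← hmul, inv_mul_cancel, h1]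
      right_inv := fun x => by rw [← hmul, mul_inv_cancel, h1]
      continuous_toFun := hcont g
      continuous_invFun := hcont g⁻¹ }
  map_one' := Homeomorph.ext h1
  map_mul' g h := Homeomorph.ext (hmul g h)

/-- The homomorphism to `Homeo(Σ, ∂Σ)` given by an action on the surface in coordinates. -/
noncomputable def surfaceHom {G : Type*} [Group G] (A : G → ℂ × ℂ → ℂ × ℂ)
    (hmaps : ∀ g, MapsTo (A g) (surface z) (surface z))
    (hcont : ∀ g, ContinuousOn (A g) (surface z)) (h1 : ∀ q ∈ surface z, A 1 q = q)
    (hmul : ∀ g h, ∀ q ∈ surface z, A (g * h) q = A g (A h q))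
    (hbd : ∀ g, ∀ q ∈ surface z, ‖q.1‖ = 1 → A g q = q) : G →* homeoSurface z :=
  (homOfAction (fun g => (hmaps g).restrict (A g) (surface z) (surface z))
    (fun g => (hcont g).mapsToRestrict (hmaps g)) (fun q => Subtype.ext (h1 q q.2))
    (fun g h q => Subtype.ext (hmul g h q q.2))).codRestrict (homeoSurface z)
    fun g q hq => Subtype.ext (hbd g q q.2 hq)

/-- The canonical lift, as a homomorphism. -/
noncomputable def liftHom (hz : ∀ a ∈ z, ‖a‖ < 1) : planeHomeo z →* homeoSurface z :=
  surfaceHom (fun h => curveLift z h)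
    (fun h _ hq => ⟨norm_le_of_mem h.2 hq.1, curveLift_mem hz h.2 hq.2⟩)
    (fun h => (continuousOn_curveLift_family hz (Λ := Unit) (fun _ => h.2)
      (h.1.continuous.comp continuous_snd)).comp (f := fun q => ((), q)) (by fun_prop)
      fun _ hq => ⟨mem_univ _, hq.2⟩)
    (fun _ hq => curveLift_one hz hq.2) (fun g h _ hq => curveLift_mul hz g.2 h.2 hq.2)
    (fun h q _ hq1 => curveLift_eq_self h.2 (fun a ha => by rw [hq1]; exact hz a ha)
      fun y hy => h.2.1 y (hq1 ▸ hy))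

theorem continuous_liftHom_family (hz : ∀ a ∈ z, ‖a‖ < 1) {Λ : Type*} [TopologicalSpace Λ]
    {h : Λ → planeHomeo z} (hc : Continuous fun p : Λ × ℂ => (h p.1 : ℂ ≃ₜ ℂ) p.2) :
    Continuous fun p : Λ × surface z => (liftHom hz (h p.1) : surface z ≃ₜ surface z) p.2 := by
  refine Continuous.subtype_mk (f := fun p : Λ × surface z => curveLift z (h p.1) p.2) ?_ _
  exact (continuousOn_curveLift_family hz (fun l => (h l).2) hc).comp_continuous
    (f := fun p : Λ × surface z => (p.1, (p.2 : ℂ × ℂ))) (by fun_prop) fun p => ⟨mem_univ _, p.2.2.2⟩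

end Actions

/-! ### Extension from the disc to the plane -/

section Extension

open Classical in
/-- The extension by the identity of a self-map of the disc. -/
noncomputable def extendDisc (f : disc → disc) (x : ℂ) : ℂ :=
  if hx : x ∈ disc then f ⟨x, hx⟩ else x

theorem extendDisc_of_mem {f : disc → disc} {x : ℂ} (hx : x ∈ disc) :
    extendDisc f x = f ⟨x, hx⟩ := dif_pos hx

theorem extendDisc_of_le {f : disc → disc} (hf : ∀ x : disc, ‖(x : ℂ)‖ = 1 → f x = x) {x : ℂ}
    (hx : 1 ≤ ‖x‖) : extendDisc f x = x := by
  by_cases h : x ∈ disc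
  · rw [extendDisc_of_mem h, hf ⟨x, h⟩ (le_antisymm h hx)]
  · exact dif_neg h

theorem continuous_extendDisc_family {Λ : Type*} [TopologicalSpace Λ] {f : Λ → disc → disc}
    (hf : ∀ l, ∀ x : disc, ‖(x : ℂ)‖ = 1 → f l x = x)
    (hc : Continuous fun p : Λ × disc => f p.1 p.2) :
    Continuous fun p : Λ × ℂ => extendDisc (f p.1) p.2 := by
  have h1 : ContinuousOn (fun p : Λ × ℂ => extendDisc (f p.1) p.2) {p | ‖p.2‖ ≤ 1} := by
    rw [continuousOn_iff_continuous_domRestrict]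
    have : Continuous fun p : {p : Λ × ℂ | ‖p.2‖ ≤ 1} => (f p.1.1 ⟨p.1.2, p.2⟩ : ℂ) :=
      continuous_subtype_val.comp (hc.comp
        (f := fun p : {p : Λ × ℂ | ‖p.2‖ ≤ 1} => (p.1.1, (⟨p.1.2, p.2⟩ : disc))) (by fun_prop))
    exact this.congr fun p => (extendDisc_of_mem p.2).symm
  have h2 : ContinuousOn (fun p : Λ × ℂ => extendDisc (f p.1) p.2) {p | 1 ≤ ‖p.2‖} :=
    continuous_snd.continuousOn.congr fun p hp => extendDisc_of_le (hf p.1) hp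
  rw [← continuousOn_univ]
  refine (h1.union_of_isClosed h2 (isClosed_le (by fun_prop) continuous_const)
    (isClosed_le continuous_const (by fun_prop))).mono fun p _ => le_total ‖p.2‖ 1

/-- Extension by the identity, as a homomorphism. -/
noncomputable def extendHom (z : Finset ℂ) : homeoDisc z →* planeHomeo z :=
  (homOfAction (fun f : homeoDisc z => extendDisc (f : disc ≃ₜ disc))
    (fun f => (continuous_extendDisc_family (Λ := Unit) (f := fun _ => (f : disc ≃ₜ disc))
      (fun _ => f.2.1) ((f : disc ≃ₜ disc).continuous.comp continuous_snd)).comp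
      (f := fun x => ((), x)) (by fun_prop))
    (fun x => by
      by_cases h : x ∈ disc
      · exact extendDisc_of_mem h
      · exact dif_neg h)
    (fun f g x => by
      by_cases h : x ∈ disc
      · rw [extendDisc_of_mem h, extendDisc_of_mem h, extendDisc_of_mem (Subtype.coe_prop _)]
        rfl
      · have hx : extendDisc (g : disc ≃ₜ disc) x = x := dif_neg h
        rw [hx, extendDisc, dif_neg h, extendDisc, dif_neg h])).codRestrict (planeHomeo z) fun f => by
    refine ⟨fun x hx => extendDisc_of_le f.2.1 hx, fun x => ?_⟩
    change extendDisc (f : disc ≃ₜ disc) x ∈ z ↔ x ∈ z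
    by_cases h : x ∈ disc
    · rw [extendDisc_of_mem h]
      exact f.2.2 ⟨x, h⟩
    · rw [extendDisc, dif_neg h]

theorem extendHom_apply (f : homeoDisc z) (x : ℂ) :
    (extendHom z f : ℂ ≃ₜ ℂ) x = extendDisc (f : disc ≃ₜ disc) x := rfl

end Extension

/-! ### Uniqueness of lifts that fix the boundary -/

section Uniqueness

/-- Directions of real part `1` are parametrized by their slope, and each point of `z` excludes at
most one slope. -/
theorem exists_ray_avoiding (z : Finset ℂ) {x : ℂ} (hx : x ∉ z) :
    ∃ v : ℂ, v.re = 1 ∧ ∀ s : ℝ, x + s • v ∉ z := by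
  classical
  obtain ⟨t, ht⟩ := Infinite.exists_notMem_finset (z.image fun a => (a - x).im / (a - x).re)
  refine ⟨⟨1, t⟩, rfl, fun s hs => ht (Finset.mem_image.2 ⟨_, hs, ?_⟩)⟩
  have hs0 : s ≠ 0 := by
    rintro rfl
    exact hx (by simpa using hs)
  simp [mul_div_cancel_left₀ _ hs0]

/-- A lift of `h` that fixes the boundary of the surface is the canonical one. -/
theorem eq_curveLift_of_isLift (hz : ∀ a ∈ z, ‖a‖ < 1) {h : ℂ ≃ₜ ℂ} (hh : h ∈ planeHomeo z)
    {k : surface z → ℂ × ℂ} (hk : Continuous k) (hmem : ∀ q, k q ∈ curve z)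
    (hproj : ∀ q, (k q).1 = h q.1.1) (hbd : ∀ q, ‖q.1.1‖ = 1 → k q = q) (q : surface z) :
    k q = curveLift z h q := by
  refine Prod.ext (hproj q) ?_
  by_cases hx : q.1.1 ∈ z
  · rw [(snd_eq_zero_iff (hmem q)).2 (by rw [hproj]; exact (hh.2 _).2 hx),
      (snd_eq_zero_iff (curveLift_mem hz hh q.2.2)).2 ((hh.2 _).2 hx)]
  · obtain ⟨v, hv, havoid⟩ := exists_ray_avoiding z hx
    set x := q.1.1 with hxdef
    have hqx : ‖x‖ ≤ 1 := q.2.1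
    -- By time `2` the real part has grown by `2` from a value at least `-1`, so the line has
    -- reached norm at least `1`.
    obtain ⟨s₁, hs₁, hs₁'⟩ : ∃ s ∈ Icc (0 : ℝ) 2, ‖x + s • v‖ = 1 := by
      refine intermediate_value_Icc (f := fun s : ℝ => ‖x + s • v‖) (by norm_num)
        (Continuous.continuousOn (by fun_prop)) ⟨by simpa using hqx, ?_⟩
      have h1 := Complex.abs_re_le_norm (x + (2 : ℝ) • v)
      have h2 := Complex.abs_re_le_norm x
      have h3 : (x + (2 : ℝ) • v).re = x.re + 2 := by simp [hv]
      rw [h3] at h1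
      have h4 := abs_le.1 (h2.trans hqx)
      have h5 := le_abs_self (x.re + 2)
      change 1 ≤ ‖x + (2 : ℝ) • v‖
      linarith
    let β : I → ℂ := fun t => x + ((t : ℝ) * s₁) • v
    have hβ : Continuous β := by fun_prop
    have hβ0 : β 0 = x := by simp [β]
    have hβ1 : ‖β 1‖ = 1 := by simpa [β] using hs₁'
    have hβD : ∀ t, ‖β t‖ ≤ 1 := fun t => by
      have := (convex_closedBall (0 : ℂ) 1).add_smul_sub_mem (x := x) (y := x + s₁ • v)
        (by simpa using hqx) (by simpa using hs₁'.le) t.2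
      simpa [β, mul_smul] using this
    have hne : ∀ t, ∏ a ∈ z, (β t - a) ≠ 0 := fun t => Finset.prod_ne_zero_iff.2 fun a ha h0 =>
      havoid (t * s₁) (by rw [show x + ((t : ℝ) * s₁) • v = a from sub_eq_zero.1 h0]; exact ha)
    obtain ⟨R, hR, hsq, hR0⟩ := exists_root_family (A := Unit)
      (H := fun _ t => ∏ a ∈ z, (β t - a)) (r := fun _ => q.1.2) (by fun_prop) (fun _ => hne)
      continuous_const (fun _ => by rw [hβ0]; exact q.2.2)
    let Q : I → surface z := fun t => ⟨(β t, R () t), hβD t, hsq () t⟩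
    have hQ : Continuous Q :=
      (hβ.prodMk (hR.comp (Continuous.prodMk_right ()))).subtype_mk _
    have hQ0 : Q 0 = q := Subtype.ext (Prod.ext hβ0 (hR0 ()))
    have hlift : Continuous fun t => curveLift z h (Q t) :=
      (continuous_subtype_val.comp (liftHom hz ⟨h, hh⟩ : surface z ≃ₜ surface z).continuous).comp hQ
    -- The two second coordinates are roots of the same nonvanishing function along the path. They
    -- agree at its boundary end `t = 1`, hence at `t = 0`.
    have hgoal := isPreconnected_univ.eq_of_sq_eq (f := fun t => (k (Q t)).2)
      (g := fun t => (curveLift z h (Q t)).2) (y := 1) (x := 0)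
      (continuous_snd.comp (hk.comp hQ)).continuousOn (continuous_snd.comp hlift).continuousOn
      (fun t _ => ?_) (fun {t} _ h0 => ?_) (mem_univ _) ?_ (mem_univ _)
    · rw [← hQ0]
      exact hgoal
    · simp only [Pi.pow_apply]
      rw [(hmem (Q t) : (k (Q t)).2 ^ 2 = _), hproj]
      exact (curveLift_mem hz hh (Q t).2.2 : (curveLift z h (Q t)).2 ^ 2 = _).symm
    · have := (hh.2 _).1 ((snd_eq_zero_iff (curveLift_mem hz hh (Q t).2.2)).1 h0)
      exact hne t (Finset.prod_eq_zero this (sub_self _))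
    · rw [hbd (Q 1) hβ1, curveLift_eq_self hh (q := Q 1)
        (fun a ha => by rw [show ‖(Q 1).1.1‖ = 1 from hβ1]; exact hz a ha)
        fun y hy => hh.1 y (by rw [← hβ1]; exact hy)]

end Uniqueness

/-! ### The radial coordinate change of the blow-up -/

section RealProfile

/-- The radial profile of the blow-up, in the coordinate `s = e^p`: it equals `-e^{-p}` for very
negative and `e^p` for positive `p`. -/
noncomputable def logProfile (p : ℝ) : ℝ :=
  Real.smoothTransition (2 * Real.exp p - 1) * Real.exp p -
    (1 - Real.smoothTransition (2 * Real.exp p - 1)) * Real.exp (-p)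

theorem contDiff_logProfile : ContDiff ℝ ∞ logProfile := by
  unfold logProfile
  have h : ContDiff ℝ ∞ fun p : ℝ => Real.smoothTransition (2 * Real.exp p - 1) :=
    Real.smoothTransition.contDiff.comp ((contDiff_const.mul Real.contDiff_exp).sub contDiff_const)
  exact (h.mul Real.contDiff_exp).sub ((contDiff_const.sub h).mul (Real.contDiff_exp.comp contDiff_neg))

theorem monotone_smoothTransition : Monotone Real.smoothTransition := Real.smoothTransition.monotone

theorem hasDerivAt_logProfile (p : ℝ) : ∃ d, 0 < d ∧ HasDerivAt logProfile d p := by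
  set y := 2 * Real.exp p - 1 with hy
  have hst : HasDerivAt Real.smoothTransition (deriv Real.smoothTransition y) y :=
    ((Real.smoothTransition.contDiff (n := 1)).differentiable (by simp) y).hasDerivAt
  have hd0 : 0 ≤ deriv Real.smoothTransition y := monotone_smoothTransition.deriv_nonneg
  have hin : HasDerivAt (fun p : ℝ => 2 * Real.exp p - 1) (2 * Real.exp p) p :=
    ((Real.hasDerivAt_exp p).const_mul 2).sub_const 1
  have hc := hst.comp p hin
  have hneg : HasDerivAt (fun p : ℝ => Real.exp (-p)) (-Real.exp (-p)) p := by
    simpa using (hasDerivAt_neg p).exp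
  refine ⟨_, ?_, (hc.mul (Real.hasDerivAt_exp p)).sub ((hc.const_sub 1).mul hneg)⟩
  have h1 := Real.smoothTransition.nonneg y
  have h2 := Real.smoothTransition.le_one y
  have e1 := Real.exp_pos p
  have e2 := Real.exp_pos (-p)
  simp only [Function.comp_apply, ← hy]
  have t1 : 0 ≤ deriv Real.smoothTransition y * (2 * Real.exp p) * Real.exp p := by positivity
  have t2 : 0 ≤ deriv Real.smoothTransition y * (2 * Real.exp p) * Real.exp (-p) := by positivity
  have t3 : 0 < Real.smoothTransition y * Real.exp p +
      (1 - Real.smoothTransition y) * Real.exp (-p) := by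
    rcases h1.eq_or_lt with h | h
    · rw [← h]; linarith
    · have := mul_pos h e1
      have := mul_nonneg (sub_nonneg.2 h2) e2.le
      linarith
  linarith

theorem strictMono_logProfile : StrictMono logProfile := by
  refine strictMono_of_deriv_pos fun p => ?_
  obtain ⟨d, hd, h⟩ := hasDerivAt_logProfile p
  rwa [h.deriv]

theorem logProfile_of_nonneg {p : ℝ} (hp : 0 ≤ p) : logProfile p = Real.exp p := by
  have h1 : Real.smoothTransition (2 * Real.exp p - 1) = 1 :=
    Real.smoothTransition.one_of_one_le (by have := Real.one_le_exp hp; linarith)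
  simp [logProfile, h1]

theorem logProfile_of_le {p : ℝ} (hp : Real.exp p ≤ 1 / 2) : logProfile p = -Real.exp (-p) := by
  have h1 : Real.smoothTransition (2 * Real.exp p - 1) = 0 :=
    Real.smoothTransition.zero_of_nonpos (by linarith)
  simp [logProfile, h1]

theorem surjective_logProfile : Function.Surjective logProfile := by
  refine contDiff_logProfile.continuous.surjective ?_ ?_
  · refine Real.tendsto_exp_atTop.congr' ?_
    filter_upwards [Filter.eventually_ge_atTop 0] with p hp
    exact (logProfile_of_nonneg hp).symm
  · refine (Filter.tendsto_neg_atTop_atBot.comp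
      (Real.tendsto_exp_atTop.comp Filter.tendsto_neg_atBot_atTop)).congr' ?_
    have : ∀ᶠ p in Filter.atBot, Real.exp p < 1 / 2 :=
      Real.tendsto_exp_atBot.eventually_lt_const (by norm_num)
    filter_upwards [this] with p hp
    exact (logProfile_of_le hp.le).symm

/-- The logarithmic coordinate turns the half-line into `ℝ`, so that a smooth homeomorphism of the
line with positive derivative has a smooth inverse. This gives smoothness of `profileInv`. -/
noncomputable def logProfileHomeo : ℝ ≃ₜ ℝ :=
  (strictMono_logProfile.orderIsoOfSurjective _ surjective_logProfile).toHomeomorph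

theorem contDiff_logProfileHomeo_symm : ContDiff ℝ ∞ logProfileHomeo.symm := by
  choose d hd hder using hasDerivAt_logProfile
  exact logProfileHomeo.contDiff_symm_deriv (f' := d) (fun p => (hd p).ne') hder contDiff_logProfile

/-- An increasing diffeomorphism from the positive half-line onto the line, equal to `s` for large
and to `-1/s` for small `s`. -/
noncomputable def profile (s : ℝ) : ℝ := logProfile (Real.log s)

/-- The inverse of `profile`. -/
noncomputable def profileInv (r : ℝ) : ℝ := Real.exp (logProfileHomeo.symm r)

theorem profileInv_pos (r : ℝ) : 0 < profileInv r := Real.exp_pos _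

theorem profile_profileInv (r : ℝ) : profile (profileInv r) = r := by
  rw [profile, profileInv, Real.log_exp]
  exact logProfileHomeo.apply_symm_apply r

theorem profileInv_profile {s : ℝ} (hs : 0 < s) : profileInv (profile s) = s := by
  have : logProfileHomeo.symm (logProfile (Real.log s)) = Real.log s :=
    logProfileHomeo.symm_apply_apply _
  rw [profile, profileInv, this, Real.exp_log hs]

theorem contDiff_profileInv : ContDiff ℝ ∞ profileInv :=
  Real.contDiff_exp.comp contDiff_logProfileHomeo_symm

theorem contDiffOn_profile : ContDiffOn ℝ ∞ profile (Ioi 0) :=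
  contDiff_logProfile.comp_contDiffOn
    (Real.contDiffOn_log.mono fun _ (hx : 0 < _) => hx.ne')

theorem profile_lt_iff {s t : ℝ} (hs : 0 < s) (ht : 0 < t) : profile s < profile t ↔ s < t := by
  rw [profile, profile, strictMono_logProfile.lt_iff_lt, Real.log_lt_log_iff hs ht]

theorem profile_of_one_le {s : ℝ} (hs : 1 ≤ s) : profile s = s := by
  rw [profile, logProfile_of_nonneg (Real.log_nonneg hs), Real.exp_log (by linarith)]

theorem profile_of_le_half {s : ℝ} (h0 : 0 < s) (hs : s ≤ 1 / 2) : profile s = -s⁻¹ := by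
  rw [profile, logProfile_of_le (by rwa [Real.exp_log h0]), Real.exp_neg, Real.exp_log h0]

theorem profile_le_self {s : ℝ} (hs : 0 < s) : profile s ≤ s := by
  rw [profile, logProfile, Real.exp_neg, Real.exp_log hs]
  have h1 := Real.smoothTransition.le_one (2 * s - 1)
  have h2 : 0 ≤ (1 - Real.smoothTransition (2 * s - 1)) * s⁻¹ :=
    mul_nonneg (sub_nonneg.2 h1) (inv_pos.2 hs).le
  nlinarith

theorem profileInv_of_one_le {r : ℝ} (hr : 1 ≤ r) : profileInv r = r := by
  have := profileInv_profile (show 0 < r by linarith)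
  rwa [profile_of_one_le hr] at this

theorem profileInv_of_le_neg_two {r : ℝ} (hr : r ≤ -2) : profileInv r = -r⁻¹ := by
  have h0 : 0 < -r⁻¹ := by rw [← inv_neg]; exact inv_pos.2 (by linarith)
  have h1 : -r⁻¹ ≤ 1 / 2 := by
    rw [← inv_neg, one_div]
    exact inv_anti₀ (by norm_num) (by linarith)
  have := profileInv_profile h0
  rwa [profile_of_le_half h0 h1, inv_neg, inv_inv, neg_neg] at this

theorem profileInv_lt_iff {r t : ℝ} : profileInv r < profileInv t ↔ r < t := by
  rw [← profile_lt_iff (profileInv_pos r) (profileInv_pos t), profile_profileInv,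
    profile_profileInv]

/-- `profileInv 0` is the radius of the holes in units of `ε`, so the holes lie strictly inside the
discs of radius `ε` that `collapse` and `inflate` modify. -/
theorem profileInv_zero_lt_one : profileInv 0 < 1 := by
  have := profileInv_lt_iff.2 (show (0 : ℝ) < 1 by norm_num)
  rwa [profileInv_of_one_le le_rfl] at this

theorem profileInv_lt_profile_iff {s : ℝ} (hs : 0 < s) : profileInv 0 < s ↔ 0 < profile s := by
  rw [← profile_lt_iff (profileInv_pos 0) hs, profile_profileInv]

theorem profileInv_le_max (r : ℝ) : profileInv r ≤ max 1 r := by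
  rcases le_total 1 r with h | h
  · rw [profileInv_of_one_le h]; exact le_max_right _ _
  · refine le_max_of_le_left ?_
    rcases h.lt_or_eq with h | h
    · have := profileInv_lt_iff.2 h
      rw [profileInv_of_one_le le_rfl] at this
      exact this.le
    · rw [h, profileInv_of_one_le le_rfl]

/-- The scaling factor of the collapsing map. -/
noncomputable def shrink (s : ℝ) : ℝ := profile s / s

/-- The scaling factor of the inverse of the collapsing map. -/
noncomputable def expand (r : ℝ) : ℝ := profileInv r / r

theorem shrink_of_one_le {s : ℝ} (hs : 1 ≤ s) : shrink s = 1 := by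
  rw [shrink, profile_of_one_le hs, div_self (by linarith)]

theorem expand_of_one_le {s : ℝ} (hs : 1 ≤ s) : expand s = 1 := by
  rw [expand, profileInv_of_one_le hs, div_self (by linarith)]

theorem contDiffOn_shrink : ContDiffOn ℝ ∞ shrink (Ioi 0) :=
  contDiffOn_profile.div contDiffOn_id fun _ hx => ne_of_gt hx

theorem contDiffOn_expand : ContDiffOn ℝ ∞ expand (Ioi 0) :=
  contDiff_profileInv.contDiffOn.div contDiffOn_id fun _ hx => ne_of_gt hx

theorem shrink_pos {s : ℝ} (hs : profileInv 0 < s) : 0 < shrink s := by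
  have h0 : 0 < s := (profileInv_pos 0).trans hs
  exact div_pos ((profileInv_lt_profile_iff h0).1 hs) h0

theorem shrink_le_one {s : ℝ} (hs : 0 < s) : shrink s ≤ 1 :=
  (div_le_one hs).2 (profile_le_self hs)

theorem expand_pos {r : ℝ} (hr : 0 < r) : 0 < expand r := div_pos (profileInv_pos r) hr

end RealProfile

/-! ### Collapsing discs around the marked points -/

section Collapse

/-- `δ` is small compared to the distances between the points of `z` and to the boundary. -/
structure IsSeparated (z : Finset ℂ) (δ : ℝ) : Prop where
  pos : 0 < δ
  le_half : δ ≤ 1 / 2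
  norm_add_lt : ∀ a ∈ z, ‖a‖ + δ < 1
  le_norm_sub : ∀ a ∈ z, ∀ b ∈ z, a ≠ b → 4 * δ ≤ ‖a - b‖

theorem exists_isSeparated {z : Finset ℂ} (hz : ∀ a ∈ z, ‖a‖ < 1) : ∃ δ, IsSeparated z δ := by
  classical
  obtain ⟨d₁, h1, h1'⟩ : ∃ d : ℝ, 0 < d ∧ ∀ a ∈ z, d ≤ 1 - ‖a‖ := by
    rcases z.eq_empty_or_nonempty with rfl | hne
    · exact ⟨1, one_pos, by simp⟩
    · obtain ⟨a, ha, hmin⟩ := z.exists_min_image (fun a => 1 - ‖a‖) hne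
      exact ⟨1 - ‖a‖, sub_pos.2 (hz a ha), hmin⟩
  obtain ⟨d₂, h2, h2'⟩ : ∃ d : ℝ, 0 < d ∧ ∀ p ∈ z.offDiag, d ≤ ‖p.1 - p.2‖ := by
    rcases z.offDiag.eq_empty_or_nonempty with h | hne
    · exact ⟨1, one_pos, by simp [h]⟩
    · obtain ⟨p, hp, hmin⟩ := z.offDiag.exists_min_image (fun p => ‖p.1 - p.2‖) hne
      exact ⟨‖p.1 - p.2‖, norm_pos_iff.2 (sub_ne_zero.2 (Finset.mem_offDiag.1 hp).2.2), hmin⟩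
  refine ⟨min (1 / 2) (min (d₁ / 2) (d₂ / 4)), by positivity, min_le_left _ _, fun a ha => ?_,
    fun a ha b hb hab => ?_⟩
  · have := (min_le_right (1 / 2) _).trans (min_le_left (d₁ / 2) (d₂ / 4))
    have := h1' a ha
    linarith
  · have := (min_le_right (1 / 2) _).trans (min_le_right (d₁ / 2) (d₂ / 4))
    have := h2' (a, b) (Finset.mem_offDiag.2 ⟨ha, hb, hab⟩)
    linarith

variable {z : Finset ℂ} {δ ε : ℝ} {a b x : ℂ}

/-- Rescale the plane radially near the points of `z`. -/
noncomputable def radialMap (z : Finset ℂ) (φ : ℝ → ℝ) (ε : ℝ) (x : ℂ) : ℂ :=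
  x + ∑ a ∈ z, (φ (‖x - a‖ / ε) - 1) • (x - a)

theorem radialMap_of_le {φ : ℝ → ℝ} (hφ : ∀ r, 1 ≤ r → φ r = 1) (hε : 0 < ε)
    (hx : ∀ a ∈ z, ε ≤ ‖x - a‖) : radialMap z φ ε x = x := by
  rw [radialMap, Finset.sum_eq_zero, add_zero]
  intro a ha
  rw [hφ _ ((one_le_div hε).2 (hx a ha)), sub_self, zero_smul]

/-- The separation `4δ` leaves `2δ` to every other marked point. Hence within `2δ` of `a` only the
summand of `a` in `radialMap` is nontrivial. -/
theorem IsSeparated.le_norm_sub' (hδ : IsSeparated z δ) (ha : a ∈ z) (hb : b ∈ z) (hab : b ≠ a)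
    (hx : ‖x - a‖ ≤ 2 * δ) : 2 * δ ≤ ‖x - b‖ := by
  have h1 := hδ.le_norm_sub b hb a ha hab
  have h2 := norm_sub_le (x - a) (x - b)
  rw [sub_sub_sub_cancel_left] at h2
  linarith

theorem radialMap_of_near {φ : ℝ → ℝ} (hφ : ∀ r, 1 ≤ r → φ r = 1) (hδ : IsSeparated z δ)
    (hε : 0 < ε) (hεδ : ε ≤ δ) (ha : a ∈ z) (hx : ‖x - a‖ ≤ 2 * δ) :
    radialMap z φ ε x = a + φ (‖x - a‖ / ε) • (x - a) := by
  have hδ0 := hδ.pos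
  rw [radialMap, Finset.sum_eq_single_of_mem a ha]
  · rw [sub_smul, one_smul]; ring
  · intro b hb hba
    rw [hφ _ ((one_le_div hε).2 ?_), sub_self, zero_smul]
    have := hδ.le_norm_sub' ha hb hba hx
    linarith

/-- The map collapsing the discs of radius `profileInv 0 * ε` around the points of `z`. -/
noncomputable def collapse (z : Finset ℂ) : ℝ → ℂ → ℂ := radialMap z shrink

/-- The inverse of the collapsing map. -/
noncomputable def inflate (z : Finset ℂ) : ℝ → ℂ → ℂ := radialMap z expand

/-- The points outside of the closed discs that are collapsed. -/
def outside (z : Finset ℂ) (ε : ℝ) : Set ℂ := {x | ∀ a ∈ z, profileInv 0 * ε < ‖x - a‖}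

theorem near_or_far (z : Finset ℂ) (ε : ℝ) (x : ℂ) :
    (∃ a ∈ z, ‖x - a‖ < ε) ∨ ∀ a ∈ z, ε ≤ ‖x - a‖ := by
  by_cases h : ∃ a ∈ z, ‖x - a‖ < ε
  · exact Or.inl h
  · push Not at h
    exact Or.inr h

theorem collapse_of_far (hε : 0 < ε) (hx : ∀ a ∈ z, ε ≤ ‖x - a‖) : collapse z ε x = x :=
  radialMap_of_le (fun _ => shrink_of_one_le) hε hx

theorem inflate_of_far (hε : 0 < ε) (hx : ∀ a ∈ z, ε ≤ ‖x - a‖) : inflate z ε x = x :=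
  radialMap_of_le (fun _ => expand_of_one_le) hε hx

theorem notMem_of_outside (hε : 0 < ε) (hx : x ∈ outside z ε) : x ∉ z := fun h => by
  have h1 := hx x h
  rw [sub_self, norm_zero] at h1
  have := mul_pos (profileInv_pos 0) hε
  linarith

theorem mem_outside_of_near (hδ : IsSeparated z δ) (ha : a ∈ z) (hx : ‖x - a‖ ≤ 2 * δ) :
    x ∈ outside z ε ↔ profileInv 0 * ε < ‖x - a‖ := by
  refine ⟨fun h => h a ha, fun h b hb => ?_⟩
  have hδ0 := hδ.pos
  by_cases hba : b = a
  · rwa [hba]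
  · have := hδ.le_norm_sub' ha hb hba hx
    have h1 := profileInv_zero_lt_one
    nlinarith

variable (hδ : IsSeparated z δ) (hε : 0 < ε) (hεδ : ε ≤ δ)

include hδ hε hεδ

theorem collapse_of_near (ha : a ∈ z) (hx : ‖x - a‖ ≤ 2 * δ) :
    collapse z ε x = a + shrink (‖x - a‖ / ε) • (x - a) :=
  radialMap_of_near (fun _ => shrink_of_one_le) hδ hε hεδ ha hx

theorem inflate_of_near (ha : a ∈ z) (hx : ‖x - a‖ ≤ 2 * δ) :
    inflate z ε x = a + expand (‖x - a‖ / ε) • (x - a) :=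
  radialMap_of_near (fun _ => expand_of_one_le) hδ hε hεδ ha hx

/-- Along each ray from `a` the two maps are multiplication by `profile s / s` and `profileInv r /
r`, so in the radial coordinate they are the inverse functions `profile` and `profileInv`. -/
theorem inflate_collapse (hx : x ∈ outside z ε) :
    collapse z ε x ∉ z ∧ inflate z ε (collapse z ε x) = x := by
  have hδ0 := hδ.pos
  rcases near_or_far z ε x with ⟨a, ha, hxa⟩ | hfar
  · have h1 : ‖x - a‖ ≤ 2 * δ := by linarith
    have h2 := hx a ha
    set s := ‖x - a‖ / ε with hs
    have hs0 : profileInv 0 < s := (lt_div_iff₀ hε).2 h2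
    have hspos : 0 < s := (profileInv_pos 0).trans hs0
    have hsh := shrink_pos hs0
    have hc := collapse_of_near hδ hε hεδ ha h1
    have hnorm : ‖collapse z ε x - a‖ = ε * profile s := by
      rw [hc, add_sub_cancel_left, norm_smul, Real.norm_of_nonneg hsh.le, shrink]
      rw [show ‖x - a‖ = s * ε by rw [hs]; field_simp]
      field_simp
    have hle : ‖collapse z ε x - a‖ ≤ 2 * δ := by
      rw [hnorm]
      have := profile_le_self hspos
      have : ε * profile s ≤ ε * s := by gcongr
      have h4 : ε * s = ‖x - a‖ := by rw [hs]; field_simp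
      linarith
    have hpp := (profileInv_lt_profile_iff hspos).1 hs0
    refine ⟨fun hmem => ?_, ?_⟩
    · by_cases hca : collapse z ε x = a
      · rw [hca, sub_self, norm_zero] at hnorm
        have := mul_pos hε hpp
        linarith
      · have := hδ.le_norm_sub' ha hmem hca hle
        rw [sub_self, norm_zero] at this
        linarith
    · rw [inflate_of_near hδ hε hεδ ha hle, hnorm, hc, add_sub_cancel_left, ← hs, smul_smul,
        mul_div_cancel_left₀ _ hε.ne', expand, shrink, profileInv_profile hspos]
      rw [div_mul_div_cancel₀ hpp.ne', div_self hspos.ne', one_smul, add_sub_cancel]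
  · rw [collapse_of_far hε hfar]
    exact ⟨notMem_of_outside hε hx, inflate_of_far hε hfar⟩

theorem collapse_inflate (hx : x ∉ z) :
    inflate z ε x ∈ outside z ε ∧ collapse z ε (inflate z ε x) = x := by
  have hδ0 := hδ.pos
  rcases near_or_far z ε x with ⟨a, ha, hxa⟩ | hfar
  · have h1 : ‖x - a‖ ≤ 2 * δ := by linarith
    have hpos : 0 < ‖x - a‖ := norm_pos_iff.2 (sub_ne_zero.2 fun h => hx (h ▸ ha))
    set r := ‖x - a‖ / ε with hr
    have hrpos : 0 < r := div_pos hpos hε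
    have hc := inflate_of_near hδ hε hεδ ha h1
    have hnorm : ‖inflate z ε x - a‖ = ε * profileInv r := by
      rw [hc, add_sub_cancel_left, norm_smul, Real.norm_of_nonneg (expand_pos hrpos).le,
        expand, show ‖x - a‖ = r * ε by rw [hr]; field_simp]
      field_simp
    have hle : ‖inflate z ε x - a‖ ≤ 2 * δ := by
      rw [hnorm]
      have h3 := profileInv_le_max r
      rw [max_eq_left ((div_le_one hε).2 hxa.le)] at h3
      nlinarith
    refine ⟨(mem_outside_of_near hδ ha hle).2 ?_, ?_⟩
    · rw [hnorm, mul_comm]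
      exact mul_lt_mul_of_pos_left (profileInv_lt_iff.2 hrpos) hε
    · rw [collapse_of_near hδ hε hεδ ha hle, hnorm, hc, add_sub_cancel_left, ← hr, smul_smul,
        mul_div_cancel_left₀ _ hε.ne', expand, shrink, profile_profileInv,
        div_mul_div_cancel₀ (profileInv_pos r).ne', div_self hrpos.ne', one_smul, add_sub_cancel]
  · rw [inflate_of_far hε hfar]
    refine ⟨fun a ha => ?_, collapse_of_far hε hfar⟩
    have := hfar a ha
    have := profileInv_zero_lt_one
    nlinarith

/-- The scaling factor lies in `(0, 1]` and differs from `1` only within `ε` of `a`. Uniform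
closeness is what makes the isotopy continuous when the holes shrink to points. -/
theorem norm_collapse_sub_le (hx : x ∈ outside z ε) : ‖collapse z ε x - x‖ ≤ ε := by
  have hδ0 := hδ.pos
  rcases near_or_far z ε x with ⟨a, ha, hxa⟩ | hfar
  · have h2 := hx a ha
    have hs0 : profileInv 0 < ‖x - a‖ / ε := (lt_div_iff₀ hε).2 h2
    have h3 := shrink_pos hs0
    have h4 := shrink_le_one ((profileInv_pos 0).trans hs0)
    rw [collapse_of_near hδ hε hεδ ha (by linarith)]
    have : a + shrink (‖x - a‖ / ε) • (x - a) - x = (shrink (‖x - a‖ / ε) - 1) • (x - a) := by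
      rw [sub_smul, one_smul]; ring
    rw [this, norm_smul, Real.norm_of_nonpos (by linarith)]
    have h5 := norm_nonneg (x - a)
    nlinarith
  · rw [collapse_of_far hε hfar, sub_self, norm_zero]
    exact hε.le

theorem norm_inflate_sub_le (hx : x ∉ z) : ‖inflate z ε x - x‖ ≤ ε := by
  obtain ⟨h1, h2⟩ := collapse_inflate hδ hε hεδ hx
  have := norm_collapse_sub_le hδ hε hεδ h1
  rwa [h2, norm_sub_rev] at this

end Collapse

variable {z : Finset ℂ} {δ ε : ℝ} {a b x : ℂ}

/-! ### Smooth families built from collapsing and lifting -/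

section Families

variable {Λ : Type} [TopologicalSpace Λ] {E : Type} [NormedAddCommGroup E] [NormedSpace ℝ E]
  {S : Set (Λ × E)}

theorem SmoothFamilyOn.radialMap {φ : ℝ → ℝ} (hφ : ContDiffOn ℝ ∞ φ (Ioi 0)) {ε : Λ → ℝ}
    (hε : Continuous ε) (hε0 : ∀ l, 0 < ε l) {f : Λ → E → ℂ} (hf : SmoothFamilyOn f S)
    (hz : ∀ p ∈ S, f p.1 p.2 ∉ z) :
    SmoothFamilyOn (fun l x => radialMap z φ (ε l) (f l x)) S := by
  unfold BranchedLift.radialMap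
  refine hf.add (SmoothFamilyOn.finset_sum z fun a ha => ?_)
  have hne : ∀ p ∈ S, f p.1 p.2 - a ≠ 0 := fun p hp h => hz p hp (by rwa [sub_eq_zero.1 h])
  have h1 := hf.sub (const' a)
  refine SmoothFamilyOn.smul (SmoothFamilyOn.sub ?_ (const' 1)) h1
  refine contDiffOn_comp hφ isOpen_Ioi ((h1.norm hne).rdiv
    (const (hε.comp continuous_fst).continuousOn) fun p _ => (hε0 p.1).ne') fun p hp => ?_
  exact div_pos (norm_pos_iff.2 (hne p hp)) (hε0 p.1)

theorem SmoothFamilyOn.collapse {ε : Λ → ℝ}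
    (hε : Continuous ε) (hε0 : ∀ l, 0 < ε l) {f : Λ → E → ℂ} (hf : SmoothFamilyOn f S)
    (hz : ∀ p ∈ S, f p.1 p.2 ∉ z) :
    SmoothFamilyOn (fun l x => BranchedLift.collapse z (ε l) (f l x)) S :=
  SmoothFamilyOn.radialMap contDiffOn_shrink hε hε0 hf hz

theorem SmoothFamilyOn.inflate {ε : Λ → ℝ}
    (hε : Continuous ε) (hε0 : ∀ l, 0 < ε l) {f : Λ → E → ℂ} (hf : SmoothFamilyOn f S)
    (hz : ∀ p ∈ S, f p.1 p.2 ∉ z) :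
    SmoothFamilyOn (fun l x => BranchedLift.inflate z (ε l) (f l x)) S :=
  SmoothFamilyOn.radialMap contDiffOn_expand hε hε0 hf hz

theorem SmoothFamilyOn.fst {F G : Type} [NormedAddCommGroup F] [NormedSpace ℝ F]
    [NormedAddCommGroup G] [NormedSpace ℝ G] {f : Λ → E → F × G} (hf : SmoothFamilyOn f S) :
    SmoothFamilyOn (fun l x => (f l x).1) S := hf.clm (ContinuousLinearMap.fst ℝ F G)

theorem SmoothFamilyOn.snd {F G : Type} [NormedAddCommGroup F] [NormedSpace ℝ F]
    [NormedAddCommGroup G] [NormedSpace ℝ G] {f : Λ → E → F × G} (hf : SmoothFamilyOn f S) :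
    SmoothFamilyOn (fun l x => (f l x).2) S := hf.clm (ContinuousLinearMap.snd ℝ F G)

theorem SmoothFamilyOn.continuous {f : Λ → E → ℂ} (hf : SmoothFamilyOn f univ) :
    Continuous fun p : Λ × E => f p.1 p.2 := by
  rw [← continuousOn_univ]
  exact hf.continuousOn

/-- Away from `a` the difference quotient is a nonvanishing smooth family, and a continuous root of
such a family is smooth (`SmoothFamilyOn.of_sq`). -/
theorem smoothFamilyOn_quotRoot {h : Λ → ℂ ≃ₜ ℂ} (hh : ∀ l, h l ∈ planeHomeo z)
    (hs : SmoothFamilyOn (fun l x => h l x) univ) (ha : ‖a‖ < 1) :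
    SmoothFamilyOn (fun l x => quotRoot (h l) a x) {p | p.2 ≠ a} := by
  have hc := hs.continuous
  have hva : Continuous fun p : Λ × ℂ => h p.1 a :=
    hc.comp (by fun_prop : Continuous fun p : Λ × ℂ => (p.1, a))
  refine SmoothFamilyOn.of_sq (f := fun l x => dquot (h l) a x)
    (isOpen_ne.preimage continuous_snd) ?_ (continuousOn_quotRoot_family hh hc ha)
    (fun p hp => quotRoot_sq (hh p.1) ha hp) fun p hp => dquot_ne_zero hp
  exact ((hs.mono (subset_univ _)).sub (.const hva.continuousOn)).div
    (SmoothFamilyOn.id.sub (.const' a)) fun p hp => sub_ne_zero.2 hp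

theorem SmoothFamilyOn.curveLift (hz1 : ∀ a ∈ z, ‖a‖ < 1) {h : Λ → ℂ ≃ₜ ℂ}
    (hh : ∀ l, h l ∈ planeHomeo z)
    (hs : SmoothFamilyOn (fun l x => h l x) univ) {f : Λ → E → ℂ × ℂ}
    (hf : SmoothFamilyOn f S) (hz : ∀ p ∈ S, (f p.1 p.2).1 ∉ z) :
    SmoothFamilyOn (fun l x => BranchedLift.curveLift z (h l) (f l x)) S :=
  (hs.comp hf.fst fun _ _ => mem_univ _).prodMk (hf.snd.mul (SmoothFamilyOn.finset_prod z
    fun a ha => (smoothFamilyOn_quotRoot hh hs (hz1 a ha)).comp hf.fst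
      fun p hp (h0 : (f p.1 p.2).1 = a) => hz p hp (by rwa [h0])))

end Families

/-! ### Hadamard's formula in the plane -/

section MeanDeriv

/-- The average of the derivative of `h` on the segment from `a` to `x`. -/
noncomputable def meanDeriv (h : ℂ → ℂ) (a x : ℂ) : ℂ →L[ℝ] ℂ :=
  ∫ t : I, fderiv ℝ h (a + (t : ℝ) • (x - a))

theorem meanDeriv_apply {h : ℂ → ℂ} (hh : ContDiff ℝ ∞ h) (a x : ℂ) :
    meanDeriv h a x (x - a) = h x - h a :=
  integral_segment_deriv (f := h) (f' := fderiv ℝ h) convex_univ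
    (fun y _ => ((hh.differentiable (by simp)) y).hasFDerivAt.hasFDerivWithinAt)
    (hh.continuous_fderiv (by simp)).continuousOn (mem_univ a) (mem_univ x)

theorem meanDeriv_self (h : ℂ → ℂ) (a : ℂ) : meanDeriv h a a = fderiv ℝ h a := by
  simp [meanDeriv]

variable {Λ : Type} [TopologicalSpace Λ] {E F : Type} [NormedAddCommGroup E] [NormedSpace ℝ E]
  [NormedAddCommGroup F] [NormedSpace ℝ F]

theorem SmoothFamilyOn.fderiv {f : Λ → E → F} (hf : SmoothFamilyOn f univ) :
    SmoothFamilyOn (fun l x => fderiv ℝ (f l) x) univ := by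
  intro k
  obtain ⟨-, f', hd, h'⟩ := hf (k + 1)
  refine h'.congr fun p _ => ?_
  have := hd p (mem_univ _)
  simp only [mem_univ, ofPred_true, hasFDerivWithinAt_univ] at this
  exact this.fderiv

theorem SmoothFamilyOn.meanDeriv {h : Λ → ℂ → ℂ} (hh : SmoothFamilyOn h univ) (a : ℂ) :
    SmoothFamilyOn (fun l x => BranchedLift.meanDeriv (h l) a x) univ := by
  intro k
  have h1 : SmoothFamilyOn (fun (p : Λ × I) x => _root_.fderiv ℝ (h p.1) (a + (p.2 : ℝ) • (x - a)))
      (univ ×ˢ univ) := by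
    refine SmoothFamilyOn.comp (T := univ) (SmoothFamilyOn.reparam (φ := Prod.fst) continuous_fst
        (S' := univ) hh.fderiv fun _ _ => mem_univ _)
      ((SmoothFamilyOn.const' a).add (SmoothFamilyOn.smul (.const ?_) (.sub .id (.const' a))))
      fun _ _ => mem_univ _
    fun_prop
  have := ParamContDiffOn.integral convex_univ (h1 k)
  rwa [univ_prod_univ] at this

end MeanDeriv

/-! ### The action on one blown-up point -/

section BlowMap

/-- The local factor of the collapsing map at `a`. -/
noncomputable def collapseAt (a : ℂ) (ε : ℝ) (x : ℂ) : ℂ := a + shrink (‖x - a‖ / ε) • (x - a)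

/-- The image under `h` of the direction of `x` at `a`, after collapsing. -/
noncomputable def direction (h : ℂ → ℂ) (a : ℂ) (ε : ℝ) (x : ℂ) : ℂ :=
  meanDeriv h a (collapseAt a ε x) (x - a)

/-- The map induced by `h` on the neighbourhood of `a` in which `a` is blown up and the hole is
filled with an inside-out copy of the plane. -/
noncomputable def blowMap (h : ℂ → ℂ) (a : ℂ) (ε : ℝ) (x : ℂ) : ℂ :=
  h a + (ε * profileInv (profile (‖x - a‖ / ε) * (‖direction h a ε x‖ / ‖x - a‖)) /
    ‖direction h a ε x‖) • direction h a ε x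

variable {h g : ℂ ≃ₜ ℂ} {a x : ℂ} {ε : ℝ}

/-- Hadamard's formula with the scalar `shrink` taken out. The scalar vanishes on the rim of the
hole, but `direction` still makes sense there; this is what carries the map across the rim. -/
theorem shrink_smul_direction (hh : ContDiff ℝ ∞ h) :
    shrink (‖x - a‖ / ε) • direction h a ε x = h (collapseAt a ε x) - h a := by
  rw [direction, ← map_smul, ← meanDeriv_apply hh a (collapseAt a ε x)]
  simp [collapseAt]

/-- The diffeomorphisms of the plane that fix every point outside the open unit disc and preserve
the set `z`. -/
def planeDiffeo (z : Finset ℂ) : Subgroup (ℂ ≃ₜ ℂ) where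
  carrier := {h | h ∈ planeHomeo z ∧ ContDiff ℝ ∞ h ∧ ContDiff ℝ ∞ (h⁻¹ : ℂ ≃ₜ ℂ)}
  one_mem' := ⟨one_mem _, contDiff_id, contDiff_id⟩
  mul_mem' := by
    rintro f g ⟨h1, hf, hf'⟩ ⟨h2, hg, hg'⟩
    refine ⟨mul_mem h1 h2, hf.comp hg, ?_⟩
    rw [mul_inv_rev]
    exact hg'.comp hf'
  inv_mem' := by
    rintro f ⟨h1, hf, hf'⟩
    exact ⟨inv_mem h1, hf', by rwa [inv_inv]⟩

variable {z : Finset ℂ}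

theorem fderiv_injective (hh : h ∈ planeDiffeo z) (x : ℂ) : Function.Injective (fderiv ℝ h x) := by
  have h1 : HasFDerivAt h (fderiv ℝ h x) x := (hh.2.1.differentiable (by simp) x).hasFDerivAt
  have h2 := (hh.2.2.differentiable (by simp) (h x)).hasFDerivAt
  have h3 := h2.comp x h1
  have h4 : ((h⁻¹ : ℂ ≃ₜ ℂ) ∘ h) = id := funext fun y => h.symm_apply_apply y
  rw [h4] at h3
  have h5 := h3.unique (hasFDerivAt_id x)
  exact Function.LeftInverse.injective (g := fderiv ℝ (h⁻¹ : ℂ ≃ₜ ℂ) (h x)) fun v =>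
    DFunLike.congr_fun h5 v

/-- If it vanished, injectivity of `h` would put the collapsed point at `a`. There the mean
derivative is the derivative of `h` at `a`, which is injective. -/
theorem direction_ne_zero (hh : h ∈ planeDiffeo z) (hx : x ≠ a) : direction h a ε x ≠ 0 := by
  have hxa : x - a ≠ 0 := sub_ne_zero.2 hx
  intro h0
  have h1 := shrink_smul_direction (a := a) (x := x) (ε := ε) hh.2.1
  rw [h0, smul_zero] at h1
  have h2 : collapseAt a ε x = a := h.injective (sub_eq_zero.1 h1.symm)
  rw [direction, h2, meanDeriv_self] at h0
  exact hxa (fderiv_injective hh a (h0.trans (map_zero _).symm))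

/-- Off the rim this is the increment of a composite divided by the common scalar `shrink`; on the
rim it is the chain rule at `a`. -/
theorem direction_mul (hg : g ∈ planeDiffeo z) (hh : h ∈ planeDiffeo z) (hx : x ≠ a) :
    direction (g * h : ℂ ≃ₜ ℂ) a ε x =
      meanDeriv g (h a) (h (collapseAt a ε x)) (direction h a ε x) := by
  have hxa : x - a ≠ 0 := sub_ne_zero.2 hx
  by_cases hk : shrink (‖x - a‖ / ε) = 0
  · have h2 : collapseAt a ε x = a := by rw [collapseAt, hk, zero_smul, add_zero]
    rw [direction, direction, h2, meanDeriv_self, meanDeriv_self, meanDeriv_self]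
    have := fderiv_comp (𝕜 := ℝ) a (hg.2.1.differentiable (by simp) (h a))
      (hh.2.1.differentiable (by simp) a)
    exact DFunLike.congr_fun this (x - a)
  · have h1 := shrink_smul_direction (a := a) (x := x) (ε := ε) (mul_mem hg hh).2.1
    refine smul_right_injective _ hk ?_
    simp only
    rw [h1, ← map_smul, shrink_smul_direction hh.2.1, meanDeriv_apply hg.2.1]
    rfl

theorem blowMap_self (h : ℂ → ℂ) (a : ℂ) (ε : ℝ) : blowMap h a ε a = h a := by
  simp [blowMap, direction]

theorem norm_blowMap_sub (hh : h ∈ planeDiffeo z) (hε : 0 < ε) (hx : x ≠ a) :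
    ‖blowMap h a ε x - h a‖ =
      ε * profileInv (profile (‖x - a‖ / ε) * (‖direction h a ε x‖ / ‖x - a‖)) := by
  have h1 := norm_pos_iff.2 (direction_ne_zero (ε := ε) hh hx)
  rw [blowMap, add_sub_cancel_left, norm_smul, Real.norm_of_nonneg, div_mul_cancel₀ _ h1.ne']
  exact div_nonneg (mul_nonneg hε.le (profileInv_pos _).le) h1.le

theorem blowMap_ne (hh : h ∈ planeDiffeo z) (hε : 0 < ε) (hx : x ≠ a) :
    blowMap h a ε x ≠ h a := fun h0 => by
  have := norm_blowMap_sub hh hε hx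
  rw [h0, sub_self, norm_zero] at this
  exact (mul_pos hε (profileInv_pos _)).ne this

theorem profile_blowMap (hh : h ∈ planeDiffeo z) (hε : 0 < ε) (hx : x ≠ a) :
    profile (‖blowMap h a ε x - h a‖ / ε) =
      profile (‖x - a‖ / ε) * (‖direction h a ε x‖ / ‖x - a‖) := by
  rw [norm_blowMap_sub hh hε hx, mul_div_cancel_left₀ _ hε.ne', profile_profileInv]

/-- `collapseAt` is `(r, u) ↦ a + r u` for `r` of either sign, and the blow-up was designed so that
it intertwines `blowMap` with `h`. -/
theorem collapseAt_blowMap (hh : h ∈ planeDiffeo z) (hε : 0 < ε) (hx : x ≠ a) :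
    collapseAt (h a) ε (blowMap h a ε x) = h (collapseAt a ε x) := by
  have h1 := (norm_pos_iff.2 (direction_ne_zero (ε := ε) hh hx)).ne'
  have h2 := (norm_pos_iff.2 (sub_ne_zero.2 hx)).ne'
  have h3 := (norm_pos_iff.2 (sub_ne_zero.2 (blowMap_ne hh hε hx))).ne'
  have h4 := (profileInv_pos (profile (‖x - a‖ / ε) * (‖direction h a ε x‖ / ‖x - a‖))).ne'
  rw [collapseAt, shrink, profile_blowMap hh hε hx, norm_blowMap_sub hh hε hx, blowMap,
    add_sub_cancel_left, smul_smul, ← eq_sub_iff_add_eq', ← shrink_smul_direction hh.2.1, shrink]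
  congr 1
  generalize profileInv _ = Q at h4 ⊢
  field_simp

/-- The displacement `blowMap h a ε x - h a` is a positive multiple `c` of `direction h a ε x`. By
linearity of the mean derivative `c` enters the next direction as a factor, and it cancels in all
the quotients. -/
theorem blowMap_mul (hg : g ∈ planeDiffeo z) (hh : h ∈ planeDiffeo z) (hε : 0 < ε) :
    blowMap (g * h : ℂ ≃ₜ ℂ) a ε x = blowMap g (h a) ε (blowMap h a ε x) := by
  by_cases hx : x = a
  · subst hx
    rw [blowMap_self, blowMap_self, blowMap_self]
    rfl
  have h1 := norm_pos_iff.2 (direction_ne_zero (ε := ε) hh hx)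
  have h2 := (norm_pos_iff.2 (sub_ne_zero.2 hx)).ne'
  have hp := profileInv_pos (profile (‖x - a‖ / ε) * (‖direction h a ε x‖ / ‖x - a‖))
  obtain ⟨c, hc, hM⟩ : ∃ c : ℝ, 0 < c ∧ blowMap h a ε x - h a = c • direction h a ε x :=
    ⟨_, div_pos (mul_pos hε hp) h1, by rw [blowMap, add_sub_cancel_left]⟩
  have h5 : direction g (h a) ε (blowMap h a ε x) = c • direction (g * h : ℂ ≃ₜ ℂ) a ε x := by
    rw [direction, collapseAt_blowMap hh hε hx, hM, map_smul, direction_mul hg hh hx]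
  have h6 : ‖direction g (h a) ε (blowMap h a ε x)‖ / ‖blowMap h a ε x - h a‖ =
      ‖direction (g * h : ℂ ≃ₜ ℂ) a ε x‖ / ‖direction h a ε x‖ := by
    rw [h5, hM, norm_smul, norm_smul, mul_div_mul_left _ _ (norm_pos_iff.2 hc.ne').ne']
  have h7 := (norm_pos_iff.2 (direction_ne_zero (ε := ε) (mul_mem hg hh) hx)).ne'
  rw [blowMap, blowMap.eq_1 g, profile_blowMap hh hε hx, h6, h5, norm_smul, smul_smul,
    Real.norm_of_nonneg hc.le, mul_assoc, div_mul_div_cancel₀' h1.ne']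
  refine congrArg₂ (· + ·) rfl (congrArg (· • _) ?_)
  generalize profileInv _ = Q
  field_simp

theorem direction_one (a x : ℂ) : direction (1 : ℂ ≃ₜ ℂ) a ε x = x - a := by
  have : fderiv ℝ ((1 : ℂ ≃ₜ ℂ) : ℂ → ℂ) = fun _ => ContinuousLinearMap.id ℝ ℂ := by
    funext y
    exact fderiv_id
  rw [direction, meanDeriv, this]
  simp

theorem blowMap_one (hε : 0 < ε) : blowMap (1 : ℂ ≃ₜ ℂ) a ε x = x := by
  by_cases hx : x = a
  · subst hx
    rw [blowMap_self]
    rfl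
  have h2 := norm_pos_iff.2 (sub_ne_zero.2 hx)
  rw [blowMap, direction_one, div_self h2.ne', mul_one, profileInv_profile (by positivity),
    mul_div_cancel₀ _ hε.ne', div_self h2.ne', one_smul]
  exact add_sub_cancel _ _

/-- Near `a` the blown up map is a Möbius transformation. -/
theorem blowMap_of_near (hh : h ∈ planeDiffeo z) (ha : ‖a‖ < 1) (hε : 0 < ε) (hε1 : ε ≤ 1 / 2)
    (hx : ‖x - a‖ ≤ ε ^ 2 / 8) :
    1 / 2 ≤ ‖1 - starRingEnd ℂ (a - h a) * (x - a) / ε ^ 2‖ ∧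
    blowMap h a ε x = h a + (x - a) / (1 - starRingEnd ℂ (a - h a) * (x - a) / ε ^ 2) := by
  have hha := norm_lt_of_mem hh.1 ha
  set e := 1 - starRingEnd ℂ (a - h a) * (x - a) / ε ^ 2 with he
  have hεc : (ε : ℂ) ≠ 0 := Complex.ofReal_ne_zero.2 hε.ne'
  have hsmall : ‖starRingEnd ℂ (a - h a) * (x - a) / ε ^ 2‖ ≤ 1 / 2 := by
    rw [norm_div, norm_mul, norm_pow, Complex.norm_real, Real.norm_of_nonneg hε.le,
      RCLike.norm_conj, div_le_iff₀ (by positivity)]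
    have h1 : ‖a - h a‖ ≤ 2 := (norm_sub_le _ _).trans (by linarith)
    calc ‖a - h a‖ * ‖x - a‖ ≤ 2 * (ε ^ 2 / 8) := by gcongr
      _ ≤ 1 / 2 * ε ^ 2 := by nlinarith [sq_nonneg ε]
  have hehalf : 1 / 2 ≤ ‖e‖ := by
    have h1 := norm_sub_norm_le (1 : ℂ) (starRingEnd ℂ (a - h a) * (x - a) / ε ^ 2)
    rw [norm_one] at h1
    linarith
  refine ⟨hehalf, ?_⟩
  by_cases hxa : x = a
  · rw [hxa, blowMap_self, sub_self, zero_div, add_zero]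
  have h0 : x - a ≠ 0 := sub_ne_zero.2 hxa
  have hy := norm_pos_iff.2 h0
  set y := x - a with hydef
  have hs0 : 0 < ‖y‖ / ε := div_pos hy hε
  have hs : ‖y‖ / ε ≤ 1 / 2 := by rw [div_le_iff₀ hε]; nlinarith
  have hpr : profile (‖y‖ / ε) = -(ε / ‖y‖) := by rw [profile_of_le_half hs0 hs, inv_div]
  have hk : shrink (‖y‖ / ε) = -(ε ^ 2 / ‖y‖ ^ 2) := by
    rw [shrink, hpr]; field_simp
  have hcol : h (collapseAt a ε x) = collapseAt a ε x := by
    refine hh.1.1 _ ?_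
    have h1 : ‖shrink (‖y‖ / ε) • y‖ = ε ^ 2 / ‖y‖ := by
      rw [norm_smul, hk, norm_neg, Real.norm_of_nonneg (by positivity)]
      field_simp
    have h2 : 2 ≤ ε ^ 2 / ‖y‖ := by rw [le_div_iff₀ hy]; linarith [sq_nonneg ε]
    have h3 := norm_sub_norm_le (shrink (‖y‖ / ε) • y) (-a)
    rw [sub_neg_eq_add, norm_neg, h1, add_comm _ a] at h3
    rw [collapseAt, ← hydef]
    linarith
  have hyy : ((‖y‖ : ℝ) : ℂ) ^ 2 = starRingEnd ℂ y * y := by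
    rw [← Complex.normSq_eq_conj_mul_self, Complex.normSq_eq_norm_sq]; push_cast; rfl
  have hcy : starRingEnd ℂ y ≠ 0 := by simpa using h0
  -- With `k = -ε²/‖y‖²`, Hadamard's formula reads `k • direction = (a - h a) + k • y`. Dividing by
  -- `k` and writing `‖y‖² = ȳ y` gives `y - (a - h a) ȳ y / ε²`.
  have hdir : direction h a ε x = starRingEnd ℂ e * y := by
    have h1 := shrink_smul_direction (a := a) (x := x) (ε := ε) hh.2.1
    have hk0 : shrink (‖y‖ / ε) ≠ 0 := by
      rw [hk, neg_ne_zero]; positivity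
    refine smul_right_injective _ hk0 ?_
    simp only
    rw [← hydef] at h1
    rw [h1, hcol, collapseAt, ← hydef, hk, he]
    simp only [Complex.real_smul, map_sub, map_one, map_div₀, map_mul, map_pow, Complex.conj_conj,
      Complex.conj_ofReal]
    push_cast
    rw [hyy]
    field_simp
    ring
  have he0 : e ≠ 0 := norm_pos_iff.1 (by linarith)
  have hee : ((‖e‖ : ℝ) : ℂ) ^ 2 = starRingEnd ℂ e * e := by
    rw [← Complex.normSq_eq_conj_mul_self, Complex.normSq_eq_norm_sq]; push_cast; rfl
  have hnd : ‖direction h a ε x‖ = ‖e‖ * ‖y‖ := by rw [hdir, norm_mul, RCLike.norm_conj]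
  -- The argument is `-(ε/‖y‖) ‖e‖ ≤ -4 · (1/2)`, so the branch `-1/r` of `profileInv` applies.
  have hQ : profileInv (profile (‖y‖ / ε) * (‖direction h a ε x‖ / ‖y‖)) = ‖y‖ / (ε * ‖e‖) := by
    rw [hnd, hpr, mul_div_cancel_right₀ _ hy.ne', profileInv_of_le_neg_two]
    · field_simp
    · have h1 : 4 ≤ ε / ‖y‖ := by rw [le_div_iff₀ hy]; nlinarith
      nlinarith
  have hen : ((‖e‖ : ℝ) : ℂ) ≠ 0 := Complex.ofReal_ne_zero.2 (norm_pos_iff.2 he0).ne'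
  have hyn : ((‖y‖ : ℝ) : ℂ) ≠ 0 := Complex.ofReal_ne_zero.2 hy.ne'
  rw [blowMap, ← hydef, hQ, hnd, hdir, Complex.real_smul]
  congr 1
  push_cast
  rw [eq_div_iff he0, show ∀ c : ℂ, c * (starRingEnd ℂ e * y) * e = c * y * (starRingEnd ℂ e * e)
    from fun c => by ring, ← hee]
  field_simp

end BlowMap

/-! ### The global blown-up map -/

section Blow

variable {z : Finset ℂ} {h g : ℂ ≃ₜ ℂ} {a x : ℂ} {δ ε : ℝ}

open Classical in
/-- The homeomorphism induced by `h` on the plane in which the points of `z` are blown up and the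
holes are filled with inside-out copies of the plane. -/
noncomputable def blow (z : Finset ℂ) (ε : ℝ) (h : ℂ → ℂ) (x : ℂ) : ℂ :=
  if hx : ∃ a ∈ z, ‖x - a‖ ≤ profileInv 0 * ε then blowMap h hx.choose ε x
  else inflate z ε (h (collapse z ε x))

theorem blow_of_outside {h : ℂ → ℂ} (hx : x ∈ outside z ε) :
    blow z ε h x = inflate z ε (h (collapse z ε x)) := by
  refine dif_neg fun ⟨a, ha, h1⟩ => ?_
  have := hx a ha
  linarith

theorem inside_or_outside (z : Finset ℂ) (ε : ℝ) (x : ℂ) :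
    (∃ a ∈ z, ‖x - a‖ ≤ profileInv 0 * ε) ∨ x ∈ outside z ε := by
  by_cases hx : ∃ a ∈ z, ‖x - a‖ ≤ profileInv 0 * ε
  · exact Or.inl hx
  · push Not at hx
    exact Or.inr hx

/-- The coordinate `profile` is multiplied by a nonnegative factor, so a point with nonpositive
coordinate keeps one: holes go to holes. -/
theorem norm_blowMap_sub_le (hh : h ∈ planeDiffeo z) (hε : 0 < ε)
    (hx : ‖x - a‖ ≤ profileInv 0 * ε) : ‖blowMap h a ε x - h a‖ ≤ profileInv 0 * ε := by
  by_cases hxa : x = a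
  · rw [hxa, blowMap_self, sub_self, norm_zero]
    exact mul_nonneg (profileInv_pos 0).le hε.le
  have hy := norm_pos_iff.2 (sub_ne_zero.2 hxa)
  have hs : 0 < ‖x - a‖ / ε := div_pos hy hε
  rw [norm_blowMap_sub hh hε hxa, mul_comm]
  refine mul_le_mul_of_nonneg_right ?_ hε.le
  have h1 : profile (‖x - a‖ / ε) ≤ 0 := by
    by_contra hcon
    have := (profileInv_lt_profile_iff hs).2 (not_le.1 hcon)
    rw [lt_div_iff₀ hε] at this
    linarith
  refine not_lt.1 fun hcon => ?_
  have h2 := profileInv_lt_iff.1 hcon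
  have h3 : 0 ≤ ‖direction h a ε x‖ / ‖x - a‖ := by positivity
  nlinarith

variable (hδ : IsSeparated z δ) (hε : 0 < ε) (hεδ : ε ≤ δ)

include hδ hε hεδ

theorem blow_of_inside {h : ℂ → ℂ} (ha : a ∈ z) (hx : ‖x - a‖ ≤ profileInv 0 * ε) :
    blow z ε h x = blowMap h a ε x := by
  have hex : ∃ a ∈ z, ‖x - a‖ ≤ profileInv 0 * ε := ⟨a, ha, hx⟩
  rw [blow, dif_pos hex]
  obtain ⟨h1, h2⟩ := hex.choose_spec
  have h0 := hδ.pos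
  have h3 := profileInv_zero_lt_one
  have h4 : profileInv 0 * ε ≤ δ := by nlinarith
  have : hex.choose = a := by
    by_contra hne
    have := hδ.le_norm_sub' ha h1 hne (x := x) (by linarith)
    linarith
  rw [this]

theorem blow_self {h : ℂ → ℂ} (ha : a ∈ z) : blow z ε h a = h a := by
  rw [blow_of_inside hδ hε hεδ ha, blowMap_self]
  rw [sub_self, norm_zero]
  exact mul_nonneg (profileInv_pos 0).le hε.le

/-- The two formulas agree near the boundary of the holes. -/
theorem blow_of_near (hh : h ∈ planeDiffeo z) (ha : a ∈ z) (hx : ‖x - a‖ ≤ 2 * δ) (hxa : x ≠ a)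
    (hhx : ‖x - a‖ ≤ profileInv 0 * ε ∨ ‖h (collapseAt a ε x) - h a‖ ≤ 2 * δ) :
    blow z ε h x = blowMap h a ε x := by
  by_cases hin : ‖x - a‖ ≤ profileInv 0 * ε
  · exact blow_of_inside hδ hε hεδ ha hin
  replace hhx := hhx.resolve_left hin
  rw [not_le] at hin
  have hout := (mem_outside_of_near (ε := ε) hδ ha hx).2 hin
  have hy := norm_pos_iff.2 (sub_ne_zero.2 hxa)
  have hk := shrink_pos ((lt_div_iff₀ hε).2 hin)
  have hV := norm_pos_iff.2 (direction_ne_zero (ε := ε) hh hxa)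
  rw [blow_of_outside hout, collapse_of_near hδ hε hεδ ha hx, ← collapseAt,
    inflate_of_near hδ hε hεδ ((hh.1.2 a).2 ha) hhx, ← shrink_smul_direction hh.2.1, norm_smul,
    Real.norm_of_nonneg hk.le, smul_smul, blowMap, expand]
  have h1 : profile (‖x - a‖ / ε) * (‖direction h a ε x‖ / ‖x - a‖) =
      shrink (‖x - a‖ / ε) * ‖direction h a ε x‖ / ε := by
    rw [shrink]; field_simp
  rw [h1]
  refine congrArg₂ (· + ·) rfl (congrArg (· • _) ?_)
  generalize profileInv _ = Q
  field_simp

theorem blow_mul (hg : g ∈ planeDiffeo z) (hh : h ∈ planeDiffeo z) :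
    blow z ε (g * h : ℂ ≃ₜ ℂ) x = blow z ε g (blow z ε h x) := by
  rcases inside_or_outside z ε x with ⟨a, ha, hx⟩ | hx
  · rw [blow_of_inside hδ hε hεδ ha hx, blow_of_inside hδ hε hεδ ha hx, blowMap_mul hg hh hε,
      blow_of_inside hδ hε hεδ ((hh.1.2 a).2 ha) (norm_blowMap_sub_le hh hε hx)]
  · have h1 : h (collapse z ε x) ∉ z := fun h2 =>
      (inflate_collapse hδ hε hεδ hx).1 ((hh.1.2 _).1 h2)
    obtain ⟨h3, h4⟩ := collapse_inflate hδ hε hεδ h1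
    rw [blow_of_outside hx, blow_of_outside hx, blow_of_outside h3, h4]
    rfl

theorem blow_one : blow z ε (1 : ℂ ≃ₜ ℂ) x = x := by
  rcases inside_or_outside z ε x with ⟨a, ha, hx⟩ | hx
  · rw [blow_of_inside hδ hε hεδ ha hx, blowMap_one hε]
  · rw [blow_of_outside hx]
    exact (inflate_collapse hδ hε hεδ hx).2

theorem blow_mem_iff (hh : h ∈ planeDiffeo z) : blow z ε h x ∈ z ↔ x ∈ z := by
  refine ⟨fun hx => ?_, fun hx => ?_⟩
  · have h1 := blow_mul hδ hε hεδ (x := x) (inv_mem hh) hh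
    rw [inv_mul_cancel, blow_one hδ hε hεδ, blow_self hδ hε hεδ hx] at h1
    rw [h1]
    exact ((inv_mem hh).1.2 _).2 hx
  · rw [blow_self hδ hε hεδ hx]
    exact (hh.1.2 _).2 hx

omit hδ hεδ in
theorem blow_eq_self_of_far {h : ℂ → ℂ} (hx : ∀ a ∈ z, ε ≤ ‖x - a‖) (hhx : h x = x) :
    blow z ε h x = x := by
  have hout : x ∈ outside z ε := fun a ha => by
    have := hx a ha
    have := profileInv_zero_lt_one
    nlinarith
  rw [blow_of_outside hout, collapse_of_far hε hx, hhx, inflate_of_far hε hx]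

omit hδ in
theorem blow_eq_self {h : ℂ → ℂ} {r : ℝ} (hr : ∀ a ∈ z, ‖a‖ + δ < r) (hx : r ≤ ‖x‖)
    (hhx : h x = x) : blow z ε h x = x := by
  refine blow_eq_self_of_far hε (fun a ha => ?_) hhx
  have h1 := hr a ha
  have h2 := norm_sub_norm_le x a
  linarith

/-- The blown up map is uniformly close to the original one. -/
theorem exists_norm_blow_sub_le (hh : h ∈ planeDiffeo z) (x : ℂ) :
    ∃ p, ‖p - x‖ ≤ ε ∧ ‖blow z ε h x - h p‖ ≤ ε := by
  have h1 := profileInv_zero_lt_one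
  rcases inside_or_outside z ε x with ⟨a, ha, hx⟩ | hx
  · refine ⟨a, ?_, ?_⟩
    · rw [norm_sub_rev]; nlinarith
    · rw [blow_of_inside hδ hε hεδ ha hx]
      have := norm_blowMap_sub_le hh hε hx
      nlinarith
  · refine ⟨collapse z ε x, norm_collapse_sub_le hδ hε hεδ hx, ?_⟩
    rw [blow_of_outside hx]
    exact norm_inflate_sub_le hδ hε hεδ fun h2 =>
      (inflate_collapse hδ hε hεδ hx).1 ((hh.1.2 _).1 h2)

end Blow

/-! ### Smoothness of the local blow-up in parameters -/

section Families

variable {z : Finset ℂ} {δ : ℝ} {Λ : Type} [TopologicalSpace Λ] {h : Λ → ℂ ≃ₜ ℂ} {ε : Λ → ℝ} {a : ℂ}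

theorem smoothFamilyOn_collapseAt (hε : Continuous ε) (hε0 : ∀ l, 0 < ε l) :
    SmoothFamilyOn (fun l x => collapseAt a (ε l) x) {p | p.2 ≠ a} := by
  have hne : ∀ p ∈ {p : Λ × ℂ | p.2 ≠ a}, p.2 - a ≠ 0 := fun p hp => sub_ne_zero.2 hp
  have h1 : SmoothFamilyOn (fun (_ : Λ) x => x - a) {p : Λ × ℂ | p.2 ≠ a} := .sub .id (.const' a)
  refine (SmoothFamilyOn.const' a).add (SmoothFamilyOn.smul ?_ h1)
  exact SmoothFamilyOn.contDiffOn_comp contDiffOn_shrink isOpen_Ioi ((h1.norm hne).rdiv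
    (.const (hε.comp continuous_fst).continuousOn) fun p _ => (hε0 p.1).ne')
    fun p hp => div_pos (norm_pos_iff.2 (hne p hp)) (hε0 p.1)

theorem SmoothFamilyOn.const_apply {E F : Type} [NormedAddCommGroup E] [NormedSpace ℝ E]
    [NormedAddCommGroup F] [NormedSpace ℝ F] {f : Λ → E → F} (hf : SmoothFamilyOn f univ)
    (a : E) {S : Set (Λ × E)} : SmoothFamilyOn (fun l (_ : E) => f l a) S :=
  hf.comp (.const' a) fun _ _ => mem_univ _

/-- Since `direction` never vanishes, every norm and quotient in the formula is smooth, on the rim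
too. Only the centre is left out, and there the Möbius formula takes over. -/
theorem smoothFamilyOn_blowMap (hh : ∀ l, h l ∈ planeDiffeo z)
    (hs : SmoothFamilyOn (fun l x => h l x) univ) (hε : Continuous ε) (hε0 : ∀ l, 0 < ε l) :
    SmoothFamilyOn (fun l x => blowMap (h l) a (ε l) x) {p | p.2 ≠ a} := by
  have hne : ∀ p ∈ {p : Λ × ℂ | p.2 ≠ a}, p.2 - a ≠ 0 := fun p hp => sub_ne_zero.2 hp
  have h1 : SmoothFamilyOn (fun (_ : Λ) x => x - a) {p : Λ × ℂ | p.2 ≠ a} := .sub .id (.const' a)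
  have hε' : SmoothFamilyOn (fun l (_ : ℂ) => ε l) {p : Λ × ℂ | p.2 ≠ a} :=
    .const (hε.comp continuous_fst).continuousOn
  have hV : SmoothFamilyOn (fun l x => direction (h l) a (ε l) x) {p | p.2 ≠ a} :=
    SmoothFamilyOn.bilinear (ContinuousLinearMap.id ℝ (ℂ →L[ℝ] ℂ))
      ((hs.meanDeriv a).comp (smoothFamilyOn_collapseAt hε hε0) fun _ _ => mem_univ _) h1
  have hV0 : ∀ p ∈ {p : Λ × ℂ | p.2 ≠ a}, direction (h p.1) a (ε p.1) p.2 ≠ 0 :=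
    fun p hp => direction_ne_zero (hh p.1) hp
  have hn := h1.norm hne
  have hVn := hV.norm hV0
  have hpr : SmoothFamilyOn (fun l x => profile (‖x - a‖ / ε l)) {p : Λ × ℂ | p.2 ≠ a} :=
    SmoothFamilyOn.contDiffOn_comp contDiffOn_profile isOpen_Ioi
      (hn.rdiv hε' fun p _ => (hε0 p.1).ne')
      fun p hp => div_pos (norm_pos_iff.2 (hne p hp)) (hε0 p.1)
  refine (hs.const_apply a).add (SmoothFamilyOn.smul ?_ hV)
  refine SmoothFamilyOn.rdiv (hε'.mul (SmoothFamilyOn.contDiff_comp contDiff_profileInv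
    (hpr.mul (hVn.rdiv hn fun p hp => (norm_pos_iff.2 (hne p hp)).ne')))) hVn
    fun p hp => (norm_pos_iff.2 (hV0 p hp)).ne'

end Families

theorem half_lt_profileInv_zero : 1 / 2 < profileInv 0 := by
  rw [← profile_lt_iff (by norm_num) (profileInv_pos 0), profile_profileInv,
    profile_of_le_half (by norm_num) le_rfl]
  norm_num

/-! ### Smoothness of the global blow-up in parameters -/

section Families

variable {z : Finset ℂ} {δ : ℝ} {Λ : Type} [TopologicalSpace Λ] {h : Λ → ℂ ≃ₜ ℂ} {ε : Λ → ℝ} {a : ℂ}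

theorem IsSeparated.norm_lt_one (hδ : IsSeparated z δ) (ha : a ∈ z) : ‖a‖ < 1 := by
  have := hδ.norm_add_lt a ha
  have := hδ.pos
  linarith

/-- The formula for the blown up map in the middle of the holes. -/
theorem blow_of_close (hδ : IsSeparated z δ) {ε : ℝ} (hε : 0 < ε) (hεδ : ε ≤ δ) {h : ℂ ≃ₜ ℂ}
    (hh : h ∈ planeDiffeo z) (ha : a ∈ z) {x : ℂ} (hx : ‖x - a‖ ≤ ε ^ 2 / 8) :
    1 / 2 ≤ ‖1 - starRingEnd ℂ (a - h a) * (x - a) / ε ^ 2‖ ∧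
    blow z ε h x = h a + (x - a) / (1 - starRingEnd ℂ (a - h a) * (x - a) / ε ^ 2) := by
  have hle := hεδ.trans hδ.le_half
  obtain ⟨h1, h2⟩ := blowMap_of_near hh (hδ.norm_lt_one ha) hε hle hx
  refine ⟨h1, ?_⟩
  rw [blow_of_inside hδ hε hεδ ha, h2]
  have := half_lt_profileInv_zero
  nlinarith

theorem smoothFamilyOn_moebius (hs : SmoothFamilyOn (fun l x => h l x) univ) (hε : Continuous ε)
    (hε0 : ∀ l, 0 < ε l) {S : Set (Λ × ℂ)} :
    SmoothFamilyOn (fun l x => 1 - starRingEnd ℂ (a - h l a) * (x - a) / (ε l : ℂ) ^ 2) S := by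
  have hε' : SmoothFamilyOn (fun l (_ : ℂ) => ((ε l : ℝ) : ℂ) ^ 2) S :=
    .const (((Complex.continuous_ofReal.comp hε).pow 2).comp continuous_fst).continuousOn
  exact (SmoothFamilyOn.const' 1).sub ((((SmoothFamilyOn.const' a).sub (hs.const_apply a)).conj.mul
    (SmoothFamilyOn.id.sub (.const' a))).div hε' fun p _ =>
      pow_ne_zero 2 (Complex.ofReal_ne_zero.2 (hε0 p.1).ne'))

/-- Three formulas on open sets: the Möbius map at a centre, `blowMap` on the rest of a hole and
slightly beyond its rim, and `inflate ∘ h ∘ collapse` outside the holes. -/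
theorem smoothFamilyOn_blow (hδ : IsSeparated z δ) (hh : ∀ l, h l ∈ planeDiffeo z)
    (hs : SmoothFamilyOn (fun l x => h l x) univ) (hε : Continuous ε) (hε0 : ∀ l, 0 < ε l)
    (hεδ : ∀ l, ε l ≤ δ) : SmoothFamilyOn (fun l x => blow z (ε l) (h l) x) univ := by
  have hδ0 := hδ.pos
  refine SmoothFamilyOn.of_local_isOpen isOpen_univ fun p _ => ?_
  simp only [univ_inter]
  have hεc : Continuous fun p : Λ × ℂ => ε p.1 := hε.comp continuous_fst
  rcases inside_or_outside z (ε p.1) p.2 with ⟨a, ha, hx⟩ | hx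
  · by_cases hxa : p.2 = a
    · refine ⟨{p | ‖p.2 - a‖ < ε p.1 ^ 2 / 8}, isOpen_lt (by fun_prop) (by fun_prop), ?_, ?_⟩
      · change ‖p.2 - a‖ < ε p.1 ^ 2 / 8
        rw [hxa, sub_self, norm_zero]
        have := hε0 p.1
        positivity
      · refine ((hs.const_apply a).add ((SmoothFamilyOn.id.sub (.const' a)).div
          (smoothFamilyOn_moebius (a := a) hs hε hε0) fun p hp => ?_)).congr fun p hp =>
            (blow_of_close hδ (hε0 _) (hεδ _) (hh _) ha (le_of_lt hp)).2
        have := (blow_of_close hδ (hε0 p.1) (hεδ p.1) (hh p.1) ha (le_of_lt hp)).1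
        exact norm_pos_iff.1 (by linarith)
    · have hopen : IsOpen ({p : Λ × ℂ | p.2 ≠ a} ∩
          {p | ‖h p.1 (collapseAt a (ε p.1) p.2) - h p.1 a‖ < 2 * δ}) := by
        have hc : ContinuousOn (fun p : Λ × ℂ =>
            ‖h p.1 (collapseAt a (ε p.1) p.2) - h p.1 a‖) {p : Λ × ℂ | p.2 ≠ a} :=
          ((hs.comp (smoothFamilyOn_collapseAt hε hε0) fun _ _ => mem_univ _).sub
            (hs.const_apply a)).continuousOn.norm
        exact hc.isOpen_inter_preimage (isOpen_ne.preimage continuous_snd) isOpen_Iio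
      have hopen2 : IsOpen ({p : Λ × ℂ | p.2 ≠ a} ∩ {p | ‖p.2 - a‖ < profileInv 0 * ε p.1}) :=
        (isOpen_ne.preimage continuous_snd).inter (isOpen_lt (by fun_prop) (by fun_prop))
      have hopen3 : IsOpen {p : Λ × ℂ | ‖p.2 - a‖ < 2 * δ} := isOpen_lt (by fun_prop) (by fun_prop)
      refine ⟨_, (hopen2.union hopen).inter hopen3, ⟨?_, ?_⟩, ?_⟩
      · rcases hx.lt_or_eq with hx | hx
        · exact Or.inl ⟨hxa, hx⟩
        -- A rim point is collapsed exactly to `a`. The distance in question is `0` there, and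
        -- nearby it stays below `2δ`.
        · refine Or.inr ⟨hxa, ?_⟩
          change ‖h p.1 (collapseAt a (ε p.1) p.2) - h p.1 a‖ < 2 * δ
          rw [collapseAt, hx, mul_div_cancel_right₀ _ (hε0 _).ne', shrink, profile_profileInv]
          simpa using hδ0
      · have := profileInv_zero_lt_one
        have := hεδ p.1
        have := hε0 p.1
        change ‖p.2 - a‖ < 2 * δ
        nlinarith
      · refine ((smoothFamilyOn_blowMap (a := a) hh hs hε hε0).mono ?_).congr ?_
        · rintro p ⟨h1 | h1, -⟩ <;> exact h1.1
        · rintro p ⟨h1, h3⟩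
          refine blow_of_near hδ (hε0 _) (hεδ _) (hh _) ha (le_of_lt h3) ?_ ?_
          · rcases h1 with h1 | h1 <;> exact h1.1
          · exact h1.imp (fun h => le_of_lt h.2) fun h => le_of_lt h.2
  · refine ⟨{p | p.2 ∈ outside z (ε p.1)}, ?_, hx, ?_⟩
    · have : {p : Λ × ℂ | p.2 ∈ outside z (ε p.1)} =
          ⋂ a ∈ z, {p : Λ × ℂ | profileInv 0 * ε p.1 < ‖p.2 - a‖} := by
        ext p
        simp [outside]
      rw [this]
      exact isOpen_biInter_finset fun a _ => isOpen_lt (by fun_prop) (by fun_prop)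
    · have h1 : ∀ p ∈ {p : Λ × ℂ | p.2 ∈ outside z (ε p.1)}, p.2 ∉ z :=
        fun p hp => notMem_of_outside (hε0 _) hp
      refine (SmoothFamilyOn.inflate hε hε0 (hs.comp (SmoothFamilyOn.collapse hε hε0 .id h1)
        fun _ _ => mem_univ _) fun p hp h2 => ?_).congr fun p hp => blow_of_outside hp
      exact (inflate_collapse hδ (hε0 _) (hεδ _) hp).1 (((hh _).1.2 _).1 h2)

end Families

/-! ### Blowing up as a homomorphism -/

section BlowHom

variable {z : Finset ℂ} {δ ε : ℝ}

theorem continuous_blow (hδ : IsSeparated z δ) (hε : 0 < ε) (hεδ : ε ≤ δ) {h : ℂ ≃ₜ ℂ}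
    (hh : h ∈ planeDiffeo z) : Continuous (blow z ε h) := by
  have := (smoothFamilyOn_blow (Λ := Unit) (h := fun _ => h) (ε := fun _ => ε) hδ (fun _ => hh)
    (SmoothFamilyOn.of_contDiff hh.2.1) continuous_const (fun _ => hε) fun _ => hεδ).continuous
  exact this.comp (Continuous.prodMk_right ())

/-- Blowing up, as a homomorphism. -/
noncomputable def blowHom (hδ : IsSeparated z δ) (hε : 0 < ε) (hεδ : ε ≤ δ) :
    planeDiffeo z →* planeHomeo z :=
  (homOfAction (fun h : planeDiffeo z => blow z ε (h : ℂ ≃ₜ ℂ))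
    (fun h => continuous_blow hδ hε hεδ h.2) (fun _ => blow_one hδ hε hεδ)
    (fun g h _ => blow_mul hδ hε hεδ g.2 h.2)).codRestrict (planeHomeo z) fun h =>
      ⟨fun x hx => blow_eq_self hε hεδ hδ.norm_add_lt hx (h.2.1.1 x hx),
        fun _ => blow_mem_iff hδ hε hεδ h.2⟩

end BlowHom

/-! ### Smoothness of the lift at the branch points -/

section SmoothLift

variable {z : Finset ℂ} {Λ : Type} [TopologicalSpace Λ] {k : Λ → ℂ ≃ₜ ℂ} {a : ℂ}

theorem isPreconnected_punctured_ball (a : ℂ) (r : ℝ) :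
    IsPreconnected (Metric.ball a r \ {a}) := by
  have : Metric.ball a r \ {a} =
      (fun p : ℝ × ℝ => a + p.1 * Complex.exp (p.2 * Complex.I)) '' (Ioo 0 r ×ˢ univ) := by
    ext x
    simp only [mem_sdiff, Metric.mem_ball, dist_eq_norm, mem_singleton_iff, mem_image, mem_prod,
      mem_Ioo, mem_univ, and_true, Prod.exists]
    constructor
    · rintro ⟨h1, h2⟩
      exact ⟨‖x - a‖, (x - a).arg, ⟨norm_pos_iff.2 (sub_ne_zero.2 h2), h1⟩,
        by rw [Complex.norm_mul_exp_arg_mul_I, add_sub_cancel]⟩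
    · rintro ⟨ρ, θ, ⟨h1, h2⟩, rfl⟩
      have : ‖(ρ : ℂ) * Complex.exp (θ * Complex.I)‖ = ρ := by
        rw [norm_mul, Complex.norm_exp_ofReal_mul_I, Complex.norm_real, Real.norm_of_nonneg h1.le,
          mul_one]
      rw [add_sub_cancel_left, this]
      refine ⟨h2, fun h3 => ?_⟩
      rw [add_eq_left.1 h3, norm_zero] at this
      exact h1.ne this
  rw [this]
  exact (isPreconnected_Ioo.prod isPreconnected_univ).image _ (by fun_prop)

/-- If the difference quotient extends smoothly to `a`, so does its square root. -/
theorem exists_smooth_quotRoot (hk : ∀ l, k l ∈ planeHomeo z)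
    (hs : SmoothFamilyOn (fun l x => k l x) univ) (ha : ‖a‖ < 1) {e : Λ → ℂ → ℂ} {r : ℝ}
    (hr : 0 < r) (he : SmoothFamilyOn e (univ ×ˢ Metric.ball a r))
    (he0 : ∀ l, ∀ x ∈ Metric.ball a r, e l x ≠ 0)
    (hdq : ∀ l, ∀ x ∈ Metric.ball a r, x ≠ a → dquot (k l) a x = e l x) (l₀ : Λ) :
    ∃ (W : Set (Λ × ℂ)) (Φ : Λ → ℂ → ℂ), IsOpen W ∧ (l₀, a) ∈ W ∧ SmoothFamilyOn Φ W ∧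
      ∀ p ∈ W, p.2 ≠ a → quotRoot (k p.1) a p.2 = Φ p.1 p.2 := by
  set c := csqrt (e l₀ a) with hc
  have hc0 : c ≠ 0 := csqrt_ne_zero (he0 l₀ a (Metric.mem_ball_self hr))
  have hopen : IsOpen ((univ : Set Λ) ×ˢ Metric.ball a r ∩
      {p | e p.1 p.2 / c ^ 2 ∈ Complex.slitPlane}) :=
    (he.continuousOn.div_const _).isOpen_inter_preimage (isOpen_univ.prod Metric.isOpen_ball)
      Complex.isOpen_slitPlane
  have hmem : (l₀, a) ∈ (univ : Set Λ) ×ˢ Metric.ball a r ∩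
      {p | e p.1 p.2 / c ^ 2 ∈ Complex.slitPlane} := by
    refine ⟨⟨mem_univ _, Metric.mem_ball_self hr⟩, ?_⟩
    change e l₀ a / c ^ 2 ∈ Complex.slitPlane
    rw [hc, csqrt_sq, div_self (he0 l₀ a (Metric.mem_ball_self hr))]
    exact Complex.one_mem_slitPlane
  obtain ⟨N, V, hN, hV, hl₀, haV, hsub⟩ := isOpen_prod_iff.1 hopen l₀ a hmem
  obtain ⟨ρ, hρ, hρV⟩ := Metric.isOpen_iff.1 hV a haV
  have hsub' : ∀ p ∈ N ×ˢ Metric.ball a ρ, p.2 ∈ Metric.ball a r ∧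
      e p.1 p.2 / c ^ 2 ∈ Complex.slitPlane := fun p hp => by
    have := hsub (⟨hp.1, hρV hp.2⟩ : p ∈ N ×ˢ V)
    exact ⟨this.1.2, this.2⟩
  set ψ : Λ → ℂ → ℂ := fun l x => c * csqrt (e l x / c ^ 2) with hψ
  have hψs : SmoothFamilyOn ψ (N ×ˢ Metric.ball a ρ) :=
    (SmoothFamilyOn.const' c).mul (((he.mono fun p hp => ⟨mem_univ _, (hsub' p hp).1⟩).div
      (.const' (c ^ 2)) fun _ _ => pow_ne_zero 2 hc0).csqrt fun p hp => (hsub' p hp).2)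
  have hψsq : ∀ l x, ψ l x ^ 2 = e l x := fun l x => by
    have := mul_div_cancel₀ (e l x) (pow_ne_zero 2 hc0)
    simp only [hψ, mul_pow, csqrt_sq (_ / _)]
    exact this
  have hψ0 : ∀ p ∈ N ×ˢ Metric.ball a ρ, ψ p.1 p.2 ≠ 0 := fun p hp h0 =>
    he0 p.1 p.2 (hsub' p hp).1 (by rw [← hψsq, h0]; simp)
  obtain ⟨x₁, hx₁, hx₁a⟩ : ∃ x₁ ∈ Metric.ball a ρ, x₁ ≠ a := by
    refine ⟨a + (ρ / 2 : ℝ), ?_, ?_⟩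
    · rw [Metric.mem_ball, dist_eq_norm, add_sub_cancel_left, Complex.norm_real,
        Real.norm_of_nonneg (by linarith)]
      linarith
    · rw [Ne, add_eq_left, Complex.ofReal_eq_zero]
      exact (half_pos hρ).ne'
  -- Both functions are roots of `e`, so they differ by a sign on the connected punctured ball. The
  -- sign is read off at the reference point `x₁`; it may depend on `l`, but continuously.
  set τ : Λ → ℂ := fun l => quotRoot (k l) a x₁ / ψ l x₁ with hτ
  have hq := continuousOn_quotRoot_family hk hs.continuous ha
  have hτc : ContinuousOn τ N := by
    have h1 : Continuous fun l : Λ => (l, x₁) := by fun_prop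
    have h2 : ContinuousOn (fun l => quotRoot (k l) a x₁) N :=
      hq.comp (f := fun l : Λ => (l, x₁)) h1.continuousOn fun l _ => hx₁a
    have h3 : ContinuousOn (fun l => ψ l x₁) N :=
      hψs.continuousOn.comp (f := fun l : Λ => (l, x₁)) h1.continuousOn fun l hl => ⟨hl, hx₁⟩
    exact h2.div h3 fun l hl => hψ0 (l, x₁) ⟨hl, hx₁⟩
  refine ⟨N ×ˢ Metric.ball a ρ, fun l x => τ l * ψ l x, hN.prod Metric.isOpen_ball,
    ⟨hl₀, Metric.mem_ball_self hρ⟩,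
    (SmoothFamilyOn.const (hτc.comp continuousOn_fst fun p hp => hp.1)).mul hψs, ?_⟩
  rintro ⟨l, x⟩ ⟨hl, hx⟩ hxa
  have hsq : ∀ y ∈ Metric.ball a ρ, y ≠ a → quotRoot (k l) a y ^ 2 = ψ l y ^ 2 := fun y hy hya => by
    rw [quotRoot_sq (hk l) ha hya, hψsq, hdq l y (hsub' (l, y) ⟨hl, hy⟩).1 hya]
  have hτ1 : τ l ^ 2 = 1 := by
    rw [hτ, div_pow, hsq x₁ hx₁ hx₁a, div_self (pow_ne_zero 2 (hψ0 (l, x₁) ⟨hl, hx₁⟩))]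
  refine (isPreconnected_punctured_ball a ρ).eq_of_sq_eq (f := quotRoot (k l) a)
    (g := fun y => τ l * ψ l y) (y := x₁)
    ((continuousOn_quotRoot (hk l) ha).mono fun y hy => hy.2) ?_ (fun y hy => ?_) (fun {y} hy => ?_)
    ⟨hx₁, hx₁a⟩ ?_ ⟨hx, hxa⟩
  · exact continuousOn_const.mul ((hψs.contDiffOn (l := l) fun y hy => ⟨hl, hy⟩).continuousOn.mono
      sdiff_subset)
  · simp only [Pi.pow_apply]
    rw [hsq y hy.1 hy.2, mul_pow (τ l), hτ1, one_mul]
  · refine mul_ne_zero (fun h0 => ?_) (hψ0 (l, y) ⟨hl, hy.1⟩)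
    rw [h0] at hτ1
    simp at hτ1
  · exact (div_mul_cancel₀ _ (hψ0 (l, x₁) ⟨hl, hx₁⟩)).symm

variable {δ ε : ℝ} {h : Λ → planeDiffeo z}

/-- Near every point, the lifts of a smooth family of blown up maps are restrictions of a smooth
family on the ambient space. -/
theorem exists_smooth_curveLift_blow (hδ : IsSeparated z δ) (hε : 0 < ε) (hεδ : ε ≤ δ)
    (hs : SmoothFamilyOn (fun l x => (h l : ℂ ≃ₜ ℂ) x) univ) (p₀ : Λ × ℂ × ℂ) :
    ∃ (W : Set (Λ × ℂ × ℂ)) (Φ : Λ → ℂ × ℂ → ℂ × ℂ), IsOpen W ∧ p₀ ∈ W ∧ SmoothFamilyOn Φ W ∧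
      ∀ p ∈ W, p.2 ∈ curve z → curveLift z (blowHom hδ hε hεδ (h p.1)) p.2 = Φ p.1 p.2 := by
  classical
  set k : Λ → ℂ ≃ₜ ℂ := fun l => blowHom hδ hε hεδ (h l) with hkdef
  have hk : ∀ l, k l ∈ planeHomeo z := fun l => (blowHom hδ hε hεδ (h l)).2
  have hks : SmoothFamilyOn (fun l x => k l x) univ :=
    smoothFamilyOn_blow hδ (fun l => (h l).2) hs (continuous_const (y := ε)) (fun _ => hε) fun _ => hεδ
  have hcfst : Continuous fun p : Λ × ℂ × ℂ => p.2.1 := by fun_prop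
  by_cases hz : p₀.2.1 ∈ z
  · set a := p₀.2.1 with ha
    have ha1 := hδ.norm_lt_one hz
    have hball : ∀ {x}, x ∈ Metric.ball a (ε ^ 2 / 8) → ‖x - a‖ ≤ ε ^ 2 / 8 := fun hx => by
      rw [Metric.mem_ball, dist_eq_norm] at hx
      exact hx.le
    -- The Möbius denominator: near `a` the difference quotient of the blown-up map is `e⁻¹`, which
    -- is smooth and nonzero at `a` as well.
    set e : Λ → ℂ → ℂ := fun l x => 1 - starRingEnd ℂ (a - (h l : ℂ ≃ₜ ℂ) a) * (x - a) / (ε : ℂ) ^ 2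
      with he
    have hes : SmoothFamilyOn e univ :=
      smoothFamilyOn_moebius (h := fun l => h l) hs continuous_const fun _ => hε
    have he0 : ∀ l, ∀ x ∈ Metric.ball a (ε ^ 2 / 8), e l x ≠ 0 := fun l x hx => by
      have := (blow_of_close hδ hε hεδ (h l).2 hz (hball hx)).1
      exact norm_pos_iff.1 (by linarith)
    obtain ⟨W, Φ, hW, haW, hΦ, hΦeq⟩ := exists_smooth_quotRoot hk hks ha1 (r := ε ^ 2 / 8)
      (e := fun l x => (e l x)⁻¹) (by positivity)
      ((hes.mono (subset_univ _)).inv fun p hp => he0 p.1 p.2 hp.2)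
      (fun l x hx => inv_ne_zero (he0 l x hx)) (fun l x hx hxa => by
        have h1 : k l x = blow z ε (h l : ℂ ≃ₜ ℂ) x := rfl
        have h2 : k l a = blow z ε (h l : ℂ ≃ₜ ℂ) a := rfl
        rw [dquot, h1, h2, blow_self hδ hε hεδ hz,
          (blow_of_close hδ hε hεδ (h l).2 hz (hball hx)).2, add_sub_cancel_left, div_div,
          mul_comm, ← div_div, div_self (sub_ne_zero.2 hxa), one_div]) p₀.1
    have hφ : Continuous fun p : Λ × ℂ × ℂ => (p.1, p.2.1) := by fun_prop
    have hfst : SmoothFamilyOn (fun (_ : Λ) (q : ℂ × ℂ) => q.1) univ := SmoothFamilyOn.id.fst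
    have hsnd : SmoothFamilyOn (fun (_ : Λ) (q : ℂ × ℂ) => q.2) univ := SmoothFamilyOn.id.snd
    refine ⟨{p | (p.1, p.2.1) ∈ W} ∩ {p | ∀ b ∈ z.erase a, p.2.1 ≠ b},
      fun l q => (k l q.1, q.2 * (Φ l q.1 * ∏ b ∈ z.erase a, quotRoot (k l) b q.1)),
      (hW.preimage hφ).inter ?_, ⟨haW, fun b hb => (Finset.ne_of_mem_erase hb).symm⟩, ?_, ?_⟩
    · simp only [ofPred_forall]
      exact isOpen_biInter_finset fun b _ => isOpen_ne.preimage hcfst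
    · refine (hks.comp (hfst.mono (subset_univ _)) fun _ _ => mem_univ _).prodMk
        ((hsnd.mono (subset_univ _)).mul ((hΦ.comp (hfst.mono (subset_univ _)) fun p hp => hp.1).mul
          (SmoothFamilyOn.finset_prod _ fun b hb => ?_)))
      exact (smoothFamilyOn_quotRoot hk hks (hδ.norm_lt_one (Finset.mem_of_mem_erase hb))).comp
        (hfst.mono (subset_univ _)) fun p hp => hp.2 b hb
    · rintro p ⟨hp, -⟩ hpc
      refine Prod.ext rfl ?_
      change p.2.2 * ∏ b ∈ z, quotRoot (k p.1) b p.2.1 = _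
      -- Over `a` itself `w = 0` kills the product, so the junk value of `quotRoot` at `a` is
      -- harmless.
      by_cases hpa : p.2.1 = a
      · rw [(snd_eq_zero_iff hpc).2 (hpa ▸ hz), zero_mul]
        change 0 = p.2.2 * _
        rw [(snd_eq_zero_iff hpc).2 (hpa ▸ hz), zero_mul]
      · rw [← Finset.mul_prod_erase z _ hz, hΦeq _ hp hpa]
  · refine ⟨{p | p.2.1 ∉ z}, fun l q => curveLift z (k l) q, ?_, hz,
      SmoothFamilyOn.curveLift (fun a ha => hδ.norm_lt_one ha) hk hks .id fun p hp => hp,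
      fun _ _ _ => rfl⟩
    exact (z.finite_toSet.isClosed.isOpen_compl).preimage hcfst

end SmoothLift
-- The isotopy that shrinks the holes
variable {z : Finset ℂ} {δ ε : ℝ}

open Classical in
/-- The isotopy from `h` to the blown up homeomorphism that lets the holes grow. -/
noncomputable def blowIsotopy (hδ : IsSeparated z δ) (hε : 0 < ε) (hεδ : ε ≤ δ)
    (h : planeDiffeo z) (t : I) : planeHomeo z :=
  if ht : 0 < t then
    blowHom hδ (mul_pos (show (0 : ℝ) < t from ht) hε)
      ((mul_le_of_le_one_left hε.le t.2.2).trans hεδ) h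
  else ⟨h, h.2.1⟩

theorem continuous_blowIsotopy (hδ : IsSeparated z δ) (hε : 0 < ε) (hεδ : ε ≤ δ)
    (h : planeDiffeo z) :
    Continuous fun p : I × ℂ => (blowIsotopy hδ hε hεδ h p.1 : ℂ ≃ₜ ℂ) p.2 := by
  rw [continuous_iff_continuousAt]
  rintro ⟨t, x⟩
  by_cases ht : 0 < t
  · have hopen : IsOpen {p : I × ℂ | 0 < p.1} := isOpen_lt continuous_const continuous_fst
    refine ContinuousOn.continuousAt (s := {p : I × ℂ | 0 < p.1}) ?_ (hopen.mem_nhds ht)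
    rw [continuousOn_iff_continuous_domRestrict]
    -- For `t > 0` the time is just a parameter, with hole size `t ε`.
    have h1 := (smoothFamilyOn_blow (Λ := {t : I // 0 < t}) (h := fun _ => h)
      (ε := fun t => (t : ℝ) * ε) hδ (fun _ => h.2) (SmoothFamilyOn.of_contDiff h.2.2.1)
      (by fun_prop) (fun t => mul_pos (show (0 : ℝ) < (t : I) from t.2) hε)
      fun t => (mul_le_of_le_one_left hε.le t.1.2.2).trans hεδ).continuous
    refine (h1.comp (f := fun p : {p : I × ℂ | 0 < p.1} =>
      ((⟨p.1.1, p.2⟩ : {t : I // 0 < t}), p.1.2)) (by fun_prop)).congr fun p => ?_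
    have hp : 0 < p.1.1 := p.2
    simp only [domRestrict, Function.comp_apply, blowIsotopy, dif_pos hp]
    rfl
  · obtain rfl : t = 0 := le_antisymm (not_lt.1 ht) t.2.1
    have h0 : blowIsotopy hδ hε hεδ h 0 = ⟨h, h.2.1⟩ := dif_neg (lt_irrefl _)
    -- At `t = 0` the formulas degenerate; continuity follows from the blown-up map being within `t
    -- ε` of the value of `h` at a point within `t ε`.
    have key : ∀ p : I × ℂ, ∃ y, ‖y - p.2‖ ≤ p.1 * ε ∧
        ‖(blowIsotopy hδ hε hεδ h p.1 : ℂ ≃ₜ ℂ) p.2 - (h : ℂ ≃ₜ ℂ) y‖ ≤ p.1 * ε := by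
      intro p
      by_cases hp : 0 < p.1
      · rw [blowIsotopy, dif_pos hp]
        exact exists_norm_blow_sub_le hδ (mul_pos (show (0 : ℝ) < p.1 from hp) hε)
          ((mul_le_of_le_one_left hε.le p.1.2.2).trans hεδ) h.2 p.2
      · rw [blowIsotopy, dif_neg hp]
        have : 0 ≤ (p.1 : ℝ) * ε := mul_nonneg p.1.2.1 hε.le
        exact ⟨p.2, by simpa using this, by simpa using this⟩
    choose y hy1 hy2 using key
    have hlim : Filter.Tendsto (fun p : I × ℂ => (p.1 : ℝ) * ε) (𝓝 (0, x)) (𝓝 0) := by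
      have : Continuous fun p : I × ℂ => (p.1 : ℝ) * ε := by fun_prop
      simpa using this.tendsto (0, x)
    have hy : Filter.Tendsto y (𝓝 (0, x)) (𝓝 x) := by
      have h1 := squeeze_zero_norm hy1 hlim
      have h2 : Filter.Tendsto (fun p : I × ℂ => p.2) (𝓝 (0, x)) (𝓝 x) := continuous_snd.tendsto _
      simpa using h1.add h2
    have h3 := ((h : ℂ ≃ₜ ℂ).continuous.tendsto x).comp hy
    have h4 := (squeeze_zero_norm hy2 hlim).add h3
    rw [ContinuousAt, h0]
    simpa using h4

/-- Blowing up does not change the mapping class of the lift. -/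
theorem mk_liftHom_blowHom (hz : ∀ a ∈ z, ‖a‖ < 1) (hδ : IsSeparated z δ) (hε : 0 < ε)
    (hεδ : ε ≤ δ) (h : planeDiffeo z) :
    (QuotientGroup.mk (liftHom hz (blowHom hδ hε hεδ h)) : TopMod (homeoSurface z)) =
      QuotientGroup.mk (liftHom hz ⟨h, h.2.1⟩) := by
  have hmem : (liftHom hz ⟨h, h.2.1⟩)⁻¹ * liftHom hz (blowHom hδ hε hεδ h) ∈
      isotopyOne (homeoSurface z) := by
    refine ⟨fun t => (liftHom hz ⟨h, h.2.1⟩)⁻¹ * liftHom hz (blowIsotopy hδ hε hεδ h t), ?_, ?_, ?_⟩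
    · exact ((liftHom hz ⟨h, h.2.1⟩ : surface z ≃ₜ surface z)⁻¹ :
        surface z ≃ₜ surface z).continuous.comp
        (continuous_liftHom_family hz (continuous_blowIsotopy hδ hε hεδ h))
    · simp only
      rw [blowIsotopy, dif_neg (lt_irrefl _), inv_mul_cancel]
    · simp only
      rw [blowIsotopy, dif_pos zero_lt_one]
      congr 2
      refine Subtype.ext (Homeomorph.ext fun x => ?_)
      change blow z (((1 : I) : ℝ) * ε) _ x = blow z ε _ x
      simp
  exact (QuotientGroup.eq.2 hmem).symm

/-! ### Smooth families and the `C^∞` topology -/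

section CInftyTopology

theorem uniqueDiffOn_square : UniqueDiffOn ℝ (Icc (0 : ℝ × ℝ) 1) := by
  rw [show (Icc (0 : ℝ × ℝ) 1) = Icc (0 : ℝ) 1 ×ˢ Icc (0 : ℝ) 1 from (Icc_prod_eq _ _)]
  exact (uniqueDiffOn_Icc one_pos).prod (uniqueDiffOn_Icc one_pos)

variable {E : Type} [NormedAddCommGroup E] [NormedSpace ℝ E] {X : Set E} {K : Subgroup (X ≃ₜ X)}

theorem IsSmooth.contDiffOn_comp {F : Type*} [NormedAddCommGroup F] [NormedSpace ℝ F] {f : X → F}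
    (hf : IsSmooth f) {G : Type*} [NormedAddCommGroup G] [NormedSpace ℝ G] {c : G → X} {Q : Set G}
    (hc : ContDiffOn ℝ ∞ (fun t => (c t : E)) Q) : ContDiffOn ℝ ∞ (fun t => f (c t)) Q := by
  intro t ht
  obtain ⟨U, hU, f', hf', hfU⟩ := hf (c t)
  have h1 : ContDiffAt ℝ ∞ f' (c t) := hf'.contDiffAt hU
  refine (h1.comp_contDiffWithinAt t (hc t ht)).congr_of_eventuallyEq ?_ ?_
  · filter_upwards [(hc.continuousOn t ht).preimage_mem_nhdsWithin hU] with s hs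
    exact (hfU _ hs).symm
  · exact (hfU _ (mem_of_mem_nhds hU)).symm

/-- In the `C^∞` topology, the restrictions of diffeomorphisms to a smooth square form a smooth
family. -/
theorem smoothFamilyOn_square (c : SmoothSquare X) :
    SmoothFamilyOn (fun (f : diffIn K) t => ((f : X ≃ₜ X) (c.1 t) : E))
      (univ ×ˢ Icc (0 : ℝ × ℝ) 1) := by
  have hsm : ∀ f : diffIn K, ContDiffOn ℝ ∞ (fun t => ((f : X ≃ₜ X) (c.1 t) : E))
      (Icc (0 : ℝ × ℝ) 1) := fun f => f.2.1.1.contDiffOn_comp c.2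
  refine fun k => ParamContDiffOn.of_iteratedFDerivWithin uniqueDiffOn_square hsm fun j _ => ?_
  have hcont : Continuous (fun f : diffIn K => UniformOnFun.ofFun {Icc (0 : ℝ × ℝ) 1}
        (iteratedFDerivWithin ℝ j (fun t => ((f : X ≃ₜ X) (c.1 t) : E)) (Icc (0 : ℝ × ℝ) 1))) :=
    continuous_iInf_dom (i := c) (continuous_iInf_dom (i := j) continuous_induced_dom)
  rintro ⟨f, t⟩ ⟨-, ht⟩
  have h1 := UniformOnFun.tendsto_iff_tendstoUniformlyOn.1 (hcont.tendsto f) _ rfl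
  refine tendsto_comp_of_locally_uniform_limit_within
    (F := fun p : diffIn K × ℝ × ℝ => iteratedFDerivWithin ℝ j
      (fun t => ((p.1 : X ≃ₜ X) (c.1 t) : E)) (Icc (0 : ℝ × ℝ) 1))
    (g := Prod.snd) (s := Icc (0 : ℝ × ℝ) 1)
    ((hsm f).continuousOn_iteratedFDerivWithin (mod_cast le_top) uniqueDiffOn_square t ht) ?_ ?_
  · exact tendsto_nhdsWithin_iff.2 ⟨continuous_snd.continuousWithinAt,
      Filter.eventually_of_mem self_mem_nhdsWithin fun p hp => hp.2⟩
  · intro u hu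
    refine ⟨_, self_mem_nhdsWithin, ?_⟩
    have h2 : Filter.Tendsto Prod.fst (𝓝[univ ×ˢ Icc (0 : ℝ × ℝ) 1] (f, t)) (𝓝 f) :=
      continuous_fst.continuousWithinAt
    exact h2.eventually (h1 u hu)

/-- A family of diffeomorphisms whose restrictions to all smooth squares are smooth families is
continuous in the `C^∞` topology. -/
theorem continuous_of_smoothFamilyOn {Λ : Type} [TopologicalSpace Λ] {f : Λ → diffIn K}
    (hf : ∀ c : SmoothSquare X, SmoothFamilyOn (fun l t => ((f l : X ≃ₜ X) (c.1 t) : E))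
      (univ ×ˢ Icc (0 : ℝ × ℝ) 1)) : Continuous f := by
  refine continuous_iInf_rng.2 fun c => continuous_iInf_rng.2 fun k => continuous_induced_rng.2 ?_
  rw [continuous_iff_continuousAt]
  intro l
  refine UniformOnFun.tendsto_iff_tendstoUniformlyOn.2 ?_
  rintro _ rfl u hu
  -- Compactness of the square turns joint continuity of the iterated derivatives into uniform
  -- convergence.
  obtain ⟨v, hv, h⟩ := isCompact_Icc.mem_uniformity_of_prod
    (f := fun l => iteratedFDerivWithin ℝ k (fun t => ((f l : X ≃ₜ X) (c.1 t) : E))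
      (Icc (0 : ℝ × ℝ) 1))
    ((hf c k).continuousOn_iteratedFDerivWithin uniqueDiffOn_square) (mem_univ l)
    (UniformSpace.symm hu)
  rw [nhdsWithin_univ] at hv
  filter_upwards [hv] with l' hl' t ht using h l' hl' t ht

/-- A family of maps that extends locally to smooth families on the ambient space restricts to
smooth families on smooth squares. -/
theorem smoothFamilyOn_comp_square {F : Type} [NormedAddCommGroup F] [NormedSpace ℝ F]
    {Λ : Type} [TopologicalSpace Λ] {f : Λ → E → F}
    (hf : ∀ p : Λ × E, p.2 ∈ X → ∃ (W : Set (Λ × E)) (Φ : Λ → E → F), IsOpen W ∧ p ∈ W ∧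
      SmoothFamilyOn Φ W ∧ ∀ p ∈ W, p.2 ∈ X → f p.1 p.2 = Φ p.1 p.2) (c : SmoothSquare X) :
    SmoothFamilyOn (fun l t => f l (c.1 t)) (univ ×ˢ Icc (0 : ℝ × ℝ) 1) := by
  have hc : SmoothFamilyOn (fun (_ : Λ) t => (c.1 t : E)) (univ ×ˢ Icc (0 : ℝ × ℝ) 1) :=
    .of_contDiffOn c.2 uniqueDiffOn_square fun p hp => hp.2
  have hc2 : ContinuousOn (fun p : Λ × ℝ × ℝ => (p.1, (c.1 p.2 : E))) (univ ×ˢ Icc (0 : ℝ × ℝ) 1) :=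
    continuousOn_fst.prodMk hc.continuousOn
  refine SmoothFamilyOn.of_local (fun l => ?_) fun p hp => ?_
  · have : {x | (l, x) ∈ (univ : Set Λ) ×ˢ Icc (0 : ℝ × ℝ) 1} = Icc (0 : ℝ × ℝ) 1 := by ext; simp
    rw [this]
    exact uniqueDiffOn_square
  · obtain ⟨W, Φ, hW, hpW, hΦ, hfΦ⟩ := hf (p.1, c.1 p.2) (c.1 p.2).2
    obtain ⟨V, hV, hVW⟩ := continuousOn_iff'.1 hc2 W hW
    have hmem : ∀ q ∈ univ ×ˢ Icc (0 : ℝ × ℝ) 1 ∩ V, (q.1, (c.1 q.2 : E)) ∈ W := fun q hq =>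
      ((Set.ext_iff.1 hVW q).2 ⟨hq.2, hq.1⟩).1
    refine ⟨V, hV, ((Set.ext_iff.1 hVW p).1 ⟨hpW, hp⟩).1, ?_⟩
    exact (hΦ.comp (hc.mono inter_subset_left) hmem).congr fun q hq =>
      hfΦ _ (hmem q hq) (c.1 q.2).2

theorem isSmooth_of_smoothFamilyOn {F : Type} [NormedAddCommGroup F] [NormedSpace ℝ F]
    {Λ : Type} [TopologicalSpace Λ] {f : Λ → E → F}
    (hf : ∀ p : Λ × E, p.2 ∈ X → ∃ (W : Set (Λ × E)) (Φ : Λ → E → F), IsOpen W ∧ p ∈ W ∧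
      SmoothFamilyOn Φ W ∧ ∀ p ∈ W, p.2 ∈ X → f p.1 p.2 = Φ p.1 p.2) (l : Λ) :
    IsSmooth (fun x : X => f l x) := by
  intro x
  obtain ⟨W, Φ, hW, hpW, hΦ, hfΦ⟩ := hf (l, x) x.2
  have hW' : IsOpen {y | (l, y) ∈ W} := hW.preimage (Continuous.prodMk_right l)
  exact ⟨{y | (l, y) ∈ W}, hW'.mem_nhds hpW, Φ l, hΦ.contDiffOn fun y hy => hy,
    fun y hy => (hfΦ _ hy y.2).symm⟩

end CInftyTopology

/-! ### Radial homeomorphisms supported in a collar -/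

section RadialScale

/-- A function vanishing exactly on the unit circle. -/
noncomputable def defect (y : ℂ) : ℝ := 1 - ‖y‖ ^ 2

theorem defect_le_one (y : ℂ) : defect y ≤ 1 := by
  unfold defect
  linarith [sq_nonneg ‖y‖]

theorem defect_nonneg_iff {y : ℂ} : 0 ≤ defect y ↔ ‖y‖ ≤ 1 := by
  rw [defect, sub_nonneg, sq_le_one_iff₀ (norm_nonneg y)]

theorem defect_pos_iff {y : ℂ} : 0 < defect y ↔ ‖y‖ < 1 := by
  rw [defect, sub_pos, sq_lt_one_iff₀ (norm_nonneg y)]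

theorem defect_eq_zero_iff {y : ℂ} : defect y = 0 ↔ ‖y‖ = 1 := by
  rw [defect, sub_eq_zero, eq_comm, pow_eq_one_iff_of_nonneg (norm_nonneg y) two_ne_zero]

theorem contDiff_defect : ContDiff ℝ ∞ defect := contDiff_const.sub (contDiff_norm_sq ℝ)

/-- The radial map of the plane that changes the defect by `θ`. -/
noncomputable def radialScale (θ : ℝ → ℝ) (y : ℂ) : ℂ :=
  √((1 - θ (defect y)) / ‖y‖ ^ 2) • y

theorem radialScale_of_eq {θ : ℝ → ℝ} {y : ℂ} (h : θ (defect y) = defect y) :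
    radialScale θ y = y := by
  by_cases hy : y = 0
  · simp [radialScale, hy]
  · rw [radialScale, h, defect, sub_sub_cancel, div_self (by simpa using hy), Real.sqrt_one, one_smul]

theorem defect_radialScale {θ : ℝ → ℝ} {y : ℂ} (hy : y ≠ 0) (h : θ (defect y) ≤ 1) :
    defect (radialScale θ y) = θ (defect y) := by
  have h0 : ‖y‖ ^ 2 ≠ 0 := by simpa using hy
  rw [defect, radialScale, norm_smul, mul_pow, Real.norm_of_nonneg (Real.sqrt_nonneg _),
    Real.sq_sqrt (div_nonneg (sub_nonneg.2 h) (sq_nonneg _)), div_mul_cancel₀ _ h0, sub_sub_cancel]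

/-- The norm and the direction determine a point. -/
theorem eq_of_defect_eq {x y : ℂ} {c : ℝ} (hc : 0 ≤ c) (hxy : x = c • y)
    (h : defect x = defect y) : x = y := by
  have h1 : ‖x‖ = ‖y‖ := by
    have : ‖x‖ ^ 2 = ‖y‖ ^ 2 := by unfold defect at h; linarith
    exact (pow_left_inj₀ (norm_nonneg _) (norm_nonneg _) two_ne_zero).1 this
  by_cases hy : y = 0
  · rw [hxy, hy, smul_zero]
  · rw [hxy, norm_smul, Real.norm_of_nonneg hc] at h1
    rw [hxy, (mul_eq_right₀ (norm_ne_zero_iff.2 hy)).1 h1, one_smul]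

/-- The conditions on `θ` under which the radial map is a homeomorphism of the disc supported in the
collar `defect ≤ δ` of the boundary. -/
structure IsCollar (δ : ℝ) (θ : ℝ → ℝ) : Prop where
  pos : 0 < δ
  continuous : Continuous θ
  strictMonoOn : StrictMonoOn θ (Icc 0 1)
  map_zero : θ 0 = 0
  eq_of_le : ∀ u, δ ≤ u → θ u = u

variable {δ : ℝ} {θ : ℝ → ℝ}

theorem IsCollar.mem_Icc (hθ : IsCollar δ θ) (hδ1 : δ < 1) {u : ℝ} (hu : u ∈ Icc (0 : ℝ) 1) :
    θ u ∈ Icc (0 : ℝ) 1 := by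
  have h0 := hθ.strictMonoOn.monotoneOn (left_mem_Icc.2 zero_le_one) hu hu.1
  have h1 := hθ.strictMonoOn.monotoneOn hu (right_mem_Icc.2 zero_le_one) hu.2
  rw [hθ.map_zero] at h0
  rw [hθ.eq_of_le 1 hδ1.le] at h1
  exact ⟨h0, h1⟩

theorem IsCollar.defect_radialScale (hθ : IsCollar δ θ) (hδ1 : δ < 1) {y : ℂ} (hy : ‖y‖ ≤ 1) :
    defect (radialScale θ y) = θ (defect y) := by
  by_cases h0 : y = 0
  · have : defect y = 1 := by simp [defect, h0]
    rw [radialScale_of_eq] <;> rw [this, hθ.eq_of_le 1 hδ1.le]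
  · exact BranchedLift.defect_radialScale h0
      (hθ.mem_Icc hδ1 ⟨defect_nonneg_iff.2 hy, defect_le_one y⟩).2

theorem continuous_radialScale_family {Λ : Type*} [TopologicalSpace Λ] {θ : Λ → ℝ → ℝ}
    (hδ1 : δ < 1) (hθ : ∀ l, IsCollar δ (θ l)) (hc : Continuous fun p : Λ × ℝ => θ p.1 p.2) :
    Continuous fun p : Λ × ℂ => radialScale (θ p.1) p.2 := by
  have hd : Continuous defect := contDiff_defect.continuous
  rw [continuous_iff_continuousAt]
  rintro ⟨l, y⟩
  by_cases hy : y = 0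
  · have hopen : IsOpen {p : Λ × ℂ | δ < defect p.2} :=
      isOpen_lt continuous_const (hd.comp continuous_snd)
    have hmem : (l, y) ∈ {p : Λ × ℂ | δ < defect p.2} := by
      change δ < defect y
      rw [hy, defect, norm_zero]
      linarith
    refine continuous_snd.continuousAt.congr ?_
    filter_upwards [hopen.mem_nhds hmem] with p hp
    exact (radialScale_of_eq ((hθ p.1).eq_of_le _ (le_of_lt hp))).symm
  · have h1 : Continuous fun p : Λ × ℂ => θ p.1 (defect p.2) :=
      hc.comp (continuous_fst.prodMk (hd.comp continuous_snd))
    exact (ContinuousAt.sqrt ((continuous_const.sub h1).continuousAt.div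
      (by fun_prop) (by simpa using hy))).smul continuous_snd.continuousAt

/-- Monotonicity of `θ` recovers the defect, hence the norm. Then both points are scaled by the same
factor, which is positive unless the map fixes them anyway. -/
theorem IsCollar.injOn (hθ : IsCollar δ θ) (hδ1 : δ < 1) :
    InjOn (radialScale θ) {y | ‖y‖ ≤ 1} := by
  intro x hx y hy hxy
  have hd : defect x = defect y := by
    refine hθ.strictMonoOn.injOn ⟨defect_nonneg_iff.2 hx, defect_le_one x⟩
      ⟨defect_nonneg_iff.2 hy, defect_le_one y⟩ ?_
    rw [← hθ.defect_radialScale hδ1 hx, hxy, hθ.defect_radialScale hδ1 hy]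
  by_cases h1 : θ (defect x) = defect x
  · rwa [radialScale_of_eq h1, radialScale_of_eq (hd ▸ h1)] at hxy
  · have hn : ‖x‖ = ‖y‖ := by
      have : ‖x‖ ^ 2 = ‖y‖ ^ 2 := by unfold defect at hd; linarith
      exact (pow_left_inj₀ (norm_nonneg _) (norm_nonneg _) two_ne_zero).1 this
    have hx1 : defect x < 1 := by
      refine lt_of_le_of_ne (defect_le_one x) fun h => h1 ?_
      rw [h, hθ.eq_of_le 1 hδ1.le]
    have hx0 : 0 < ‖x‖ ^ 2 := by unfold defect at hx1; linarith
    have h2 : θ (defect x) < 1 := by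
      have := hθ.strictMonoOn ⟨defect_nonneg_iff.2 hx, defect_le_one x⟩
        (right_mem_Icc.2 zero_le_one) hx1
      rwa [hθ.eq_of_le 1 hδ1.le] at this
    rw [radialScale, radialScale, ← hd, ← hn] at hxy
    refine smul_right_injective ℂ (Real.sqrt_ne_zero'.2 (div_pos (sub_pos.2 h2) hx0)) hxy

theorem IsCollar.surjOn (hθ : IsCollar δ θ) (hδ1 : δ < 1) {x : ℂ} (hx : ‖x‖ ≤ 1) :
    ∃ y, ‖y‖ ≤ 1 ∧ radialScale θ y = x := by
  by_cases hx0 : x = 0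
  · exact ⟨0, by simp, by simp [radialScale, hx0]⟩
  obtain ⟨r, hr, hrx⟩ := intermediate_value_Icc zero_le_one hθ.continuous.continuousOn
    (show defect x ∈ Icc (θ 0) (θ 1) by
      rw [hθ.map_zero, hθ.eq_of_le 1 hδ1.le]
      exact ⟨defect_nonneg_iff.2 hx, defect_le_one x⟩)
  have h1 : defect (radialScale (fun _ => r) x) = r := BranchedLift.defect_radialScale hx0 hr.2
  have h2 : ‖radialScale (fun _ => r) x‖ ≤ 1 := by
    rw [← defect_nonneg_iff, h1]
    exact hr.1
  refine ⟨_, h2, eq_of_defect_eq (c := _) (mul_nonneg (Real.sqrt_nonneg _) (Real.sqrt_nonneg _))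
    (smul_smul _ _ _) ?_⟩
  rw [hθ.defect_radialScale hδ1 h2, h1, hrx]

instance : CompactSpace disc :=
  isCompact_iff_compactSpace.1 (by
    have : disc = Metric.closedBall 0 1 := by ext; simp [disc]
    rw [this]
    exact isCompact_closedBall 0 1)

variable {z : Finset ℂ}

/-- The radial bijection of the disc. -/
noncomputable def radialEquiv (hδ1 : δ < 1) (hθ : IsCollar δ θ) : disc ≃ disc :=
  Equiv.ofBijective (fun y : disc => (⟨radialScale θ y, by
      change ‖_‖ ≤ 1
      rw [← defect_nonneg_iff, hθ.defect_radialScale hδ1 y.2]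
      exact (hθ.mem_Icc hδ1 ⟨defect_nonneg_iff.2 y.2, defect_le_one _⟩).1⟩ : disc))
    ⟨fun x y hxy => Subtype.ext (hθ.injOn hδ1 x.2 y.2 (congrArg Subtype.val hxy)),
      fun x => by
        obtain ⟨y, hy, hyx⟩ := hθ.surjOn hδ1 x.2
        exact ⟨⟨y, hy⟩, Subtype.ext hyx⟩⟩

theorem continuous_radialEquiv (hδ1 : δ < 1) (hθ : IsCollar δ θ) :
    Continuous (radialEquiv hδ1 hθ) :=
  Continuous.subtype_mk ((continuous_radialScale_family (Λ := Unit) hδ1 (fun _ => hθ)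
    (hθ.continuous.comp continuous_snd)).comp
      (f := fun y : disc => ((), (y : ℂ))) (by fun_prop)) _

/-- The radial homeomorphism of the disc. -/
noncomputable def radialHomeo (hδ1 : δ < 1) (hz : ∀ a ∈ z, ‖a‖ + δ < 1) (hθ : IsCollar δ θ) :
    homeoDisc z where
  val :=
    { toEquiv := radialEquiv hδ1 hθ
      continuous_toFun := continuous_radialEquiv hδ1 hθ
      continuous_invFun := (continuous_radialEquiv hδ1 hθ).continuous_symm_of_equiv_compact_to_t2 }
  property := by
    refine ⟨fun x hx => Subtype.ext (radialScale_of_eq ?_), fun x => ?_⟩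
    · rw [defect_eq_zero_iff.2 hx, hθ.map_zero]
    · have hfix : ∀ a ∈ z, radialScale θ a = a := fun a ha => radialScale_of_eq <|
        hθ.eq_of_le _ (by
          have := hz a ha
          have := hθ.pos
          unfold defect
          nlinarith [norm_nonneg a])
      change radialScale θ x ∈ z ↔ (x : ℂ) ∈ z
      refine ⟨fun h => ?_, fun h => by rwa [hfix _ h]⟩
      have h1 : ‖radialScale θ x‖ ≤ 1 := by
        have := hz _ h
        have := hfix _ h
        rw [← defect_nonneg_iff, hθ.defect_radialScale hδ1 x.2]
        exact (hθ.mem_Icc hδ1 ⟨defect_nonneg_iff.2 x.2, defect_le_one _⟩).1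
      rw [← hθ.injOn hδ1 h1 x.2 (hfix _ h)]
      exact h

theorem radialHomeo_apply (hδ1 : δ < 1) (hz : ∀ a ∈ z, ‖a‖ + δ < 1) (hθ : IsCollar δ θ)
    (y : disc) : ((radialHomeo hδ1 hz hθ : disc ≃ₜ disc) y : ℂ) = radialScale θ y := rfl

/-- The straight line isotopy from the identity. -/
theorem IsCollar.lineMap (hθ : IsCollar δ θ) (t : I) :
    IsCollar δ (fun u => (1 - (t : ℝ)) * u + t * θ u) where
  pos := hθ.pos
  continuous := by
    have := hθ.continuous
    fun_prop
  strictMonoOn := by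
    intro u hu v hv huv
    have h1 := hθ.strictMonoOn hu hv huv
    have h2 := t.2.1
    have h3 := t.2.2
    rcases h2.lt_or_eq with h | h
    · have := mul_lt_mul_of_pos_left h1 h
      have := mul_le_mul_of_nonneg_left huv.le (sub_nonneg.2 h3)
      simp only
      linarith
    · simp only [← h]
      linarith
  map_zero := by simp [hθ.map_zero]
  eq_of_le u hu := by rw [hθ.eq_of_le u hu]; ring

/-- The lift of a radial homeomorphism is isotopic to the identity. -/
theorem liftHom_radialHomeo_mem (hz1 : ∀ a ∈ z, ‖a‖ < 1) (hδ1 : δ < 1)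
    (hz : ∀ a ∈ z, ‖a‖ + δ < 1) (hθ : IsCollar δ θ) :
    liftHom hz1 (extendHom z (radialHomeo hδ1 hz hθ)) ∈ isotopyOne (homeoSurface z) := by
  refine ⟨fun t => liftHom hz1 (extendHom z (radialHomeo hδ1 hz (hθ.lineMap t))), ?_, ?_, ?_⟩
  · refine continuous_liftHom_family hz1 (h := fun t => extendHom z (radialHomeo hδ1 hz (hθ.lineMap t)))
      (continuous_extendDisc_family
        (f := fun t => (radialHomeo hδ1 hz (hθ.lineMap t) : disc ≃ₜ disc)) (fun t => (radialHomeo hδ1 hz (hθ.lineMap t)).2.1) ?_)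
    refine Continuous.subtype_mk (f := fun p : I × disc => radialScale
      (fun u => (1 - (p.1 : ℝ)) * u + p.1 * θ u) p.2) ?_ _
    have hcont := hθ.continuous
    exact (continuous_radialScale_family (Λ := I)
      (θ := fun t u => (1 - (t : ℝ)) * u + t * θ u) hδ1 hθ.lineMap (by fun_prop)).comp
        (f := fun p : I × disc => (p.1, (p.2 : ℂ))) (by fun_prop)
  · have : radialHomeo hδ1 hz (hθ.lineMap 0) = 1 := Subtype.ext (Homeomorph.ext fun y =>
      Subtype.ext ((radialHomeo_apply _ _ _ y).trans (radialScale_of_eq (by simp))))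
    simp only [this, map_one]
  · refine congrArg (fun k => liftHom hz1 (extendHom z k)) ?_
    exact Subtype.ext (Homeomorph.ext fun y => Subtype.ext (by
      rw [radialHomeo_apply, radialHomeo_apply]
      simp))

end RadialScale

/-! ### The doubly exponential collar function -/

section CollarProfile

theorem expNegInvGlue_of_pos {x : ℝ} (hx : 0 < x) : expNegInvGlue x = Real.exp (-x⁻¹) := by
  simp [expNegInvGlue, hx.not_ge]

theorem expNegInvGlue_le_self {x : ℝ} (hx : 0 ≤ x) : expNegInvGlue x ≤ x := by
  rcases hx.eq_or_lt with rfl | hx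
  · simp
  · rw [expNegInvGlue_of_pos hx, Real.exp_neg]
    refine inv_le_of_inv_le₀ hx ?_
    have := Real.add_one_le_exp x⁻¹
    linarith

theorem hasDerivAt_expNegInvGlue {x : ℝ} (hx : 0 < x) :
    ∃ d, 0 < d ∧ HasDerivAt expNegInvGlue d x := by
  refine ⟨Real.exp (-x⁻¹) * -(-(x ^ 2)⁻¹), ?_, ?_⟩
  · rw [neg_neg]
    positivity
  · refine ((hasDerivAt_inv hx.ne').neg.exp).congr_of_eventuallyEq ?_
    filter_upwards [lt_mem_nhds hx] with y hy using expNegInvGlue_of_pos hy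

/-- A function that equals `u` for `u ≥ δ` and vanishes to a doubly exponential order at zero. -/
noncomputable def collar (δ u : ℝ) : ℝ :=
  Real.smoothTransition (2 / δ * u - 1) * u +
    (1 - Real.smoothTransition (2 / δ * u - 1)) * expNegInvGlue (expNegInvGlue u)

variable {δ u : ℝ}

theorem contDiff_collar (δ : ℝ) : ContDiff ℝ ∞ (collar δ) := by
  have h1 : ContDiff ℝ ∞ fun u : ℝ => Real.smoothTransition (2 / δ * u - 1) :=
    Real.smoothTransition.contDiff.comp ((contDiff_const.mul contDiff_id).sub contDiff_const)
  have h2 : ContDiff ℝ ∞ fun u : ℝ => expNegInvGlue (expNegInvGlue u) :=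
    expNegInvGlue.contDiff.comp expNegInvGlue.contDiff
  exact (h1.mul contDiff_id).add ((contDiff_const.sub h1).mul h2)

theorem collar_of_le (hδ : 0 < δ) (hu : δ ≤ u) : collar δ u = u := by
  have : Real.smoothTransition (2 / δ * u - 1) = 1 := by
    refine Real.smoothTransition.one_of_one_le ?_
    have : 2 ≤ 2 / δ * u := by
      rw [div_mul_eq_mul_div, le_div_iff₀ hδ]
      linarith
    linarith
  simp [collar, this]

theorem collar_of_le_half (hδ : 0 < δ) (hu : u ≤ δ / 2) :
    collar δ u = expNegInvGlue (expNegInvGlue u) := by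
  have : Real.smoothTransition (2 / δ * u - 1) = 0 := by
    refine Real.smoothTransition.zero_of_nonpos ?_
    have : 2 / δ * u ≤ 1 := by
      rw [div_mul_eq_mul_div, div_le_iff₀ hδ]
      linarith
    linarith
  simp [collar, this]

theorem collar_of_nonpos (hδ : 0 < δ) (hu : u ≤ 0) : collar δ u = 0 := by
  rw [collar_of_le_half hδ (by linarith), expNegInvGlue.zero_of_nonpos hu, expNegInvGlue.zero]

theorem collar_pos (hu : 0 < u) : 0 < collar δ u := by
  have h1 := Real.smoothTransition.nonneg (2 / δ * u - 1)
  have h2 := Real.smoothTransition.le_one (2 / δ * u - 1)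
  have h3 : 0 < expNegInvGlue (expNegInvGlue u) :=
    expNegInvGlue.pos_of_pos (expNegInvGlue.pos_of_pos hu)
  rw [collar]
  rcases h1.eq_or_lt with h | h
  · rw [← h]; linarith
  · have := mul_pos h hu
    have := mul_nonneg (sub_nonneg.2 h2) h3.le
    linarith

theorem hasDerivAt_collar (hδ : 0 < δ) (hu : 0 < u) : ∃ d, 0 < d ∧ HasDerivAt (collar δ) d u := by
  set y := 2 / δ * u - 1 with hy
  have hst : HasDerivAt Real.smoothTransition (deriv Real.smoothTransition y) y :=
    ((Real.smoothTransition.contDiff (n := 1)).differentiable (by simp) y).hasDerivAt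
  have hd0 : 0 ≤ deriv Real.smoothTransition y := monotone_smoothTransition.deriv_nonneg
  have hin : HasDerivAt (fun u : ℝ => 2 / δ * u - 1) (2 / δ) u := by
    simpa using ((hasDerivAt_id u).const_mul (2 / δ)).sub_const 1
  have hc := hst.comp u hin
  obtain ⟨d₁, hd₁, h₁⟩ := hasDerivAt_expNegInvGlue hu
  obtain ⟨d₂, hd₂, h₂⟩ := hasDerivAt_expNegInvGlue (expNegInvGlue.pos_of_pos hu)
  refine ⟨_, ?_, (hc.mul (hasDerivAt_id u)).add ((hc.const_sub 1).mul (h₂.comp u h₁))⟩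
  have h1 := Real.smoothTransition.nonneg y
  have h2 := Real.smoothTransition.le_one y
  have h3 : expNegInvGlue (expNegInvGlue u) ≤ u :=
    (expNegInvGlue_le_self (expNegInvGlue.nonneg u)).trans (expNegInvGlue_le_self hu.le)
  simp only [Function.comp_apply, ← hy, id]
  -- The cutoff increases from the smaller function `e(e(u))` to the larger function `u`, so its
  -- derivative contributes with the right sign.
  have t1 : 0 ≤ deriv Real.smoothTransition y * (2 / δ) * (u - expNegInvGlue (expNegInvGlue u)) :=
    mul_nonneg (by positivity) (sub_nonneg.2 h3)
  have t3 : 0 < Real.smoothTransition y + (1 - Real.smoothTransition y) * (d₂ * d₁) := by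
    rcases h1.eq_or_lt with h | h
    · rw [← h]; simpa using mul_pos hd₂ hd₁
    · have := mul_nonneg (sub_nonneg.2 h2) (mul_pos hd₂ hd₁).le
      linarith
  linarith

theorem isCollar_collar (hδ : 0 < δ) : IsCollar δ (collar δ) where
  pos := hδ
  continuous := (contDiff_collar δ).continuous
  strictMonoOn := by
    refine strictMonoOn_of_deriv_pos (convex_Icc 0 1) (contDiff_collar δ).continuous.continuousOn
      fun u hu => ?_
    rw [interior_Icc] at hu
    obtain ⟨d, hd, h⟩ := hasDerivAt_collar hδ hu.1
    rwa [h.deriv]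
  map_zero := collar_of_nonpos hδ le_rfl
  eq_of_le _ hu := collar_of_le hδ hu

/-- The function `collar` in the logarithmic coordinate. -/
noncomputable def logCollar (δ p : ℝ) : ℝ := Real.log (collar δ (Real.exp p))

theorem contDiff_logCollar : ContDiff ℝ ∞ (logCollar δ) :=
  ((contDiff_collar δ).comp Real.contDiff_exp).log fun _ => (collar_pos (Real.exp_pos _)).ne'

theorem hasDerivAt_logCollar (hδ : 0 < δ) (p : ℝ) : ∃ d, 0 < d ∧ HasDerivAt (logCollar δ) d p := by
  obtain ⟨d, hd, h⟩ := hasDerivAt_collar hδ (Real.exp_pos p)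
  have hp := collar_pos (δ := δ) (Real.exp_pos p)
  exact ⟨_, div_pos (mul_pos hd (Real.exp_pos p)) hp, (h.comp p (Real.hasDerivAt_exp p)).log hp.ne'⟩

theorem strictMono_logCollar (hδ : 0 < δ) : StrictMono (logCollar δ) := by
  refine strictMono_of_deriv_pos fun p => ?_
  obtain ⟨d, hd, h⟩ := hasDerivAt_logCollar hδ p
  rwa [h.deriv]

theorem surjective_logCollar (hδ : 0 < δ) : Function.Surjective (logCollar δ) := by
  refine contDiff_logCollar.continuous.surjective ?_ ?_
  · refine Filter.tendsto_id.congr' ?_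
    have : ∀ᶠ p in Filter.atTop, δ ≤ Real.exp p := Real.tendsto_exp_atTop.eventually_ge_atTop δ
    filter_upwards [this] with p hp
    rw [logCollar, collar_of_le hδ hp, Real.log_exp, id]
  · refine Real.tendsto_log_nhdsGT_zero.comp (tendsto_nhdsWithin_iff.2 ⟨?_, ?_⟩)
    · have := ((contDiff_collar δ).continuous.tendsto 0).comp Real.tendsto_exp_atBot
      rwa [collar_of_nonpos hδ le_rfl] at this
    · exact Filter.Eventually.of_forall fun p => collar_pos (Real.exp_pos p)

noncomputable def logCollarHomeo (hδ : 0 < δ) : ℝ ≃ₜ ℝ :=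
  ((strictMono_logCollar hδ).orderIsoOfSurjective _ (surjective_logCollar hδ)).toHomeomorph

/-- The inverse of `collar` on the positive half-line. -/
noncomputable def collarInv (hδ : 0 < δ) (r : ℝ) : ℝ :=
  Real.exp ((logCollarHomeo hδ).symm (Real.log r))

theorem contDiffOn_collarInv (hδ : 0 < δ) : ContDiffOn ℝ ∞ (collarInv hδ) (Ioi 0) := by
  choose d hd hder using hasDerivAt_logCollar hδ
  have h1 : ContDiff ℝ ∞ (logCollarHomeo hδ).symm :=
    (logCollarHomeo hδ).contDiff_symm_deriv (f' := d) (fun p => (hd p).ne') hder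
      contDiff_logCollar
  exact (Real.contDiff_exp.comp h1).comp_contDiffOn
    (Real.contDiffOn_log.mono fun _ (hx : 0 < _) => hx.ne')

theorem collar_collarInv (hδ : 0 < δ) {r : ℝ} (hr : 0 < r) : collar δ (collarInv hδ r) = r := by
  have h1 : logCollar δ ((logCollarHomeo hδ).symm (Real.log r)) = Real.log r :=
    (logCollarHomeo hδ).apply_symm_apply _
  exact Real.log_injOn_pos (collar_pos (Real.exp_pos _)) hr h1

theorem collarInv_collar (hδ : 0 < δ) (hu : 0 < u) : collarInv hδ (collar δ u) = u := by
  have h1 : logCollar δ (Real.log u) = Real.log (collar δ u) := by rw [logCollar, Real.exp_log hu]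
  have h2 : (logCollarHomeo hδ).symm (logCollar δ (Real.log u)) = Real.log u :=
    (logCollarHomeo hδ).symm_apply_apply _
  rw [collarInv, ← h1, h2, Real.exp_log hu]

theorem collarInv_pos (hδ : 0 < δ) (r : ℝ) : 0 < collarInv hδ r := Real.exp_pos _

theorem collarInv_of_le (hδ : 0 < δ) {r : ℝ} (hr : δ ≤ r) : collarInv hδ r = r := by
  have := collarInv_collar hδ (u := r) (by linarith)
  rwa [collar_of_le hδ hr] at this

/-- The effect near zero of multiplication by `B` in the coordinate given by the collar. -/
theorem collarInv_mul (hδ : 0 < δ) (hu : 0 < u) (huδ : u ≤ δ / 2) {B : ℝ} (hB : 0 < B)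
    (hL : 0 < 1 - expNegInvGlue u * Real.log B)
    (hD : 0 < 1 + u * Real.log (1 - expNegInvGlue u * Real.log B))
    (hD' : u / (1 + u * Real.log (1 - expNegInvGlue u * Real.log B)) ≤ δ / 2) :
    collarInv hδ (collar δ u * B) =
      u / (1 + u * Real.log (1 - expNegInvGlue u * Real.log B)) := by
  set L := 1 - expNegInvGlue u * Real.log B with hLdef
  set D := 1 + u * Real.log L with hDdef
  have he := expNegInvGlue.pos_of_pos hu
  -- Inverting `exp(-1/·)` once turns multiplication by `B` into adding `-log B` to the reciprocal
  -- of `e(u)`, that is, division of `e(u)` by `L`. Inverting again turns this into division of `u`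
  -- by `D`.
  have h1 : expNegInvGlue (u / D) = expNegInvGlue u / L := by
    rw [expNegInvGlue_of_pos (div_pos hu hD), expNegInvGlue_of_pos hu, inv_div, hDdef,
      show -((1 + u * Real.log L) / u) = -u⁻¹ - Real.log L by field_simp; ring, Real.exp_sub,
      Real.exp_log hL]
  have h2 : expNegInvGlue (expNegInvGlue u / L) = expNegInvGlue (expNegInvGlue u) * B := by
    rw [expNegInvGlue_of_pos (div_pos he hL), expNegInvGlue_of_pos he, inv_div, hLdef,
      show -((1 - expNegInvGlue u * Real.log B) / expNegInvGlue u) =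
        -(expNegInvGlue u)⁻¹ + Real.log B by field_simp; ring, Real.exp_add, Real.exp_log hB]
  rw [← collarInv_collar hδ (div_pos hu hD), collar_of_le_half hδ hD', h1, h2,
    collar_of_le_half hδ huδ]

end CollarProfile

/-! ### Division by a boundary coordinate -/

section Hadamard

variable {Λ : Type} [TopologicalSpace Λ] {E F : Type} [NormedAddCommGroup E] [NormedSpace ℝ E]
  [NormedAddCommGroup F] [NormedSpace ℝ F]

theorem SmoothFamilyOn.fderivWithin {f : Λ → E → F} {Q : Set E} (hQ : UniqueDiffOn ℝ Q)
    (hf : SmoothFamilyOn f (univ ×ˢ Q)) :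
    SmoothFamilyOn (fun l x => fderivWithin ℝ (f l) Q x) (univ ×ˢ Q) := by
  intro k
  obtain ⟨-, f', hd, h'⟩ := hf (k + 1)
  refine h'.congr fun p hp => ?_
  have := hd p hp
  simp only [mem_prod, mem_univ, true_and, ofPred_mem_eq] at this
  exact this.fderivWithin (hQ p.2 hp.2)

/-- A smooth family of functions on the square that vanish on one side is divisible by the
distance to that side. -/
theorem exists_smooth_quotient {f : Λ → ℝ × ℝ → ℝ}
    (hf : SmoothFamilyOn f (univ ×ˢ Icc (0 : ℝ × ℝ) 1))
    (h0 : ∀ l, ∀ t ∈ Icc (0 : ℝ) 1, f l (0, t) = 0) :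
    ∃ b : Λ → ℝ × ℝ → ℝ, SmoothFamilyOn b (univ ×ˢ Icc (0 : ℝ × ℝ) 1) ∧
      ∀ l, ∀ x ∈ Icc (0 : ℝ × ℝ) 1, f l x = x.1 * b l x := by
  set Q := Icc (0 : ℝ × ℝ) 1 with hQ
  have hQmem : ∀ x : ℝ × ℝ, x ∈ Q ↔ x.1 ∈ Icc (0 : ℝ) 1 ∧ x.2 ∈ Icc (0 : ℝ) 1 := fun x => by
    rw [hQ, Icc_prod_eq]; exact Iff.rfl
  have hd := hf.fderivWithin uniqueDiffOn_square
  have hconv : Convex ℝ Q := convex_Icc _ _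
  have h1 : SmoothFamilyOn (fun (p : Λ × I) (x : ℝ × ℝ) =>
      _root_.fderivWithin ℝ (f p.1) Q ((p.2 : ℝ) * x.1, x.2)) (univ ×ˢ Q) := by
    refine SmoothFamilyOn.comp (T := univ ×ˢ Q)
      (SmoothFamilyOn.reparam (φ := Prod.fst) continuous_fst (S' := univ ×ˢ Q) hd fun p hp =>
        ⟨mem_univ _, hp.2⟩)
      (SmoothFamilyOn.prodMk (SmoothFamilyOn.mul (.const (by fun_prop)) SmoothFamilyOn.id.fst)
        SmoothFamilyOn.id.snd) ?_
    rintro p ⟨-, hp⟩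
    rw [hQmem] at hp
    exact ⟨mem_univ _, (hQmem _).2 ⟨⟨mul_nonneg p.1.2.2.1 hp.1.1,
      mul_le_one₀ p.1.2.2.2 hp.1.1 hp.1.2⟩, hp.2⟩⟩
  -- The quotient is the mean of the first partial derivative on the segment from `(0, x.2)` to `x`.
  refine ⟨fun l x => (∫ t : I, _root_.fderivWithin ℝ (f l) Q ((t : ℝ) * x.1, x.2)) (1, 0), ?_, ?_⟩
  · have h2 : SmoothFamilyOn (fun l x => ∫ t : I, _root_.fderivWithin ℝ (f l) Q ((t : ℝ) * x.1, x.2))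
        (univ ×ˢ Q) := fun k => ParamContDiffOn.integral hconv (h1 k)
    exact SmoothFamilyOn.bilinear (ContinuousLinearMap.id ℝ ((ℝ × ℝ) →L[ℝ] ℝ)) h2 (.const' (1, 0))
  · intro l x hx
    have hx' := (hQmem x).1 hx
    have ha : (0, x.2) ∈ Q := (hQmem _).2 ⟨⟨le_rfl, zero_le_one⟩, hx'.2⟩
    have hfl : ContDiffOn ℝ ∞ (f l) Q := hf.contDiffOn fun y hy => ⟨mem_univ _, hy⟩
    have h3 := integral_segment_deriv (f := f l) (f' := _root_.fderivWithin ℝ (f l) Q) hconv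
      (fun y hy => ((hfl.differentiableOn (by simp)) y hy).hasFDerivWithinAt)
      (hfl.continuousOn_fderivWithin uniqueDiffOn_square (by simp)) ha hx
    rw [h0 l _ hx'.2, sub_zero] at h3
    rw [← h3]
    have h4 : x - (0, x.2) = x.1 • ((1 : ℝ), (0 : ℝ)) := by ext <;> simp
    rw [h4, map_smul, smul_eq_mul]
    congr 2
    refine MeasureTheory.integral_congr_ae (Filter.Eventually.of_forall fun t => ?_)
    simp only
    congr 1
    ext <;> simp

end Hadamard

/-! ### Evaluation of disc diffeomorphisms as a smooth family -/

section DiscFamilies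

variable {z : Finset ℂ}

theorem smoothFamilyOn_extendDisc {φ : ℝ × ℝ → ℂ} (hφ : ContDiffOn ℝ ∞ φ (Icc (0 : ℝ × ℝ) 1))
    (hmem : ∀ t ∈ Icc (0 : ℝ × ℝ) 1, ‖φ t‖ ≤ 1) :
    SmoothFamilyOn (fun (f : DiffDisc z) t => extendDisc (f : disc ≃ₜ disc) (φ t))
      (univ ×ˢ Icc (0 : ℝ × ℝ) 1) := by
  classical
  -- The default value `0` occurs only off the square, where it is never used.
  let c : ℝ × ℝ → disc := fun t => if h : ‖φ t‖ ≤ 1 then ⟨φ t, h⟩ else ⟨0, by simp [disc]⟩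
  have hc : ∀ t ∈ Icc (0 : ℝ × ℝ) 1, (c t : ℂ) = φ t := fun t ht => by
    simp only [c, dif_pos (hmem t ht)]
  refine (smoothFamilyOn_square ⟨c, hφ.congr hc⟩).congr fun p hp => ?_
  rw [extendDisc_of_mem (show φ p.2 ∈ disc from hmem p.2 hp.2)]
  congr 2
  exact Subtype.ext (hc p.2 hp.2).symm

theorem mem_square_iff {x : ℝ × ℝ} :
    x ∈ Icc (0 : ℝ × ℝ) 1 ↔ x.1 ∈ Icc (0 : ℝ) 1 ∧ x.2 ∈ Icc (0 : ℝ) 1 := by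
  rw [Icc_prod_eq]; exact Iff.rfl

theorem contDiff_mk_complex : ContDiff ℝ ∞ fun t : ℝ × ℝ => (⟨t.1, t.2⟩ : ℂ) :=
  Complex.equivRealProdCLM.symm.contDiff

/-- The `C^∞` topology only speaks about squares, so each interior point gets an affine square
inside the disc; composing with the inverse chart gives the family in the coordinate `x`. -/
theorem smoothFamilyOn_extendDisc_ball :
    SmoothFamilyOn (fun (f : DiffDisc z) x => extendDisc (f : disc ≃ₜ disc) x)
      (univ ×ˢ Metric.ball (0 : ℂ) 1) := by
  refine SmoothFamilyOn.of_local_isOpen (isOpen_univ.prod Metric.isOpen_ball) fun p hp => ?_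
  set x₀ := p.2 with hx₀
  have hx₀1 : ‖x₀‖ < 1 := by simpa using hp.2
  set r := 1 - ‖x₀‖ with hr
  have hr0 : 0 < r := by linarith
  set φ : ℝ × ℝ → ℂ := fun t => x₀ + r • (⟨t.1 - 1 / 2, t.2 - 1 / 2⟩ : ℂ) with hφ
  have hφs : ContDiff ℝ ∞ φ := by
    have : ContDiff ℝ ∞ fun t : ℝ × ℝ => (t.1 - 1 / 2, t.2 - 1 / 2) := by fun_prop
    exact contDiff_const.add ((contDiff_mk_complex.comp this).const_smul r)
  have hmem : ∀ t ∈ Icc (0 : ℝ × ℝ) 1, ‖φ t‖ ≤ 1 := by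
    intro t ht
    obtain ⟨⟨h1, h2⟩, h3, h4⟩ := mem_square_iff.1 ht
    have h5 := Complex.norm_le_abs_re_add_abs_im (⟨t.1 - 1 / 2, t.2 - 1 / 2⟩ : ℂ)
    have h6 : |t.1 - 1 / 2| ≤ 1 / 2 := abs_le.2 ⟨by linarith, by linarith⟩
    have h7 : |t.2 - 1 / 2| ≤ 1 / 2 := abs_le.2 ⟨by linarith, by linarith⟩
    have h8 := norm_add_le x₀ (r • (⟨t.1 - 1 / 2, t.2 - 1 / 2⟩ : ℂ))
    rw [norm_smul, Real.norm_of_nonneg hr0.le] at h8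
    have h9 : ‖(⟨t.1 - 1 / 2, t.2 - 1 / 2⟩ : ℂ)‖ ≤ 1 := by
      refine h5.trans ?_
      simp only
      linarith
    have := mul_le_mul_of_nonneg_left h9 hr0.le
    simp only [hφ]
    linarith
  set ψ : ℂ → ℝ × ℝ := fun x => (1 / 2 + (x - x₀).re / r, 1 / 2 + (x - x₀).im / r) with hψ
  have hψs : ContDiff ℝ ∞ ψ := by
    have h1 : ContDiff ℝ ∞ fun x : ℂ => (x - x₀).re :=
      Complex.reCLM.contDiff.comp (contDiff_id.sub contDiff_const)
    have h2 : ContDiff ℝ ∞ fun x : ℂ => (x - x₀).im :=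
      Complex.imCLM.contDiff.comp (contDiff_id.sub contDiff_const)
    exact (contDiff_const.add (h1.div_const r)).prodMk (contDiff_const.add (h2.div_const r))
  have hφψ : ∀ x, φ (ψ x) = x := by
    intro x
    refine Complex.ext ?_ ?_ <;> simp [hφ, hψ] <;> field_simp <;> ring
  have hψmem : ∀ x ∈ Metric.ball x₀ (r / 2), ψ x ∈ Icc (0 : ℝ × ℝ) 1 := by
    intro x hx
    rw [Metric.mem_ball, dist_eq_norm] at hx
    have h1 := abs_le.1 ((Complex.abs_re_le_norm (x - x₀)).trans hx.le)
    have h2 := abs_le.1 ((Complex.abs_im_le_norm (x - x₀)).trans hx.le)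
    have key : ∀ v : ℝ, -(r / 2) ≤ v → v ≤ r / 2 → 1 / 2 + v / r ∈ Icc (0 : ℝ) 1 := by
      intro v hv1 hv2
      have h3 : v / r ≤ 1 / 2 := by rw [div_le_iff₀ hr0]; linarith
      have h4 : -(1 / 2) ≤ v / r := by rw [le_div_iff₀ hr0]; linarith
      exact ⟨by linarith, by linarith⟩
    exact mem_square_iff.2 ⟨key _ h1.1 h1.2, key _ h2.1 h2.2⟩
  refine ⟨univ ×ˢ Metric.ball x₀ (r / 2), isOpen_univ.prod Metric.isOpen_ball,
    ⟨mem_univ _, Metric.mem_ball_self (half_pos hr0)⟩, ?_⟩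
  refine ((smoothFamilyOn_extendDisc hφs.contDiffOn hmem).comp (.of_contDiff hψs) fun q hq =>
    ⟨mem_univ _, hψmem q.2 hq.2.2⟩).congr fun q _ => ?_
  rw [hφψ]

end DiscFamilies

/-! ### The defect under a diffeomorphism near the boundary -/

section PolarSquare

variable {z : Finset ℂ}

/-- The parametrization of a neighbourhood of the point `y₀` of the unit circle in the disc by a
square, the first coordinate being twice the defect. -/
noncomputable def polarSquare (y₀ : ℂ) (t : ℝ × ℝ) : ℂ :=
  √(1 - t.1 / 2) * Complex.exp (((t.2 - 1 / 2 : ℝ) : ℂ) * Complex.I) * y₀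

variable {y₀ : ℂ}

theorem norm_polarSquare (hy₀ : ‖y₀‖ = 1) (t : ℝ × ℝ) : ‖polarSquare y₀ t‖ = √(1 - t.1 / 2) := by
  rw [polarSquare, norm_mul, norm_mul, Complex.norm_exp_ofReal_mul_I, hy₀, Complex.norm_real,
    Real.norm_of_nonneg (Real.sqrt_nonneg _), mul_one, mul_one]

theorem defect_polarSquare (hy₀ : ‖y₀‖ = 1) {t : ℝ × ℝ} (ht : t.1 ≤ 2) :
    defect (polarSquare y₀ t) = t.1 / 2 := by
  rw [defect, norm_polarSquare hy₀, Real.sq_sqrt (by linarith), sub_sub_cancel]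

theorem contDiffOn_polarSquare (y₀ : ℂ) : ContDiffOn ℝ ∞ (polarSquare y₀) {t | t.1 < 2} := by
  have h1 : ContDiffOn ℝ ∞ (fun t : ℝ × ℝ => √(1 - t.1 / 2)) {t | t.1 < 2} := by
    refine ContDiffOn.sqrt (by fun_prop) fun t ht => ?_
    have : t.1 < 2 := ht
    linarith
  have h2 : ContDiff ℝ ∞ (fun t : ℝ × ℝ => Complex.exp (((t.2 - 1 / 2 : ℝ) : ℂ) * Complex.I)) := by
    have : ContDiff ℝ ∞ fun t : ℝ × ℝ => ((t.2 - 1 / 2 : ℝ) : ℂ) :=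
      Complex.ofRealCLM.contDiff.comp (contDiff_snd.sub contDiff_const)
    exact Complex.contDiff_exp.comp (this.mul contDiff_const)
  exact ((Complex.ofRealCLM.contDiff.comp_contDiffOn h1).mul h2.contDiffOn).mul contDiffOn_const

theorem polarSquare_zero (y₀ : ℂ) : polarSquare y₀ (0, 1 / 2) = y₀ := by
  simp [polarSquare]

/-- A diffeomorphism changes the defect by a factor that does not vanish on the boundary. -/
theorem exists_defect_factor {Λ : Type} [TopologicalSpace Λ] {f : Λ → DiffDisc z}
    (hf : Continuous f) (hy₀ : ‖y₀‖ = 1) :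
    ∃ b : Λ → ℝ × ℝ → ℝ, SmoothFamilyOn b (univ ×ˢ Icc (0 : ℝ × ℝ) 1) ∧
      (∀ l, ∀ t ∈ Icc (0 : ℝ × ℝ) 1,
        defect (extendDisc (f l : disc ≃ₜ disc) (polarSquare y₀ t)) = t.1 * b l t) ∧
      ∀ l, 0 < b l (0, 1 / 2) := by
  have hmem1 : ∀ t ∈ Icc (0 : ℝ × ℝ) 1, ‖polarSquare y₀ t‖ ≤ 1 := by
    intro t ht
    have := (mem_square_iff.1 ht).1
    rw [← defect_nonneg_iff, defect_polarSquare hy₀ (by linarith [this.2])]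
    linarith [this.1]
  have hsub : Icc (0 : ℝ × ℝ) 1 ⊆ {t | t.1 < 2} := fun t ht => by
    have := (mem_square_iff.1 ht).1.2
    change t.1 < 2
    linarith
  have hg' : SmoothFamilyOn (fun l t => extendDisc (f l : disc ≃ₜ disc) (polarSquare y₀ t))
      (univ ×ˢ Icc (0 : ℝ × ℝ) 1) :=
    SmoothFamilyOn.reparam hf (smoothFamilyOn_extendDisc
      ((contDiffOn_polarSquare y₀).mono hsub) hmem1) fun p hp => ⟨mem_univ _, hp.2⟩
  obtain ⟨b, hb, hbf⟩ := exists_smooth_quotient (SmoothFamilyOn.contDiff_comp contDiff_defect hg')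
    fun l t ht => by
      have h1 : ‖polarSquare y₀ (0, t)‖ = 1 := by rw [norm_polarSquare hy₀]; simp
      rw [extendDisc_of_le (f l).2.2.1 h1.ge, defect_eq_zero_iff.2 h1]
  refine ⟨b, hb, hbf, fun l => ?_⟩
  set F := (f l : disc ≃ₜ disc) with hF
  have hy₀d : y₀ ∈ disc := hy₀.le
  obtain ⟨U, hU, g, hg, hgU⟩ := (f l).2.1.2 ⟨y₀, hy₀d⟩
  obtain ⟨K, V, hV, hK⟩ := ((hg.contDiffAt hU).of_le (by simp : (1 : WithTop ℕ∞) ≤ ∞)).exists_lipschitzOnWith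
  set x : ℝ → ℂ := fun s => extendDisc F (polarSquare y₀ (s, 1 / 2)) with hx
  have hhalf : (1 / 2 : ℝ) ∈ Icc (0 : ℝ) 1 := by norm_num
  have hcurve : ContinuousOn (fun s : ℝ => (s, (1 / 2 : ℝ))) (Icc 0 1) := by fun_prop
  have hmaps : MapsTo (fun s : ℝ => (s, (1 / 2 : ℝ))) (Icc 0 1) (Icc (0 : ℝ × ℝ) 1) :=
    fun s hs => mem_square_iff.2 ⟨hs, hhalf⟩
  have hxc : ContinuousOn x (Icc 0 1) :=
    (hg'.contDiffOn (l := l) fun t ht => ⟨mem_univ l, ht⟩).continuousOn.comp hcurve hmaps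
  have hbc : ContinuousOn (fun s => b l (s, 1 / 2)) (Icc 0 1) :=
    (hb.contDiffOn (l := l) fun t ht => ⟨mem_univ l, ht⟩).continuousOn.comp hcurve hmaps
  have hx0 : x 0 = y₀ := by
    simp only [hx, polarSquare_zero]
    exact extendDisc_of_le (f l).2.2.1 hy₀.ge
  have hI : Ioc (0 : ℝ) 1 ∈ 𝓝[>] 0 := Ioc_mem_nhdsGT one_pos
  have hle : 𝓝[>] (0 : ℝ) ≤ 𝓝[Icc 0 1] 0 :=
    nhdsWithin_le_of_mem (Filter.mem_of_superset hI Ioc_subset_Icc_self)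
  have hxt : Filter.Tendsto x (𝓝[>] 0) (𝓝 y₀) := by
    have := hxc 0 (left_mem_Icc.2 zero_le_one)
    rw [ContinuousWithinAt, hx0] at this
    exact this.mono_left hle
  have hxnt : Filter.Tendsto (fun s => (‖x s‖⁻¹ : ℝ) • x s) (𝓝[>] 0) (𝓝 y₀) := by
    have h1 := (hxt.norm.inv₀ (by rw [hy₀]; norm_num)).smul hxt
    rwa [hy₀, inv_one, one_smul] at h1
  have hbt : Filter.Tendsto (fun s => b l (s, 1 / 2)) (𝓝[>] 0) (𝓝 (b l (0, 1 / 2))) :=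
    (hbc 0 (left_mem_Icc.2 zero_le_one)).tendsto.mono_left hle
  have hxnorm : Filter.Tendsto (fun s => ‖x s‖) (𝓝[>] 0) (𝓝 1) := by
    have := hxt.norm
    rwa [hy₀] at this
  -- Let `p` be the polar point and `x = f p`. The Lipschitz extension `g` of `f⁻¹` sends `x` to `p`
  -- and fixes `x/‖x‖`, so `s/4 ≤ 1 - ‖p‖ ≤ K (1 - ‖x‖) ≤ K s b`. In the limit `b` is bounded away
  -- from `0`.
  have key : ∀ᶠ s in 𝓝[>] (0 : ℝ), 1 ≤ 4 * (K : ℝ) * b l (s, 1 / 2) := by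
    filter_upwards [hI, hxt (Filter.inter_mem hU hV), hxnt (Filter.inter_mem hU hV),
      hxnorm.eventually_const_lt (zero_lt_one)] with s hs h1 h2 hpos
    have hsQ : (s, (1 / 2 : ℝ)) ∈ Icc (0 : ℝ × ℝ) 1 := hmaps ⟨hs.1.le, hs.2⟩
    have hcd : polarSquare y₀ (s, 1 / 2) ∈ disc := hmem1 _ hsQ
    have hxs : x s = F ⟨_, hcd⟩ := extendDisc_of_mem hcd
    have hxs1 : ‖x s‖ ≤ 1 := by rw [hxs]; exact (F ⟨_, hcd⟩).2
    have hn1 : ‖(‖x s‖⁻¹ : ℝ) • x s‖ = 1 := by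
      rw [norm_smul, norm_inv, norm_norm, inv_mul_cancel₀ hpos.ne']
    have e1 : g (x s) = polarSquare y₀ (s, 1 / 2) := by
      have h3 := hgU (F ⟨_, hcd⟩) (by rw [← hxs]; exact h1.1)
      rw [← hxs] at h3
      rw [h3]
      exact congrArg Subtype.val (F.symm_apply_apply ⟨_, hcd⟩)
    have e2 : g ((‖x s‖⁻¹ : ℝ) • x s) = (‖x s‖⁻¹ : ℝ) • x s := by
      have h3 := hgU ⟨(‖x s‖⁻¹ : ℝ) • x s, hn1.le⟩ h2.1
      rw [h3]
      exact congrArg Subtype.val (((homeoDisc z).inv_mem (f l).2.2).1 _ hn1)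
    have h4 := hK.dist_le_mul _ h2.2 _ h1.2
    rw [dist_eq_norm, dist_eq_norm, e1, e2] at h4
    have h5 : ‖(‖x s‖⁻¹ : ℝ) • x s - x s‖ = 1 - ‖x s‖ := by
      have : (‖x s‖⁻¹ : ℝ) • x s - x s = (‖x s‖⁻¹ - 1) • x s := by rw [sub_smul, one_smul]
      rw [this, norm_smul, Real.norm_of_nonneg, sub_mul, inv_mul_cancel₀ hpos.ne', one_mul]
      exact sub_nonneg.2 ((one_le_inv₀ hpos).2 hxs1)
    have h6 := norm_sub_norm_le ((‖x s‖⁻¹ : ℝ) • x s) (polarSquare y₀ (s, 1 / 2))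
    rw [hn1] at h6
    rw [h5] at h4
    have h7 := defect_polarSquare hy₀ (t := (s, 1 / 2)) (by simp only; linarith [hs.2])
    have h8 := hbf l (s, 1 / 2) hsQ
    simp only at h7 h8
    have h9 : s / 2 ≤ 2 * (1 - ‖polarSquare y₀ (s, 1 / 2)‖) := by
      rw [← h7, defect]
      nlinarith [sq_nonneg (1 - ‖polarSquare y₀ (s, 1 / 2)‖)]
    have h10 : 1 - ‖x s‖ ≤ s * b l (s, 1 / 2) := by
      rw [← h8, defect]
      change 1 - ‖x s‖ ≤ 1 - ‖x s‖ ^ 2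
      nlinarith [norm_nonneg (x s)]
    have h11 : s * 1 ≤ s * (4 * (K : ℝ) * b l (s, 1 / 2)) := by
      have : (K : ℝ) * (1 - ‖x s‖) ≤ K * (s * b l (s, 1 / 2)) :=
        mul_le_mul_of_nonneg_left h10 K.2
      nlinarith
    exact le_of_mul_le_mul_left h11 hs.1
  have hlim := ge_of_tendsto (hbt.const_mul (4 * (K : ℝ))) key
  by_contra hcon
  have := mul_nonneg (mul_nonneg (by norm_num : (0 : ℝ) ≤ 4) K.coe_nonneg) (neg_nonneg.2 (not_lt.1 hcon))
  linarith

end PolarSquare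

/-! ### Conjugation by the collar homeomorphism -/

section Flatten

variable {z : Finset ℂ} {δ : ℝ}

theorem collarInv_lt_one (hδ : 0 < δ) (hδ1 : δ < 1) {r : ℝ} (hr0 : 0 < r) (hr : r < 1) :
    collarInv hδ r < 1 := by
  by_contra hcon
  have h1 := collar_collarInv hδ hr0
  rw [collar_of_le hδ (by linarith)] at h1
  linarith

/-- The norm is singular only at the origin, and near it the defect exceeds `δ`, so the map is the
identity. -/
theorem contDiffOn_radialScale {θ : ℝ → ℝ} (hθ : ContDiffOn ℝ ∞ θ (Ioi 0)) (hδ1 : δ < 1)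
    (hδ : ∀ u, δ ≤ u → θ u = u) (h1 : ∀ u, 0 < u → u < 1 → θ u < 1) :
    ContDiffOn ℝ ∞ (radialScale θ) (Metric.ball 0 1) := by
  intro y hy
  refine ContDiffAt.contDiffWithinAt ?_
  have hd : 0 < defect y := defect_pos_iff.2 (by simpa using hy)
  by_cases hy0 : y = 0
  · have hopen : IsOpen {y | δ < defect y} := isOpen_lt continuous_const contDiff_defect.continuous
    refine contDiffAt_id.congr_of_eventuallyEq ?_
    filter_upwards [hopen.mem_nhds (show δ < defect y by simpa [hy0, defect] using hδ1)] with x hx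
    exact radialScale_of_eq (hδ _ (le_of_lt hx))
  · have hn : 0 < ‖y‖ ^ 2 := by positivity
    have hd1 : defect y < 1 := by unfold defect; linarith
    have h2 : ContDiffAt ℝ ∞ (fun y => θ (defect y)) y :=
      (hθ.contDiffAt (Ioi_mem_nhds hd)).comp y contDiff_defect.contDiffAt
    refine ContDiffAt.smul (ContDiffAt.sqrt ((contDiffAt_const.sub h2).div
      (contDiff_norm_sq ℝ).contDiffAt hn.ne') ?_) contDiffAt_id
    exact (div_pos (sub_pos.2 (h1 _ hd hd1)) hn).ne'

theorem radialScale_collarInv (hδ : 0 < δ) (hδ1 : δ < 1) {x : ℂ} (hx : ‖x‖ < 1) :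
    ‖radialScale (collarInv hδ) x‖ < 1 ∧
      radialScale (collar δ) (radialScale (collarInv hδ) x) = x := by
  have hd := defect_pos_iff.2 hx
  by_cases hx0 : x = 0
  · simp [hx0, radialScale]
  have hd1 : defect x < 1 := by
    have : 0 < ‖x‖ ^ 2 := by positivity
    unfold defect
    linarith
  have h1 : defect (radialScale (collarInv hδ) x) = collarInv hδ (defect x) :=
    defect_radialScale hx0 (collarInv_lt_one hδ hδ1 hd hd1).le
  have h2 : ‖radialScale (collarInv hδ) x‖ < 1 := by
    rw [← defect_pos_iff, h1]
    exact collarInv_pos hδ _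
  refine ⟨h2, eq_of_defect_eq (c := _) (mul_nonneg (Real.sqrt_nonneg _) (Real.sqrt_nonneg _))
    (smul_smul _ _ _) ?_⟩
  rw [(isCollar_collar hδ).defect_radialScale hδ1 h2.le, h1, collar_collarInv hδ hd]

theorem norm_radialScale_collar_lt (hδ : 0 < δ) (hδ1 : δ < 1) {y : ℂ} (hy : ‖y‖ < 1) :
    ‖radialScale (collar δ) y‖ < 1 := by
  rw [← defect_pos_iff, (isCollar_collar hδ).defect_radialScale hδ1 hy.le]
  exact collar_pos (defect_pos_iff.2 hy)

variable (hδ : 0 < δ) (hδ1 : δ < 1) (hz : ∀ a ∈ z, ‖a‖ + δ < 1)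

/-- The radial homeomorphism that flattens diffeomorphisms at the boundary. -/
noncomputable def collarHomeo : homeoDisc z := radialHomeo hδ1 hz (isCollar_collar hδ)

/-- Conjugation by the collar homeomorphism, followed by the extension to the plane. -/
noncomputable def flattenHom : homeoDisc z →* planeHomeo z :=
  (extendHom z).comp (MulAut.conj (collarHomeo hδ hδ1 hz)⁻¹).toMonoidHom

theorem flattenHom_eq (f : homeoDisc z) : flattenHom hδ hδ1 hz f =
    (extendHom z (collarHomeo hδ hδ1 hz))⁻¹ * extendHom z f *
      extendHom z (collarHomeo hδ hδ1 hz) := by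
  simp [flattenHom]

theorem extendHom_collarHomeo_apply {y : ℂ} (hy : ‖y‖ ≤ 1) :
    (extendHom z (collarHomeo hδ hδ1 hz) : ℂ ≃ₜ ℂ) y = radialScale (collar δ) y := by
  rw [extendHom_apply, extendDisc_of_mem (show y ∈ disc from hy)]
  rfl

theorem flattenHom_apply (f : homeoDisc z) {y : ℂ} (hy : ‖y‖ < 1) :
    (flattenHom hδ hδ1 hz f : ℂ ≃ₜ ℂ) y =
      radialScale (collarInv hδ) (extendDisc (f : disc ≃ₜ disc) (radialScale (collar δ) y)) := by
  have h1 := norm_radialScale_collar_lt hδ hδ1 hy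
  have h2 : ‖extendDisc (f : disc ≃ₜ disc) (radialScale (collar δ) y)‖ < 1 :=
    norm_lt_of_mem (extendHom z f).2 h1
  obtain ⟨h3, h4⟩ := radialScale_collarInv hδ hδ1 h2
  rw [flattenHom_eq]
  change ((extendHom z (collarHomeo hδ hδ1 hz) : ℂ ≃ₜ ℂ)).symm ((extendHom z f : ℂ ≃ₜ ℂ)
    ((extendHom z (collarHomeo hδ hδ1 hz) : ℂ ≃ₜ ℂ) y)) = _
  rw [Homeomorph.symm_apply_eq, extendHom_collarHomeo_apply hδ hδ1 hz hy.le,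
    extendHom_collarHomeo_apply hδ hδ1 hz h3.le, h4]
  rfl

theorem smoothFamilyOn_flattenHom_ball :
    SmoothFamilyOn (fun (f : DiffDisc z) y =>
      (flattenHom hδ hδ1 hz (diffInclusion _ f) : ℂ ≃ₜ ℂ) y) (univ ×ˢ Metric.ball 0 1) := by
  have h1 : ContDiffOn ℝ ∞ (radialScale (collar δ)) (Metric.ball 0 1) :=
    contDiffOn_radialScale (contDiff_collar δ).contDiffOn hδ1 (fun _ => collar_of_le hδ)
      fun u hu hu1 => by
        have h := (isCollar_collar hδ).strictMonoOn ⟨hu.le, hu1.le⟩ (right_mem_Icc.2 zero_le_one) hu1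
        rwa [collar_of_le hδ hδ1.le] at h
  have h2 : ContDiffOn ℝ ∞ (radialScale (collarInv hδ)) (Metric.ball 0 1) :=
    contDiffOn_radialScale (contDiffOn_collarInv hδ) hδ1 (fun _ => collarInv_of_le hδ)
      fun u hu hu1 => collarInv_lt_one hδ hδ1 hu hu1
  have hmaps : ∀ p ∈ (univ : Set (DiffDisc z)) ×ˢ Metric.ball (0 : ℂ) 1,
      radialScale (collar δ) p.2 ∈ Metric.ball (0 : ℂ) 1 := fun p hp => by
    have hp2 := hp.2
    rw [mem_ball_zero_iff] at hp2 ⊢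
    exact norm_radialScale_collar_lt hδ hδ1 hp2
  refine (SmoothFamilyOn.contDiffOn_comp h2 Metric.isOpen_ball
    (smoothFamilyOn_extendDisc_ball.comp (SmoothFamilyOn.contDiffOn_comp h1 Metric.isOpen_ball .id
      fun p hp => hp.2) fun p hp => ⟨mem_univ _, hmaps p hp⟩) fun p hp => ?_).congr fun p hp => ?_
  · have := hmaps p hp
    rw [mem_ball_zero_iff] at this ⊢
    exact norm_lt_of_mem (extendHom z (diffInclusion _ p.1)).2 this
  · exact flattenHom_apply hδ hδ1 hz _ (by simpa using hp.2)

theorem polarSquare_eq_radialScale {y₀ y : ℂ} (hy₀ : ‖y₀‖ = 1) (hy : y ≠ 0) (θ : ℝ → ℝ) :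
    polarSquare y₀ (2 * θ (defect y), 1 / 2 + (Complex.log (y / y₀)).im) = radialScale θ y := by
  have hy₀0 : y₀ ≠ 0 := norm_pos_iff.1 (by rw [hy₀]; exact one_pos)
  have h1 := Complex.norm_mul_exp_arg_mul_I (y / y₀)
  rw [norm_div, hy₀, div_one] at h1
  have hn : (‖y‖ : ℂ) ≠ 0 := Complex.ofReal_ne_zero.2 (norm_ne_zero_iff.2 hy)
  have h2 : y = ‖y‖ * Complex.exp ((y / y₀).arg * Complex.I) * y₀ := by
    rw [h1, div_mul_cancel₀ _ hy₀0]
  rw [polarSquare, radialScale, Complex.log_im, add_sub_cancel_left, mul_div_cancel_left₀ _ two_ne_zero,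
    Real.sqrt_div' _ (sq_nonneg _), Real.sqrt_sq (norm_nonneg y), Complex.real_smul]
  refine Eq.trans ?_ (congrArg (fun w : ℂ => ((√(1 - θ (defect y)) / ‖y‖ : ℝ) : ℂ) * w) h2.symm)
  push_cast
  field_simp

end Flatten

/-! ### Smoothness of the flattened map across the unit circle -/

section FlattenBoundary

theorem SmoothFamilyOn.isOpen_inter_Ioi {Λ E : Type} [TopologicalSpace Λ] [NormedAddCommGroup E]
    [NormedSpace ℝ E] {f : Λ → E → ℝ} {S : Set (Λ × E)} (hf : SmoothFamilyOn f S) (hS : IsOpen S)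
    (c : ℝ) : IsOpen (S ∩ {p | c < f p.1 p.2}) :=
  hf.continuousOn.isOpen_inter_preimage hS isOpen_Ioi

theorem radialScale_of_eq_zero {θ : ℝ → ℝ} {y : ℂ} (h : θ (defect y) = 0) :
    radialScale θ y = ‖y‖⁻¹ • y := by
  rw [radialScale, h, sub_zero, one_div, Real.sqrt_inv, Real.sqrt_sq (norm_nonneg y)]

theorem collar_le_self {δ u : ℝ} (hδ : 0 < δ) (hu0 : 0 ≤ u) (hu : u ≤ δ / 2) : collar δ u ≤ u := by
  rw [collar_of_le_half hδ hu]
  exact (expNegInvGlue_le_self (expNegInvGlue.nonneg u)).trans (expNegInvGlue_le_self hu0)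

/-- A collar neighbourhood of the point `y₀` of the unit circle. -/
def boundaryNhd (δ : ℝ) (y₀ : ℂ) : Set ℂ :=
  {y | y / y₀ ∈ Complex.slitPlane} ∩ {y | |(Complex.log (y / y₀)).im| < 1 / 2} ∩
    {y | defect y < δ / 2}

/-- The coordinates on a collar neighbourhood, composed with the flattening of the collar. -/
noncomputable def boundaryCoord (δ : ℝ) (y₀ y : ℂ) : ℝ × ℝ :=
  (2 * collar δ (defect y), 1 / 2 + (Complex.log (y / y₀)).im)

variable {z : Finset ℂ} {δ : ℝ} {y₀ : ℂ}

theorem contDiffOn_log_div (y₀ : ℂ) :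
    ContDiffOn ℝ ∞ (fun y => (Complex.log (y / y₀)).im) {y | y / y₀ ∈ Complex.slitPlane} := by
  intro y hy
  have h1 : ContDiffAt ℂ ∞ (fun y => Complex.log (y / y₀)) y :=
    (Complex.contDiffAt_log hy).comp y (contDiffAt_id.div_const _)
  exact (Complex.imCLM.contDiff.contDiffAt.comp y (h1.restrict_scalars ℝ)).contDiffWithinAt

theorem isOpen_boundaryNhd (δ : ℝ) (y₀ : ℂ) : IsOpen (boundaryNhd δ y₀) := by
  have h1 : IsOpen {y | y / y₀ ∈ Complex.slitPlane} :=
    Complex.isOpen_slitPlane.preimage (continuous_id.div_const y₀)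
  exact ((contDiffOn_log_div y₀).continuousOn.abs.isOpen_inter_preimage h1 isOpen_Iio).inter
    (isOpen_lt contDiff_defect.continuous continuous_const)

theorem mem_boundaryNhd (hδ : 0 < δ) (hy₀ : ‖y₀‖ = 1) : y₀ ∈ boundaryNhd δ y₀ := by
  have h0 : y₀ ≠ 0 := norm_pos_iff.1 (by rw [hy₀]; exact one_pos)
  refine ⟨⟨?_, ?_⟩, ?_⟩
  · simp [div_self h0]
  · simp [div_self h0]
  · simp only [mem_ofPred_eq, defect_eq_zero_iff.2 hy₀]
    linarith

theorem ne_zero_of_mem_boundaryNhd {y : ℂ} (hy : y ∈ boundaryNhd δ y₀) : y ≠ 0 := by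
  rintro rfl
  have := Complex.slitPlane_ne_zero hy.1.1
  simp at this

theorem contDiffOn_boundaryCoord (δ : ℝ) (y₀ : ℂ) :
    ContDiffOn ℝ ∞ (boundaryCoord δ y₀) (boundaryNhd δ y₀) :=
  ((contDiff_const.mul ((contDiff_collar δ).comp contDiff_defect)).contDiffOn).prodMk
    (contDiffOn_const.add ((contDiffOn_log_div y₀).mono fun _ hy => hy.1.1))

theorem boundaryCoord_mem (hδ : 0 < δ) (hδ1 : δ < 1) {y : ℂ} (hy : y ∈ boundaryNhd δ y₀) :
    boundaryCoord δ y₀ y ∈ Icc (0 : ℝ × ℝ) 1 := by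
  have h1 : |(Complex.log (y / y₀)).im| < 1 / 2 := hy.1.2
  have h2 : defect y < δ / 2 := hy.2
  rw [abs_lt] at h1
  refine mem_square_iff.2 ⟨?_, by simp only [boundaryCoord, mem_Icc]; constructor <;> linarith⟩
  simp only [boundaryCoord, mem_Icc]
  rcases le_or_gt (defect y) 0 with h | h
  · rw [collar_of_nonpos hδ h]
    norm_num
  · have h3 := collar_pos (δ := δ) h
    have h4 := collar_le_self hδ h.le h2.le
    constructor <;> linarith

variable (hδ : 0 < δ) (hδ1 : δ < 1) (hz : ∀ a ∈ z, ‖a‖ + δ < 1)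

/-- The flattened map has the direction of `P` and the defect `u / D`, where `u` is the defect of
`y`. Both are smooth up to and beyond the circle, because the collar and `e` are extended by zero to
`u ≤ 0`; there the formula reduces to the identity. -/
theorem exists_smooth_flattenHom_boundary (f₀ : DiffDisc z) (hy₀ : ‖y₀‖ = 1) :
    ∃ W : Set (DiffDisc z × ℂ), IsOpen W ∧ (f₀, y₀) ∈ W ∧
      SmoothFamilyOn (fun (f : DiffDisc z) y =>
        (flattenHom hδ hδ1 hz (diffInclusion _ f) : ℂ ≃ₜ ℂ) y) W := by
  obtain ⟨b, hb, hbf, hbpos⟩ := exists_defect_factor (z := z) (f := id) continuous_id hy₀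
  set X := boundaryCoord δ y₀ with hX
  set S₀ : Set (DiffDisc z × ℂ) := univ ×ˢ boundaryNhd δ y₀ with hS₀
  have hS₀o : IsOpen S₀ := isOpen_univ.prod (isOpen_boundaryNhd δ y₀)
  have hXs : SmoothFamilyOn (fun (_ : DiffDisc z) y => X y) S₀ :=
    .of_contDiffOn (contDiffOn_boundaryCoord δ y₀) (isOpen_boundaryNhd δ y₀).uniqueDiffOn
      fun p hp => hp.2
  have hXm : ∀ p ∈ S₀, (p.1, X p.2) ∈ (univ : Set (DiffDisc z)) ×ˢ Icc (0 : ℝ × ℝ) 1 :=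
    fun p hp => ⟨mem_univ _, boundaryCoord_mem hδ hδ1 hp.2⟩
  set P : DiffDisc z → ℂ → ℂ := fun f y => extendDisc (f : disc ≃ₜ disc) (polarSquare y₀ (X y)) with hP
  -- The factor `2` appears because the first coordinate of the square is twice the defect.
  set B : DiffDisc z → ℂ → ℝ := fun f y => 2 * b f (X y) with hB
  set e : DiffDisc z → ℂ → ℝ := fun _ y => expNegInvGlue (defect y) with he
  set L : DiffDisc z → ℂ → ℝ := fun f y => 1 - e f y * Real.log (B f y) with hL
  set D : DiffDisc z → ℂ → ℝ := fun f y => 1 + defect y * Real.log (L f y) with hD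
  have hPs : SmoothFamilyOn P S₀ := by
    refine SmoothFamilyOn.comp (g := fun (f : DiffDisc z) t =>
      extendDisc (f : disc ≃ₜ disc) (polarSquare y₀ t)) (smoothFamilyOn_extendDisc (z := z) (φ := polarSquare y₀)
      ((contDiffOn_polarSquare y₀).mono fun t ht => ?_) fun t ht => ?_) hXs hXm
    · have := (mem_square_iff.1 ht).1.2
      change t.1 < 2
      linarith
    · have := (mem_square_iff.1 ht).1
      rw [← defect_nonneg_iff, defect_polarSquare hy₀ (by linarith [this.2])]
      linarith [this.1]
  have hBs : SmoothFamilyOn B S₀ := (SmoothFamilyOn.const' 2).mul (hb.comp hXs hXm)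
  have hus : SmoothFamilyOn (fun (_ : DiffDisc z) y => defect y) univ := .of_contDiff contDiff_defect
  have hes : SmoothFamilyOn e univ := .contDiff_comp expNegInvGlue.contDiff hus
  set S₁ := S₀ ∩ {p | 0 < B p.1 p.2} with hS₁
  have hS₁o : IsOpen S₁ := hBs.isOpen_inter_Ioi hS₀o 0
  have hLs : SmoothFamilyOn L S₁ := (SmoothFamilyOn.const' 1).sub ((hes.mono (subset_univ _)).mul
    ((hBs.mono inter_subset_left).rlog fun p hp => (show 0 < B p.1 p.2 from hp.2).ne'))
  set S₂ := S₁ ∩ {p | 0 < L p.1 p.2} with hS₂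
  have hS₂o : IsOpen S₂ := hLs.isOpen_inter_Ioi hS₁o 0
  have hDs : SmoothFamilyOn D S₂ := (SmoothFamilyOn.const' 1).add ((hus.mono (subset_univ _)).mul
    ((hLs.mono inter_subset_left).rlog fun p hp => (show 0 < L p.1 p.2 from hp.2).ne'))
  set S₃ := S₂ ∩ {p | 0 < D p.1 p.2} with hS₃
  have hS₃o : IsOpen S₃ := hDs.isOpen_inter_Ioi hS₂o 0
  have h30 : S₃ ⊆ S₀ := fun p hp => hp.1.1.1
  have hqs : SmoothFamilyOn (fun f y => defect y / D f y) S₃ := (hus.mono (subset_univ _)).rdiv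
    (hDs.mono inter_subset_left) fun p hp => (show 0 < D p.1 p.2 from hp.2).ne'
  -- This keeps the new defect in the range where the collar is exactly `e(e(u))`, as
  -- `collarInv_mul` requires.
  set S₄ := S₃ ∩ {p | 1 - δ / 2 < 1 - defect p.2 / D p.1 p.2} with hS₄
  have hqs' := (SmoothFamilyOn.const' (1 : ℝ) (S := S₃) (Λ := DiffDisc z) (E := ℂ)).sub hqs
  have hS₄o : IsOpen S₄ := hqs'.isOpen_inter_Ioi hS₃o (1 - δ / 2)
  have hP4 := hPs.mono (inter_subset_left.trans h30 : S₄ ⊆ S₀)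
  set S₅ := S₄ ∩ {p | 0 < ‖P p.1 p.2‖ ^ 2} with hS₅
  have hS₅o : IsOpen S₅ := hP4.norm_sq.isOpen_inter_Ioi hS₄o 0
  have hP5 := hP4.mono (inter_subset_left : S₅ ⊆ S₄)
  have hq5 := hqs'.mono (inter_subset_left.trans inter_subset_left : S₅ ⊆ S₃)
  have hnum : ∀ p ∈ S₅, 0 < 1 - defect p.2 / D p.1 p.2 := fun p hp => by
    have : 1 - δ / 2 < 1 - defect p.2 / D p.1 p.2 := hp.1.2
    linarith
  have hX₀ : X y₀ = (0, 1 / 2) := by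
    have h0 : y₀ ≠ 0 := norm_pos_iff.1 (by rw [hy₀]; exact one_pos)
    rw [hX, boundaryCoord, defect_eq_zero_iff.2 hy₀, collar_of_nonpos hδ le_rfl, div_self h0]
    simp
  have hd₀ : defect y₀ = 0 := defect_eq_zero_iff.2 hy₀
  have hL₀ : L f₀ y₀ = 1 := by simp [hL, he, hd₀]
  have hD₀ : D f₀ y₀ = 1 := by simp [hD, hd₀]
  refine ⟨S₅, hS₅o, ⟨⟨⟨⟨⟨⟨mem_univ _, mem_boundaryNhd hδ hy₀⟩, ?_⟩, ?_⟩, ?_⟩, ?_⟩, ?_⟩,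
    (((hq5.rdiv hP5.norm_sq fun p hp => (show 0 < ‖P p.1 p.2‖ ^ 2 from hp.2).ne').rsqrt
      fun p hp => div_pos (hnum p hp) hp.2).smul hP5).congr ?_⟩
  · change 0 < 2 * b f₀ (X y₀)
    rw [hX₀]
    have := hbpos f₀
    positivity
  · change 0 < L f₀ y₀
    rw [hL₀]
    exact one_pos
  · change 0 < D f₀ y₀
    rw [hD₀]
    exact one_pos
  · change 1 - δ / 2 < 1 - defect y₀ / D f₀ y₀
    rw [hd₀]
    simpa using hδ
  · change 0 < ‖P f₀ y₀‖ ^ 2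
    simp only [hP]
    rw [hX₀, polarSquare_zero, extendDisc_of_le f₀.2.2.1 hy₀.ge, hy₀]
    norm_num
  rintro ⟨f, y⟩ hp
  have hy : y ∈ boundaryNhd δ y₀ := (h30 hp.1.1).2
  have hy0 := ne_zero_of_mem_boundaryNhd hy
  have hpolar : polarSquare y₀ (X y) = radialScale (collar δ) y :=
    polarSquare_eq_radialScale hy₀ hy0 (collar δ)
  have hB0 : 0 < B f y := hp.1.1.1.1.2
  have hL0 : 0 < L f y := hp.1.1.1.2
  have hD0 : 0 < D f y := hp.1.1.2
  have hq0 : defect y / D f y ≤ δ / 2 := by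
    have : 1 - δ / 2 < 1 - defect y / D f y := hp.1.2
    linarith
  change _ = √((1 - defect y / D f y) / ‖P f y‖ ^ 2) • P f y
  -- Inside the disc the formula is `collarInv_mul`. On and outside the circle `D = 1` and `P =
  -- y/‖y‖`, so the right side is `‖y‖ • y/‖y‖ = y`.
  rcases lt_or_ge 0 (defect y) with hu | hu
  · have hdef : defect (P f y) = collar δ (defect y) * B f y := by
      refine (hbf f (X y) (boundaryCoord_mem hδ hδ1 hy)).trans ?_
      simp only [hB, hX, boundaryCoord]
      ring
    have hinv : collarInv hδ (defect (P f y)) = defect y / D f y := by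
      rw [hdef]
      exact collarInv_mul hδ hu (le_of_lt hy.2) hB0 hL0 hD0 hq0
    rw [← hinv, flattenHom_apply hδ hδ1 hz _ (defect_pos_iff.1 hu)]
    simp only [hP, hpolar]
    rfl
  · have hy1 : 1 ≤ ‖y‖ := by
      by_contra hcon
      exact absurd (defect_pos_iff.2 (not_le.1 hcon)) (not_lt.2 hu)
    have hn : 0 < ‖y‖ := by linarith
    have he0 : e f y = 0 := expNegInvGlue.zero_of_nonpos hu
    have hD1 : D f y = 1 := by simp [hD, hL, he0]
    have hPy : P f y = ‖y‖⁻¹ • y := by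
      simp only [hP]
      rw [hpolar, radialScale_of_eq_zero (collar_of_nonpos hδ hu)]
      refine extendDisc_of_le f.2.2.1 ?_
      rw [norm_smul, norm_inv, norm_norm, inv_mul_cancel₀ hn.ne']
    have hPn : ‖P f y‖ = 1 := by
      rw [hPy, norm_smul, norm_inv, norm_norm, inv_mul_cancel₀ hn.ne']
    rw [(flattenHom hδ hδ1 hz _).2.1 y hy1, hPn, hPy, hD1, div_one, defect, sub_sub_cancel, one_pow,
      div_one, Real.sqrt_sq hn.le, smul_smul, mul_inv_cancel₀ hn.ne', one_smul]

theorem smoothFamilyOn_flattenHom :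
    SmoothFamilyOn (fun (f : DiffDisc z) y =>
      (flattenHom hδ hδ1 hz (diffInclusion _ f) : ℂ ≃ₜ ℂ) y) univ := by
  refine SmoothFamilyOn.of_local_isOpen isOpen_univ fun p _ => ?_
  simp only [univ_inter]
  rcases lt_trichotomy ‖p.2‖ 1 with h | h | h
  · exact ⟨univ ×ˢ Metric.ball 0 1, isOpen_univ.prod Metric.isOpen_ball, by simpa using h,
      smoothFamilyOn_flattenHom_ball hδ hδ1 hz⟩
  · exact exists_smooth_flattenHom_boundary hδ hδ1 hz p.1 h
  · exact ⟨{p | 1 < ‖p.2‖}, isOpen_lt continuous_const continuous_snd.norm, h,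
      SmoothFamilyOn.id.congr fun p hp => (flattenHom hδ hδ1 hz _).2.1 _ (le_of_lt hp)⟩

theorem flattenHom_mem (f : DiffDisc z) :
    (flattenHom hδ hδ1 hz (diffInclusion _ f) : ℂ ≃ₜ ℂ) ∈ planeDiffeo z := by
  have h : ∀ f : DiffDisc z, ContDiff ℝ ∞ (flattenHom hδ hδ1 hz (diffInclusion _ f) : ℂ ≃ₜ ℂ) :=
    fun f => contDiffOn_univ.1 ((smoothFamilyOn_flattenHom hδ hδ1 hz).contDiffOn (l := f)
      fun _ _ => mem_univ _)
  refine ⟨(flattenHom hδ hδ1 hz _).2, h f, ?_⟩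
  have := h f⁻¹
  rwa [map_inv, map_inv] at this

/-- Flattening, as a homomorphism to the diffeomorphisms of the plane. -/
noncomputable def flattenDiffeoHom : DiffDisc z →* planeDiffeo z :=
  ((planeHomeo z).subtype.comp ((flattenHom hδ hδ1 hz).comp (diffInclusion _))).codRestrict
    (planeDiffeo z) (flattenHom_mem hδ hδ1 hz)

theorem mk_liftHom_flattenHom (hz1 : ∀ a ∈ z, ‖a‖ < 1) (f : homeoDisc z) :
    (QuotientGroup.mk (liftHom hz1 (flattenHom hδ hδ1 hz f)) : TopMod (homeoSurface z)) =
      QuotientGroup.mk (liftHom hz1 (extendHom z f)) := by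
  have h1 : (QuotientGroup.mk (liftHom hz1 (extendHom z (collarHomeo hδ hδ1 hz))) :
      TopMod (homeoSurface z)) = 1 :=
    (QuotientGroup.eq_one_iff _).2 (liftHom_radialHomeo_mem hz1 hδ1 hz (isCollar_collar hδ))
  rw [flattenHom_eq, map_mul, map_mul, map_inv, QuotientGroup.mk_mul, QuotientGroup.mk_mul,
    QuotientGroup.mk_inv, h1, inv_one, one_mul, mul_one]

end FlattenBoundary

theorem IsSmooth.continuous {E F : Type*} [NormedAddCommGroup E] [NormedSpace ℝ E]
    [NormedAddCommGroup F] [NormedSpace ℝ F] {X : Set E} {f : X → F} (hf : IsSmooth f) :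
    Continuous f := by
  rw [continuous_iff_continuousAt]
  intro x
  obtain ⟨U, hU, f', hf', hfU⟩ := hf x
  have h1 : ContinuousAt (fun y : X => f' y) x :=
    (hf'.continuousOn.continuousAt hU).comp continuousAt_subtype_val
  refine h1.congr ?_
  filter_upwards [continuousAt_subtype_val.preimage_mem_nhds hU] with y hy using hfU y hy

/-! ### The geometric homomorphism and its realization -/

section Realization

variable {z : Finset ℂ} {δ : ℝ}

/-- The canonical lift of diffeomorphisms of the disc to the branched double cover. -/
noncomputable def canonicalLift (hz : ∀ a ∈ z, ‖a‖ < 1) : DiffDisc z →* HomeoSurface z :=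
  (liftHom hz).comp ((extendHom z).comp (diffInclusion _))

theorem isLift_iff (hz : ∀ a ∈ z, ‖a‖ < 1) (f : DiffDisc z) (h : HomeoSurface z) :
    IsLift z f h ↔ h = canonicalLift hz f := by
  have happ : ∀ q : surface z, (extendHom z (diffInclusion _ f) : ℂ ≃ₜ ℂ) q.1.1 =
      (f : disc ≃ₜ disc) (proj z q) := fun q => extendDisc_of_mem (show q.1.1 ∈ disc from q.2.1)
  constructor
  · intro hlift
    refine Subtype.ext (Homeomorph.ext fun q => Subtype.ext ?_)
    refine eq_curveLift_of_isLift hz (extendHom z (diffInclusion _ f)).2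
      (k := fun q => ((h : surface z ≃ₜ surface z) q : ℂ × ℂ))
      (continuous_subtype_val.comp (h : surface z ≃ₜ surface z).continuous)
      (fun q => ((h : surface z ≃ₜ surface z) q).2.2) (fun q => ?_) (fun q hq => ?_) q
    · rw [happ]
      exact congrArg Subtype.val (hlift q)
    · exact congrArg Subtype.val (h.2 q hq)
  · rintro rfl q
    exact Subtype.ext (happ q)

/-- The canonical lift is jointly continuous in families, so it carries a smooth isotopy to a
continuous one; hence it descends to mapping classes. -/
theorem smoothIsotopyOne_le (hz : ∀ a ∈ z, ‖a‖ < 1) :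
    smoothIsotopyOne (homeoDisc z) ≤ (isotopyOne (homeoSurface z)).comap (canonicalLift hz) := by
  rintro f ⟨H, hH, H0, H1⟩
  refine ⟨fun t => canonicalLift hz (H t), ?_, by simp [H0], by simp [H1]⟩
  refine continuous_liftHom_family hz (h := fun t => extendHom z (diffInclusion _ (H t)))
    (continuous_extendDisc_family (f := fun t => (H t : disc ≃ₜ disc)) (fun t => (H t).2.2.1) ?_)
  exact Continuous.subtype_mk (hH.continuous.comp
    (f := fun p : I × disc => (⟨(p.1, p.2), p.1.2, p.2.2⟩ : (Icc (0 : ℝ) 1 ×ˢ disc : Set (ℝ × ℂ))))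
    (by fun_prop)) _

/-- The geometric homomorphism. -/
noncomputable def geometricHom (hz : ∀ a ∈ z, ‖a‖ < 1) : BraidGroup z →* ModSurface z :=
  QuotientGroup.map _ _ (canonicalLift hz) (smoothIsotopyOne_le hz)

theorem IsSeparated.lt_one (hδ : IsSeparated z δ) : δ < 1 := by
  have := hδ.le_half
  linarith

/-- The lift of the flattened and blown up diffeomorphism. -/
noncomputable def smoothLift (hδ : IsSeparated z δ) : DiffDisc z →* HomeoSurface z :=
  (liftHom fun _ => hδ.norm_lt_one).comp ((blowHom hδ hδ.pos le_rfl).comp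
    (flattenDiffeoHom hδ.pos hδ.lt_one hδ.norm_add_lt))

/-- The underlying map of the lift. -/
noncomputable def smoothLiftMap (hδ : IsSeparated z δ) (f : DiffDisc z) : ℂ × ℂ → ℂ × ℂ :=
  curveLift z (blowHom hδ hδ.pos le_rfl (flattenDiffeoHom hδ.pos hδ.lt_one hδ.norm_add_lt f))

theorem exists_smooth_smoothLift (hδ : IsSeparated z δ) (p : DiffDisc z × ℂ × ℂ)
    (_ : p.2 ∈ surface z) :
    ∃ (W : Set (DiffDisc z × ℂ × ℂ)) (Φ : DiffDisc z → ℂ × ℂ → ℂ × ℂ), IsOpen W ∧ p ∈ W ∧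
      SmoothFamilyOn Φ W ∧ ∀ p ∈ W, p.2 ∈ surface z →
        smoothLiftMap hδ p.1 p.2 = Φ p.1 p.2 := by
  obtain ⟨W, Φ, hW, hpW, hΦ, h⟩ := exists_smooth_curveLift_blow hδ hδ.pos le_rfl
    (h := flattenDiffeoHom hδ.pos hδ.lt_one hδ.norm_add_lt)
    (smoothFamilyOn_flattenHom hδ.pos hδ.lt_one hδ.norm_add_lt) p
  exact ⟨W, Φ, hW, hpW, hΦ, fun p hp hs => h p hp hs.2⟩

theorem smoothLift_mem (hδ : IsSeparated z δ) (f : DiffDisc z) :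
    (smoothLift hδ f : surface z ≃ₜ surface z) ∈ diffIn (homeoSurface z) := by
  have h := isSmooth_of_smoothFamilyOn (f := smoothLiftMap hδ) (exists_smooth_smoothLift hδ)
  refine ⟨⟨h f, ?_⟩, (smoothLift hδ f).2⟩
  have := h f⁻¹
  change IsSmooth fun x => (((smoothLift hδ f)⁻¹ : HomeoSurface z) : surface z ≃ₜ surface z) x |>.1
  rw [← map_inv]
  exact this

/-- The realization of the geometric homomorphism by diffeomorphisms. -/
noncomputable def realization (hδ : IsSeparated z δ) : DiffDisc z →* DiffSurface z :=
  ((homeoSurface z).subtype.comp (smoothLift hδ)).codRestrict _ (smoothLift_mem hδ)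

theorem continuous_realization (hδ : IsSeparated z δ) : Continuous (realization hδ) :=
  continuous_of_smoothFamilyOn fun c =>
    smoothFamilyOn_comp_square (f := smoothLiftMap hδ) (exists_smooth_smoothLift hδ) c

theorem mk_realization (hδ : IsSeparated z δ) (f : DiffDisc z) :
    (QuotientGroup.mk (diffInclusion _ (realization hδ f)) : ModSurface z) =
      QuotientGroup.mk (canonicalLift (fun _ => hδ.norm_lt_one) f) :=
  (mk_liftHom_blowHom (fun _ => hδ.norm_lt_one) hδ hδ.pos le_rfl _).trans
    (mk_liftHom_flattenHom hδ.pos hδ.lt_one hδ.norm_add_lt (fun _ => hδ.norm_lt_one) _)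

/-- The collar map lowers the defect, so it pushes points outward and keeps them in the region fixed
by `f`. The bound `1 - δ/4` guarantees a defect of at most `δ/2`, where the collar lies below the
identity. -/
theorem flattenHom_eq_self (hδ : 0 < δ) (hδ1 : δ < 1) (hz : ∀ a ∈ z, ‖a‖ + δ < 1)
    {f : homeoDisc z} {r : ℝ} (hf : ∀ x : disc, r < ‖(x : ℂ)‖ → (f : disc ≃ₜ disc) x = x) {y : ℂ}
    (hr : r < ‖y‖) (hy : 1 - δ / 4 ≤ ‖y‖) : (flattenHom hδ hδ1 hz f : ℂ ≃ₜ ℂ) y = y := by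
  rcases le_or_gt 1 ‖y‖ with h1 | h1
  · exact (flattenHom hδ hδ1 hz f).2.1 y h1
  have h2 : defect (radialScale (collar δ) y) ≤ defect y := by
    rw [(isCollar_collar hδ).defect_radialScale hδ1 h1.le]
    refine collar_le_self hδ (defect_nonneg_iff.2 h1.le) ?_
    unfold defect
    nlinarith
  have h3 : ‖y‖ ≤ ‖radialScale (collar δ) y‖ := by
    unfold defect at h2
    exact (pow_le_pow_iff_left₀ (norm_nonneg _) (norm_nonneg _) two_ne_zero).1 (by linarith)
  have h4 : (extendHom z f : ℂ ≃ₜ ℂ) (radialScale (collar δ) y) = radialScale (collar δ) y := by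
    have hm : radialScale (collar δ) y ∈ disc := (norm_radialScale_collar_lt hδ hδ1 h1).le
    rw [extendHom_apply, extendDisc_of_mem hm, hf ⟨_, hm⟩ (hr.trans_le h3)]
  rw [flattenHom_eq]
  change ((extendHom z (collarHomeo hδ hδ1 hz) : ℂ ≃ₜ ℂ)).symm ((extendHom z f : ℂ ≃ₜ ℂ)
    ((extendHom z (collarHomeo hδ hδ1 hz) : ℂ ≃ₜ ℂ) y)) = _
  rw [Homeomorph.symm_apply_eq, extendHom_collarHomeo_apply hδ hδ1 hz h1.le, h4]

theorem realization_eq_self_near_boundary (hδ : IsSeparated z δ) (f : DiffDisc z)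
    (hf : ∃ r : ℝ, r < 1 ∧ ∀ x : disc, r < ‖(x : ℂ)‖ → f.1 x = x) :
    ∃ r : ℝ, r < 1 ∧ ∀ q : surface z, r < ‖(proj z q : ℂ)‖ → (realization hδ f).1 q = q := by
  obtain ⟨r, hr, hfr⟩ := hf
  have hδ0 := hδ.pos
  have hlim : ∀ c < (1 : ℝ), ∀ᶠ m in 𝓝[<] (1 : ℝ), c < m := fun c hc =>
    nhdsWithin_le_nhds (lt_mem_nhds hc)
  -- Past norm `m` a point is beyond the `δ`-discs around `z`, in the region fixed by `f`, and
  -- within the flattened collar.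
  obtain ⟨m, ⟨⟨hm, hmr⟩, hmδ⟩, hm1⟩ := ((((Filter.eventually_all_finset z).2 fun a ha =>
    hlim _ (hδ.norm_add_lt a ha)).and (hlim r hr)).and (hlim (1 - δ / 4) (by linarith))).and
      (eventually_mem_nhdsWithin (s := Iio (1 : ℝ))) |>.exists
  refine ⟨m, hm1, fun q hq => Subtype.ext ?_⟩
  refine curveLift_eq_self (blowHom hδ hδ.pos le_rfl _).2 (fun a ha => ?_) fun y hy => ?_
  · have := hm a ha
    change m < ‖q.1.1‖ at hq
    linarith
  · change m < ‖q.1.1‖ at hq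
    have hmy : m < ‖y‖ := hq.trans_le hy
    exact blow_eq_self hδ.pos le_rfl hm hmy.le
      (flattenHom_eq_self hδ.pos hδ.lt_one hδ.norm_add_lt hfr (hmr.trans hmy)
        (hmδ.trans hmy).le)

end Realization

end BranchedLift

theorem theorem4p2 (g : ℕ) (hg : 1 ≤ g) (z : Finset ℂ) (hcard : z.card = 2 * g + 2)
    (hz : ∀ a ∈ z, ‖a‖ < 1) :
    -- the canonical lift `Ψ` and the geometric homomorphism `ψ` on mapping class groups
    ∃ (Ψ : BranchedLift.DiffDisc z →* BranchedLift.HomeoSurface z)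
      (ψ : BranchedLift.BraidGroup z →* BranchedLift.ModSurface z),
      (∀ (f : BranchedLift.DiffDisc z) (h : BranchedLift.HomeoSurface z),
        BranchedLift.IsLift z f h ↔ h = Ψ f) ∧
      (∀ f : BranchedLift.DiffDisc z,
        ψ (QuotientGroup.mk f) = QuotientGroup.mk (Ψ f)) ∧
      -- its realization by diffeomorphisms
      ∃ ρ : BranchedLift.DiffDisc z →* BranchedLift.DiffSurface z,
        Continuous ρ ∧
        (∀ f : BranchedLift.DiffDisc z,
          QuotientGroup.mk (BranchedLift.diffInclusion (BranchedLift.homeoSurface z) (ρ f)) =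
            ψ (QuotientGroup.mk f)) ∧
        -- if `f` is the identity near the boundary, so is `ρ f`
        (∀ f : BranchedLift.DiffDisc z,
          (∃ r : ℝ, r < 1 ∧ ∀ x : BranchedLift.disc, r < ‖(x : ℂ)‖ → f.1 x = x) →
          ∃ r : ℝ, r < 1 ∧ ∀ q : BranchedLift.surface z,
            r < ‖(BranchedLift.proj z q : ℂ)‖ → (ρ f).1 q = q) := by
  obtain ⟨δ, hδ⟩ := BranchedLift.exists_isSeparated hz
  exact ⟨BranchedLift.canonicalLift hz, BranchedLift.geometricHom hz, BranchedLift.isLift_iff hz,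
    fun _ => rfl, BranchedLift.realization hδ, BranchedLift.continuous_realization hδ,
    BranchedLift.mk_realization hδ, BranchedLift.realization_eq_self_near_boundary hδ⟩
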